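/- Let $V=\{V^i\}_{i\ge 2}$ be a graded vector space over $\mathbb{Q}$, let $\Lambda V$ be the free graded commutative algebra on $V$, and let $(\Lambda V,\partial)$ be a simply connected minimal Sullivan algebra, i.e. $\partial$ is a derivation of degree $+1$ with $\partial^2=0$ and $\partial(\Lambda V)\subseteq\Lambda^{\ge 2}V$ (and $V$ is the union of an increasing sequence $V(0)\subseteq V(1)\subseteq\cdots$ of graded subspaces with $\partial V(0)=0$ and $\partial V(k+1)\subseteq \Lambda V(k)$). Suppose that $(\Lambda V,\partial)$ is elliptic, i.e. $\dim H^*(\Lambda V)=\sum_{i\ge 0}\dim H^i(\Lambda V)<\infty$ and $\dim V=\sum_{i\ge 2}\dim V^i<\infty$. For $i\ge 2$ let $L^i=H^i(\Lambda (V^{\le i-2}))$, where $\Lambda(V^{\le i-2})$ is the subalgebra generated by $V^{\le i-2}$, which is stable under $\partial$, and put $L^{\mathrm{even}}=\bigoplus_{k\ge 2}L^{2k}$ and $L^{\mathrm{odd}}=\bigoplus_{k\ge 2}L^{2k+1}$ (note that $L^2=L^3=0$). Then $L^{\mathrm{even}}$ and $L^{\mathrm{odd}}$ are finite dimensional and $$\dim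 L^{\mathrm{even}}\ \ge\ \dim L^{\mathrm{odd}}.$$ Moreover, if $L^{\mathrm{even}}=0$, then $H^i(\Lambda V)\cong V^i$ for every $i\ge 2$, and $$\dim H^*(\Lambda V)=\dim V+1.$$ -/

import Mathlib

open scoped DirectSum

noncomputable section

namespace Sullivan

universe u

section FreeAlgebra

variable (V : ℕ → Type u) [∀ i, AddCommGroup (V i)] [∀ i, Module ℚ (V i)]

/-- The relations `v ⊗ w = (-1)^{deg v deg w} w ⊗ v`, for homogeneous `v, w`, in the tensor
algebra of the graded rational vector space `V = ⨁ i, V i`. -/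
inductive CommRel :
    TensorAlgebra ℚ (⨁ i, V i) → TensorAlgebra ℚ (⨁ i, V i) → Prop
  | comm (i j : ℕ) (v : V i) (w : V j) : CommRel
      (TensorAlgebra.ι ℚ (DirectSum.lof ℚ ℕ V i v) * TensorAlgebra.ι ℚ (DirectSum.lof ℚ ℕ V j w))
      ((-1 : ℚ) ^ (i * j) •
        (TensorAlgebra.ι ℚ (DirectSum.lof ℚ ℕ V j w) *
          TensorAlgebra.ι ℚ (DirectSum.lof ℚ ℕ V i v)))

/-- The free graded commutative algebra `ΛV` on the graded rational vector space `V`: the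
quotient of the tensor algebra by graded commutativity. (Squares of odd generators vanish,
as `2` is invertible.) -/
def FreeGCA : Type u := RingQuot (CommRel V)

instance : Ring (FreeGCA V) := inferInstanceAs (Ring (RingQuot (CommRel V)))

instance : Algebra ℚ (FreeGCA V) := inferInstanceAs (Algebra ℚ (RingQuot (CommRel V)))

/-- The quotient map from the tensor algebra of `V` onto `ΛV`. -/
def FreeGCA.mk : TensorAlgebra ℚ (⨁ i, V i) →ₐ[ℚ] FreeGCA V := RingQuot.mkAlgHom ℚ (CommRel V)

variable {V}

/-- The inclusion of the generators of degree `i` into `ΛV`. -/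
def gen (i : ℕ) : V i →ₗ[ℚ] FreeGCA V :=
  (FreeGCA.mk V).toLinearMap ∘ₗ TensorAlgebra.ι ℚ ∘ₗ DirectSum.lof ℚ ℕ V i

/-- The monomial `v₁ v₂ ⋯ vₖ` in `ΛV` given by a list of homogeneous elements of `V`. -/
def monomial (l : List (Σ i, V i)) : FreeGCA V := (l.map fun p => gen p.1 p.2).prod

variable (V)

/-- The homogeneous component `(ΛV)^n`, spanned by the monomials of total degree `n`. -/
def degreePart (n : ℕ) : Submodule ℚ (FreeGCA V) :=
  Submodule.span ℚ {x | ∃ l : List (Σ i, V i), (l.map fun p => p.1).sum = n ∧ monomial l = x}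

/-- `Λ^{≥ k} V`, spanned by the monomials of word length at least `k`. -/
def wordLengthGE (k : ℕ) : Submodule ℚ (FreeGCA V) :=
  Submodule.span ℚ {x | ∃ l : List (Σ i, V i), k ≤ l.length ∧ monomial l = x}

variable {V}

/-- The subalgebra `ΛW` of `ΛV` generated by a graded subspace `W` of `V`. -/
def subalgebraGenBy (W : ∀ i, Submodule ℚ (V i)) : Subalgebra ℚ (FreeGCA V) :=
  Algebra.adjoin ℚ {x | ∃ i, ∃ v ∈ W i, gen i v = x}

variable (V)

/-- The graded subspace `V^{≤ m}` of `V`. -/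
def truncation (m : ℕ) (i : ℕ) : Submodule ℚ (V i) := if i ≤ m then ⊤ else ⊥

/-- A differential on the graded algebra `ΛV`: a derivation of degree `+1` and square zero. -/
structure Differential where
  /-- the underlying linear map -/
  d : FreeGCA V →ₗ[ℚ] FreeGCA V
  /-- it raises the degree by one -/
  map_degree : ∀ n, ∀ x ∈ degreePart V n, d x ∈ degreePart V (n + 1)
  /-- the graded Leibniz rule -/
  leibniz : ∀ p, ∀ x ∈ degreePart V p, ∀ y, d (x * y) = d x * y + (-1 : ℚ) ^ p • (x * d y)
  /-- it squares to zero -/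
  d_d : ∀ x, d (d x) = 0

end FreeAlgebra

section Cohomology

variable {V : ℕ → Type u} [∀ i, AddCommGroup (V i)] [∀ i, Module ℚ (V i)]

namespace Differential

variable (D : Differential V)

/-- Cocycles of degree `n` in a subalgebra `S` of `ΛV`. -/
def cocycles (S : Subalgebra ℚ (FreeGCA V)) (n : ℕ) : Submodule ℚ (FreeGCA V) :=
  (Subalgebra.toSubmodule S ⊓ degreePart V n) ⊓ LinearMap.ker D.d

/-- Coboundaries of degree `n` in a subalgebra `S` of `ΛV`: the image of `S^{n-1}` under the
differential (zero for `n = 0`). -/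
def coboundaries (S : Subalgebra ℚ (FreeGCA V)) : ℕ → Submodule ℚ (FreeGCA V)
  | 0 => ⊥
  | n + 1 => (Subalgebra.toSubmodule S ⊓ degreePart V n).map D.d

/-- The cohomology `H^n(S)` of a graded subalgebra `S` of `ΛV` that is stable under the
differential. -/
abbrev cohomology (S : Subalgebra ℚ (FreeGCA V)) (n : ℕ) : Type u :=
  D.cocycles S n ⧸ (D.coboundaries S n).submoduleOf (D.cocycles S n)

/-- `H^n(ΛV)`. -/
abbrev H (n : ℕ) : Type u := D.cohomology ⊤ n

/-- `L^i = H^i(Λ(V^{≤ i-2}))`, for `i ≥ 2`. -/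
abbrev L (i : ℕ) : Type u := D.cohomology (subalgebraGenBy (truncation V (i - 2))) i

/-- `L^even = L^4 ⊕ L^6 ⊕ L^8 ⊕ ⋯`. -/
abbrev Leven : Type u := ⨁ k : ℕ, D.L (2 * k + 4)

/-- `L^odd = L^5 ⊕ L^7 ⊕ L^9 ⊕ ⋯`. -/
abbrev Lodd : Type u := ⨁ k : ℕ, D.L (2 * k + 5)

/-- `(ΛV, d)` is a Sullivan algebra: `V` is concentrated in positive degrees and is the union
of an increasing sequence `V(0) ⊆ V(1) ⊆ ⋯` of graded subspaces with `d = 0` on `V(0)` and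
`d (V(k+1)) ⊆ ΛV(k)`. -/
def IsSullivan : Prop :=
  Subsingleton (V 0) ∧
  ∃ W : ℕ → ∀ i, Submodule ℚ (V i),
    (∀ k i, W k i ≤ W (k + 1) i) ∧
    (∀ i (v : V i), ∃ k, v ∈ W k i) ∧
    (∀ i, ∀ v ∈ W 0 i, D.d (gen i v) = 0) ∧
    (∀ k i, ∀ v ∈ W (k + 1) i, D.d (gen i v) ∈ subalgebraGenBy (W k))

/-- `(ΛV, d)` is minimal: the image of `d` lies in `Λ^{≥ 2} V`. -/
def IsMinimal : Prop := ∀ x, D.d x ∈ wordLengthGE V 2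

/-- `(ΛV, d)` is a simply connected minimal Sullivan algebra that is elliptic: `V^1 = 0`, and
both `H^*(ΛV)` and `V` have finite total dimension. -/
structure IsElliptic : Prop where
  sullivan : D.IsSullivan
  minimal : D.IsMinimal
  simplyConnected : Subsingleton (V 1)
  finite_cohomology : Module.Finite ℚ (⨁ i, D.H i)
  finite_generators : Module.Finite ℚ (⨁ i, V i)

end Differential

end Cohomology

end Sullivan

end

/-! Since `V` starts in degree 2, a monomial of degree `i` or `i - 1` involves only generators of
degree at most `i - 2` exactly when it is decomposable (`supp_le_iff`). So `L^i` is the degree `i`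
cohomology of the complex of decomposables. Let h, v, l denote the dimensions of H, V, L in each
degree, and let r be the rank of H → V. The long exact sequence of 0 → Λ^{≥2}V → Λ^+V → V → 0
becomes l_n = (h_n - r_n) + (v_{n-1} - r_{n-1}) (`ldim_eq`), a sum of two nonnegative terms. In the
alternating sum the r's cancel, leaving dim L^even - dim L^odd = χ(H) - 1 - χ(V), where χ(V) = dim
V^even - dim V^odd.

Halperin's theorem (`VanishAbove.halperin`) states that χ(V) ≤ 0 and χ(H) ≥ 0, with χ(H) ≥ 1 when
χ(V) = 0. In either case the difference above is nonnegative. If L^even = 0, then L^odd = 0 too, so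
every l_n vanishes. Both terms of the formula are then zero in each degree, which gives h_n = r_n =
v_n for n ≥ 2; the extra 1 in the total dimension is H^0.

Halperin's theorem is proved in three stages.

Nilpotence. Killing the generators of degree below m has the homotopy effect of adjoining
suspensions of them to ΛV. The enlarged algebra, filtered by the degree of its suspended part,
inherits a vanishing range from H(ΛV). High powers of a generator of degree m fall in that range, so
they are coboundaries in the quotient (`VanishAbove.exists_pow_eq`).

Pure algebra. Let `dS` send each odd generator to the purely even part of its differential and each
even generator to 0. By nilpotence, the even generators lie in the radical of the ideal of
`dS`-coboundaries in the polynomial ring on them. Noetherianity then makes the cohomology of `dS`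
finite dimensional (`VanishAbove.dS_finite`). The weight "degree plus number of odd generators" is
preserved by `dS` and strictly raised by `d - dS`, so both differentials are exact in large weight
(`VanishAbove.exact_of_lt`).

Counting. Let S(t) be the generating function, by weight, of monomials signed by parity. It is a
polynomial, its value at 1 is χ(H), and S(t) · ∏_even (1 - t^w) = ∏_odd (1 - t^w). Comparing the
orders of vanishing at t = 1, and then the leading coefficients, gives the inequalities
(`signedCount_sum`). -/

set_option linter.unusedSectionVars false

noncomputable section

namespace Sullivan

/-- An enumeration of a finite type of generators, used to order monomials. -/
class GenList (ι : Type*) where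
  /-- the list of all generators -/
  list : List ι
  nodup : list.Nodup
  mem : ∀ i, i ∈ list

/-! ### The free graded commutative algebra on a set of generators, and its monomial basis. -/

section GC

/-- The commutation relations between generators `i` of degree `p i`. -/
inductive GC.Rel {ι : Type*} (p : ι → ℕ) : FreeAlgebra ℚ ι → FreeAlgebra ℚ ι → Prop
  | comm (i j : ι) : GC.Rel p (FreeAlgebra.ι ℚ i * FreeAlgebra.ι ℚ j)
      ((-1 : ℚ) ^ (p i * p j) • (FreeAlgebra.ι ℚ j * FreeAlgebra.ι ℚ i))

/-- The free graded commutative algebra on generators `i` of degree `p i`. -/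
def GC {ι : Type*} (p : ι → ℕ) : Type _ := RingQuot (GC.Rel p)

variable {ι : Type*} {p : ι → ℕ}

instance : Ring (GC p) := inferInstanceAs (Ring (RingQuot (GC.Rel p)))

instance : Algebra ℚ (GC p) := inferInstanceAs (Algebra ℚ (RingQuot (GC.Rel p)))

namespace GC

/-- The generators. -/
def X (i : ι) : GC p := RingQuot.mkAlgHom ℚ (GC.Rel p) (FreeAlgebra.ι ℚ i)

theorem X_mul_X (i j : ι) : (X i * X j : GC p) = (-1 : ℚ) ^ (p i * p j) • (X j * X i) := by
  have := RingQuot.mkAlgHom_rel ℚ (GC.Rel.comm (p := p) i j)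
  simp only [map_mul, map_smul] at this
  exact this

/-- The universal property of the free graded commutative algebra. -/
def lift {C : Type*} [Ring C] [Algebra ℚ C] (f : ι → C)
    (h : ∀ i j, f i * f j = (-1 : ℚ) ^ (p i * p j) • (f j * f i)) : GC p →ₐ[ℚ] C :=
  RingQuot.liftAlgHom ℚ ⟨FreeAlgebra.lift ℚ f, by
    rintro _ _ ⟨i, j⟩
    simpa using h i j⟩

@[simp]
theorem lift_X {C : Type*} [Ring C] [Algebra ℚ C] (f : ι → C)
    (h : ∀ i j, f i * f j = (-1 : ℚ) ^ (p i * p j) • (f j * f i)) (i : ι) :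
    lift (p := p) f h (X i) = f i := by
  unfold lift X
  erw [RingQuot.liftAlgHom_mkAlgHom_apply]
  simp

theorem algHom_ext {C : Type*} [Semiring C] [Algebra ℚ C] {φ ψ : GC p →ₐ[ℚ] C}
    (h : ∀ i, φ (X i) = ψ (X i)) : φ = ψ := by
  refine RingQuot.ringQuot_ext' (s := GC.Rel p) ℚ φ ψ (FreeAlgebra.hom_ext ?_)
  funext i
  exact h i

theorem adjoin_X : Algebra.adjoin ℚ (Set.range (X : ι → GC p)) = ⊤ := by
  let S := Algebra.adjoin ℚ (Set.range (X : ι → GC p))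
  let f : ι → S := fun i => ⟨X i, Algebra.subset_adjoin ⟨i, rfl⟩⟩
  let φ : GC p →ₐ[ℚ] S := lift f fun i j => Subtype.ext (X_mul_X i j)
  have h : S.val.comp φ = AlgHom.id ℚ _ := algHom_ext fun i => by simp [φ, f]
  rw [eq_top_iff]
  intro x _
  have : S.val (φ x) = x := by simpa using DFunLike.congr_fun h x
  rw [← this]
  exact (φ x).2

variable [DecidableEq ι]

/-- Exponents which do not repeat odd generators. -/
def Valid (p : ι → ℕ) (γ : ι → ℕ) : Prop := ∀ i, Odd (p i) → γ i ≤ 1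

/-- The weight of an exponent. -/
def wt [Fintype ι] {M : Type*} [AddCommMonoid M] (w : ι → M) (γ : ι → ℕ) : M := ∑ i, γ i • w i

section wt

variable [Fintype ι] {M : Type*} [AddCommMonoid M] (w : ι → M)

@[simp]
theorem wt_zero : wt w (0 : ι → ℕ) = 0 := by simp [wt]

theorem wt_add (γ γ' : ι → ℕ) : wt w (γ + γ') = wt w γ + wt w γ' := by
  simp [wt, add_smul, Finset.sum_add_distrib]

@[simp]
theorem wt_single (i : ι) : wt w (Pi.single i 1) = w i := by
  simp [wt, Pi.single_apply]

end wt

variable [GenList ι]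

/-- The position of a generator. -/
def rk (i : ι) : ℕ := (GenList.list : List ι).idxOf i

theorem rk_injective : Function.Injective (rk : ι → ℕ) := fun i _ h =>
  (List.idxOf_inj (GenList.mem i)).1 h

theorem pairwise_rk : (GenList.list : List ι).Pairwise fun i j => rk i < rk j := by
  rw [List.pairwise_iff_getElem]
  intro i j hi hj hij
  simpa [rk, List.Nodup.idxOf_getElem GenList.nodup] using hij

/-- The sorted monomial with given exponent. -/
def mono (γ : ι → ℕ) : GC p := ((GenList.list : List ι).map fun i => X i ^ γ i).prod

/-- A sorted monomial is a product of generators multiplied in from the left one at a time. The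
induction step is required for an arbitrary element `x`, not just for monomials, so no reordering
signs ever enter it. -/
theorem mono_induction {C : (ι → ℕ) → GC p → Prop} (h0 : C 0 1)
    (hs : ∀ i γ x, C γ x → C (γ + Pi.single i 1) (X i * x)) (γ : ι → ℕ) : C γ (mono γ) := by
  have pw : ∀ i (k : ℕ) γ x, C γ x → C (γ + Pi.single i k) (X i ^ k * x) := by
    intro i k
    induction k with
    | zero => intro γ x h; simpa using h
    | succ k ih =>
      intro γ x h
      have := hs i _ _ (ih γ x h)
      rwa [add_assoc, ← Pi.single_add, ← mul_assoc, ← pow_succ'] at this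
  have key : ∀ l : List ι, l.Nodup →
      C (fun i => if i ∈ l then γ i else 0) (l.map fun i => X i ^ γ i).prod := by
    intro l
    induction l with
    | nil => intro _; simpa [← Pi.zero_def] using h0
    | cons a t ih =>
      intro hn
      rw [List.nodup_cons] at hn
      have := pw a (γ a) _ _ (ih hn.2)
      rw [List.map_cons, List.prod_cons]
      convert this using 1
      funext i
      by_cases hi : i = a
      · subst hi; simp [hn.1]
      · simp [hi]
  have := key GenList.list GenList.nodup
  simp only [GenList.mem, if_true] at this
  exact this

theorem X_mul_pow (i a : ι) (k : ℕ) :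
    ∃ c : ℚ, (X i * X a ^ k : GC p) = c • (X a ^ k * X i) := by
  induction k with
  | zero => exact ⟨1, by simp⟩
  | succ k ih =>
    obtain ⟨c, hc⟩ := ih
    refine ⟨c * (-1 : ℚ) ^ (p i * p a), ?_⟩
    rw [pow_succ, ← mul_assoc, hc, smul_mul_assoc, mul_assoc, X_mul_X i a, mul_smul_comm, smul_smul,
      mul_assoc]

theorem X_mul_mono (i : ι) (γ : ι → ℕ) :
    ∃ c : ℚ, (X i * mono γ : GC p) = c • mono (γ + Pi.single i 1) := by
  have key : ∀ l : List ι, l.Nodup → i ∈ l → ∃ c : ℚ,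
      (X i * (l.map fun i => X i ^ γ i).prod : GC p) =
        c • (l.map fun j => X j ^ (γ + Pi.single i 1 : ι → ℕ) j).prod := by
    intro l
    induction l with
    | nil => intro _ h; simp at h
    | cons a t ih =>
      intro hn hi
      rw [List.nodup_cons] at hn
      simp only [List.map_cons, List.prod_cons]
      by_cases h : i = a
      · subst h
        refine ⟨1, ?_⟩
        have : (t.map fun j => (X j : GC p) ^ (γ + Pi.single i 1 : ι → ℕ) j) =
            t.map fun j => (X j : GC p) ^ γ j := by
          refine List.map_congr_left fun j hj => ?_
          have : j ≠ i := fun h => hn.1 (h ▸ hj)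
          simp [this]
        rw [this, ← mul_assoc, ← pow_succ']
        simp
      · obtain ⟨c, hc⟩ := ih hn.2 (by simpa [h] using hi)
        obtain ⟨c', hc'⟩ := X_mul_pow (p := p) i a (γ a)
        refine ⟨c' * c, ?_⟩
        rw [← mul_assoc, hc', smul_mul_assoc, mul_assoc, hc, mul_smul_comm, smul_smul]
        have : a ≠ i := Ne.symm h
        simp [this]
  exact key _ GenList.nodup (GenList.mem i)

theorem mono_mul_mono (γ γ' : ι → ℕ) :
    ∃ c : ℚ, (mono γ * mono γ' : GC p) = c • mono (γ + γ') := by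
  refine mono_induction (C := fun γ x => ∃ c : ℚ, x * mono γ' = c • mono (γ + γ')) ⟨1, by simp⟩
    ?_ γ
  rintro i γ x ⟨c, hc⟩
  obtain ⟨c', hc'⟩ := X_mul_mono (p := p) i (γ + γ')
  refine ⟨c * c', ?_⟩
  rw [mul_assoc, hc, mul_smul_comm, hc', smul_smul, add_right_comm]

@[simp]
theorem mono_zero : (mono 0 : GC p) = 1 := by
  have : ((GenList.list : List ι).map fun i => (X i : GC p) ^ (0 : ι → ℕ) i) =
      (GenList.list : List ι).map fun _ => 1 := by simp
  rw [mono, this]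
  simp

theorem mono_single (i : ι) : (mono (Pi.single i 1) : GC p) = X i := by
  have key : ∀ l : List ι, l.Nodup →
      (l.map fun j => (X j : GC p) ^ (Pi.single i 1 : ι → ℕ) j).prod =
        if i ∈ l then X i else 1 := by
    intro l
    induction l with
    | nil => simp
    | cons a t ih =>
      intro hn
      rw [List.nodup_cons] at hn
      rw [List.map_cons, List.prod_cons, ih hn.2]
      by_cases h : i = a
      · subst h; simp [hn.1]
      · have : a ≠ i := Ne.symm h
        simp [this, h]
  have := key _ GenList.nodup
  rwa [if_pos (GenList.mem i)] at this

theorem X_sq_of_odd {i : ι} (h : Odd (p i)) : (X i * X i : GC p) = 0 := by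
  have := X_mul_X (p := p) i i
  rw [Odd.neg_one_pow (h.mul h), neg_one_smul] at this
  have h2 : (2 : ℚ) • (X i * X i : GC p) = 0 := by
    rw [two_smul]; nth_rewrite 1 [this]; simp
  simpa using h2

theorem mono_eq_zero {γ : ι → ℕ} (h : ¬ Valid p γ) : (mono γ : GC p) = 0 := by
  simp only [Valid, not_forall, not_le] at h
  obtain ⟨i, hi, hγ⟩ := h
  apply List.prod_eq_zero
  rw [List.mem_map]
  refine ⟨i, GenList.mem i, ?_⟩
  obtain ⟨k, hk⟩ := Nat.exists_eq_add_of_le hγ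
  rw [hk, pow_add, pow_two, X_sq_of_odd hi, zero_mul]

theorem span_mono : Submodule.span ℚ (Set.range (mono : (ι → ℕ) → GC p)) = ⊤ := by
  rw [eq_top_iff]
  intro x _
  have hx : x ∈ Algebra.adjoin ℚ (Set.range (X : ι → GC p)) := by rw [adjoin_X]; trivial
  induction hx using Algebra.adjoin_induction with
  | mem x hx =>
    obtain ⟨i, rfl⟩ := hx
    exact Submodule.subset_span ⟨_, mono_single i⟩
  | algebraMap r =>
    rw [Algebra.algebraMap_eq_smul_one]
    exact Submodule.smul_mem _ _ (Submodule.subset_span ⟨0, mono_zero⟩)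
  | add x y _ _ hx hy => exact Submodule.add_mem _ (hx trivial) (hy trivial)
  | mul x y _ _ hx hy =>
    have := Submodule.mul_mem_mul (hx trivial) (hy trivial)
    rw [Submodule.span_mul_span] at this
    refine Submodule.span_le.2 ?_ this
    rintro _ ⟨_, ⟨a, rfl⟩, _, ⟨b, rfl⟩, rfl⟩
    obtain ⟨c, hc⟩ := mono_mul_mono (p := p) a b
    simp only [hc]
    exact Submodule.smul_mem _ _ (Submodule.subset_span ⟨_, rfl⟩)

theorem linearMap_ext {M : Type*} [AddCommGroup M] [Module ℚ M] {f g : GC p →ₗ[ℚ] M}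
    (h : ∀ γ, f (mono γ) = g (mono γ)) : f = g :=
  LinearMap.ext_on_range span_mono h

/-- The sign picked up by moving `X i` to its place in a sorted monomial. -/
def fockSign (p : ι → ℕ) [Fintype ι] (i : ι) (γ : ι → ℕ) : ℚ :=
  (-1) ^ (p i * ∑ j with rk j < rk i, p j * γ j)

variable [Fintype ι]

/-- The action of a generator on the space spanned by exponents. -/
def fockOp (p : ι → ℕ) (i : ι) : Module.End ℚ ((ι → ℕ) →₀ ℚ) :=
  Finsupp.lsum ℚ fun γ => LinearMap.toSpanSingleton ℚ _
    (if Odd (p i) ∧ γ i ≠ 0 then 0 else Finsupp.single (γ + Pi.single i 1) (fockSign p i γ))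

theorem fockOp_single (i : ι) (γ : ι → ℕ) (c : ℚ) : fockOp p i (Finsupp.single γ c) =
    if Odd (p i) ∧ γ i ≠ 0 then 0 else
      Finsupp.single (γ + Pi.single i 1) (c * fockSign p i γ) := by
  rw [fockOp, Finsupp.lsum_single, LinearMap.toSpanSingleton_apply]
  split_ifs <;> simp

theorem fockSign_add_single (i j : ι) (γ : ι → ℕ) : fockSign p i (γ + Pi.single j 1) =
    fockSign p i γ * if rk j < rk i then (-1) ^ (p i * p j) else 1 := by
  unfold fockSign
  simp only [Pi.add_apply, mul_add, Finset.sum_add_distrib, pow_add]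
  congr 1
  rw [Finset.sum_filter, Finset.sum_eq_single j]
  · split_ifs <;> simp
  · intro b _ hb; simp [hb]
  · simp

/-- These relations make the span of the exponents a module over the algebra. That module structure
is what shows the sorted monomials to be linearly independent. -/
theorem fockOp_comm (i j : ι) :
    fockOp p i * fockOp p j = (-1 : ℚ) ^ (p i * p j) • (fockOp p j * fockOp p i) := by
  refine Finsupp.lhom_ext fun γ c => ?_
  simp only [Module.End.mul_apply, LinearMap.smul_apply, fockOp_single]
  by_cases hij : i = j
  · subst hij
    split_ifs with h
    · simp
    · by_cases ho : Odd (p i)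
      · rw [fockOp_single, if_pos (by simp [ho])]; simp
      · have : (-1 : ℚ) ^ (p i * p i) = 1 :=
          Even.neg_one_pow ((Nat.not_odd_iff_even.1 ho).mul_right _)
        simp [this]
  · have hji : j ≠ i := Ne.symm hij
    by_cases h1 : Odd (p i) ∧ γ i ≠ 0 <;> by_cases h2 : Odd (p j) ∧ γ j ≠ 0
    · simp [h1, h2]
    · rw [if_neg h2, fockOp_single, if_pos (by simpa [hij] using h1), if_pos h1]; simp
    · rw [if_pos h2, if_neg h1, fockOp_single, if_pos (by simpa [hji] using h2)]; simp
    · rw [if_neg h1, if_neg h2, fockOp_single, fockOp_single,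
        if_neg (by simpa [hij] using h1), if_neg (by simpa [hji] using h2), Finsupp.smul_single,
        add_right_comm, fockSign_add_single, fockSign_add_single]
      congr 1
      have hr : rk i ≠ rk j := fun h => hij (rk_injective h)
      have hs : ((-1 : ℚ) ^ (p i * p j)) * (-1 : ℚ) ^ (p i * p j) = 1 := by
        rw [← pow_add]; exact Even.neg_one_pow ⟨_, rfl⟩
      rw [smul_eq_mul, mul_comm (p j) (p i)]
      rcases lt_or_gt_of_ne hr with h | h
      · rw [if_neg (by omega), if_pos h]
        linear_combination (-c * fockSign p i γ * fockSign p j γ) * hs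
      · rw [if_pos h, if_neg (by omega)]
        ring

/-- The action of the algebra on the space spanned by exponents. -/
def fock : GC p →ₐ[ℚ] Module.End ℚ ((ι → ℕ) →₀ ℚ) := lift (fockOp p) fockOp_comm

/-- The coordinates of an element in the monomial basis. -/
def coord : GC p →ₗ[ℚ] ((ι → ℕ) →₀ ℚ) :=
  LinearMap.applyₗ (Finsupp.single 0 1) ∘ₗ fock.toLinearMap

/-- The factors of a sorted monomial act on the zero exponent from the last to the first. Each
generator therefore meets only itself and generators of larger rank, so its sign is 1. -/
theorem coord_mono {γ : ι → ℕ} (h : Valid p γ) :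
    coord (mono γ : GC p) = Finsupp.single γ 1 := by
  have key : ∀ l : List ι, l.Pairwise (fun i j => rk i < rk j) →
      fock (l.map fun i => (X i : GC p) ^ γ i).prod (Finsupp.single 0 1) =
        Finsupp.single (fun i => if i ∈ l then γ i else 0) 1 := by
    intro l
    induction l with
    | nil => intro _; simp [← Pi.zero_def]
    | cons a t ih =>
      intro hp
      rw [List.pairwise_cons] at hp
      have hat : a ∉ t := fun h => lt_irrefl _ (hp.1 a h)
      rw [List.map_cons, List.prod_cons, map_mul, Module.End.mul_apply, ih hp.2]
      have sub : ∀ k ≤ γ a, fock ((X a : GC p) ^ k)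
          (Finsupp.single (fun i => if i ∈ t then γ i else 0) 1) =
          Finsupp.single ((fun i => if i ∈ t then γ i else 0) + Pi.single a k) 1 := by
        intro k hk
        induction k with
        | zero => simp
        | succ k ihk =>
          rw [pow_succ', map_mul, Module.End.mul_apply, ihk (by omega)]
          simp only [fock, lift_X]
          rw [fockOp_single, if_neg]
          · rw [add_assoc, ← Pi.single_add]
            congr 1
            rw [fockSign, Finset.sum_eq_zero]
            · simp
            · intro j hj
              simp only [Finset.mem_filter, Finset.mem_univ, true_and] at hj
              have h1 : j ∉ t := fun h => absurd (hp.1 j h) (by omega)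
              have h2 : j ≠ a := fun h => by subst h; omega
              simp [h1, h2]
          · rintro ⟨ho, hne⟩
            have := h a ho
            simp [hat] at hne
            omega
      rw [sub _ le_rfl]
      congr 1
      funext i
      by_cases hi : i = a
      · subst hi; simp [hat]
      · simp [hi]
  have := key _ pairwise_rk
  simpa [GenList.mem, coord, mono] using this

/-- The linear combination of monomials with given coefficients. -/
def ofCoord : ((ι → ℕ) →₀ ℚ) →ₗ[ℚ] GC p := Finsupp.linearCombination ℚ mono

theorem ofCoord_coord (x : GC p) : ofCoord (coord x) = x := by
  have : (ofCoord ∘ₗ coord : GC p →ₗ[ℚ] GC p) = LinearMap.id := by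
    refine linearMap_ext fun γ => ?_
    by_cases h : Valid p γ
    · simp [coord_mono h, ofCoord]
    · simp [mono_eq_zero h]
  exact DFunLike.congr_fun this x

theorem coord_injective : Function.Injective (coord : GC p →ₗ[ℚ] _) :=
  Function.LeftInverse.injective ofCoord_coord

theorem valid_of_coord_ne_zero {x : GC p} {γ : ι → ℕ} (h : coord x γ ≠ 0) : Valid p γ := by
  by_contra hv
  apply h
  have : (Finsupp.lapply γ ∘ₗ coord : GC p →ₗ[ℚ] ℚ) = 0 := by
    refine linearMap_ext fun γ' => ?_
    by_cases h' : Valid p γ'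
    · have : γ' ≠ γ := fun e => hv (e ▸ h')
      simp [coord_mono h', this]
    · simp [mono_eq_zero h']
  exact DFunLike.congr_fun this x

/-- The span of the monomials whose exponent satisfies a condition. -/
def part (Q : (ι → ℕ) → Prop) : Submodule ℚ (GC p) := Submodule.span ℚ (mono '' {γ | Q γ})

theorem mono_mem_part {Q : (ι → ℕ) → Prop} {γ : ι → ℕ} (h : Q γ) : (mono γ : GC p) ∈ part Q :=
  Submodule.subset_span ⟨γ, h, rfl⟩

/-- As the valid monomials form a basis, membership can be read off the coordinates. This is what
lets several conditions on exponents be combined. -/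
theorem mem_part_iff {Q : (ι → ℕ) → Prop} {x : GC p} :
    x ∈ part Q ↔ ∀ γ, coord x γ ≠ 0 → Q γ := by
  constructor
  · intro hx
    induction hx using Submodule.span_induction with
    | mem x hx =>
      obtain ⟨γ, hγ, rfl⟩ := hx
      intro γ' h'
      by_cases h : Valid p γ
      · rw [coord_mono h, Finsupp.single_apply] at h'
        split_ifs at h' with e
        · exact e ▸ hγ
        · exact absurd rfl h'
      · simp [mono_eq_zero h] at h'
    | zero => simp
    | add x y _ _ hx hy =>
      intro γ h
      by_cases h1 : coord x γ = 0
      · exact hy γ fun h2 => h (by simp [h1, h2])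
      · exact hx γ h1
    | smul c x _ hx =>
      intro γ h
      exact hx γ fun h1 => h (by simp [h1])
  · intro h
    rw [← ofCoord_coord x, ofCoord, Finsupp.linearCombination_apply]
    exact Submodule.sum_mem _ fun γ hγ =>
      Submodule.smul_mem _ _ (mono_mem_part (h γ (Finsupp.mem_support_iff.1 hγ)))

theorem part_mono {Q Q' : (ι → ℕ) → Prop} (h : ∀ γ, Q γ → Q' γ) :
    (part Q : Submodule ℚ (GC p)) ≤ part Q' := fun _ hx =>
  mem_part_iff.2 fun γ hγ => h γ (mem_part_iff.1 hx γ hγ)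

theorem mem_part_and {Q Q' : (ι → ℕ) → Prop} {x : GC p} (h : x ∈ part Q) (h' : x ∈ part Q') :
    x ∈ part (fun γ => Q γ ∧ Q' γ) :=
  mem_part_iff.2 fun γ hγ => ⟨mem_part_iff.1 h γ hγ, mem_part_iff.1 h' γ hγ⟩

theorem mul_mem_part {Q Q' R : (ι → ℕ) → Prop} (h : ∀ a b, Q a → Q' b → R (a + b)) {x y : GC p}
    (hx : x ∈ part Q) (hy : y ∈ part Q') : x * y ∈ part R := by
  have := Submodule.mul_mem_mul hx hy
  rw [part, part, Submodule.span_mul_span] at this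
  refine Submodule.span_le.2 ?_ this
  rintro _ ⟨_, ⟨a, ha, rfl⟩, _, ⟨b, hb, rfl⟩, rfl⟩
  obtain ⟨c, hc⟩ := mono_mul_mono (p := p) a b
  simp only [hc]
  exact Submodule.smul_mem _ _ (mono_mem_part (h a b ha hb))

theorem X_mem_part {Q : (ι → ℕ) → Prop} {i : ι} (h : Q (Pi.single i 1)) :
    (X i : GC p) ∈ part Q := mono_single (p := p) i ▸ mono_mem_part h

theorem one_mem_part {Q : (ι → ℕ) → Prop} (h : Q 0) : (1 : GC p) ∈ part Q :=
  mono_zero (p := p) ▸ mono_mem_part h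

theorem mem_part_true (x : GC p) : x ∈ part (fun _ => True) := mem_part_iff.2 fun _ _ => trivial

theorem part_induction {Q : (ι → ℕ) → Prop} {M : Type*} [AddCommGroup M] [Module ℚ M]
    (f : GC p →ₗ[ℚ] M) (N : Submodule ℚ M) (h : ∀ γ, Q γ → f (mono γ) ∈ N) {x : GC p}
    (hx : x ∈ part Q) : f x ∈ N := by
  have : part Q ≤ N.comap f := Submodule.span_le.2 (by rintro _ ⟨γ, hγ, rfl⟩; exact h γ hγ)
  exact this hx

theorem eq_of_part {Q : (ι → ℕ) → Prop} {M : Type*} [AddCommGroup M] [Module ℚ M]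
    {f g : GC p →ₗ[ℚ] M} (h : ∀ γ, Q γ → f (mono γ) = g (mono γ)) {x : GC p}
    (hx : x ∈ part Q) : f x = g x := by
  have := part_induction (f - g) ⊥ (fun γ hγ => by simp [h γ hγ]) hx
  simpa [sub_eq_zero] using this

/-- The operator which is diagonal in the monomial basis. -/
def diag (c : (ι → ℕ) → ℚ) : GC p →ₗ[ℚ] GC p :=
  Finsupp.lsum ℚ (fun γ => LinearMap.toSpanSingleton ℚ _ (c γ • mono γ)) ∘ₗ coord

theorem diag_mono (c : (ι → ℕ) → ℚ) (γ : ι → ℕ) :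
    diag c (mono γ : GC p) = c γ • mono γ := by
  by_cases h : Valid p γ
  · simp [diag, coord_mono h]
  · simp [mono_eq_zero h]

theorem coord_diag (c : (ι → ℕ) → ℚ) (x : GC p) (γ : ι → ℕ) :
    coord (diag c x) γ = c γ * coord x γ := by
  have : (Finsupp.lapply γ ∘ₗ coord ∘ₗ diag c : GC p →ₗ[ℚ] ℚ) =
      c γ • (Finsupp.lapply γ ∘ₗ coord) := by
    refine linearMap_ext fun γ' => ?_
    by_cases h : Valid p γ'
    · by_cases e : γ' = γ
      · subst e; simp [diag_mono, coord_mono h]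
      · simp [diag_mono, coord_mono h, e]
    · simp [mono_eq_zero h]
  exact DFunLike.congr_fun this x

theorem diag_mem_part (c : (ι → ℕ) → ℚ) {Q : (ι → ℕ) → Prop} {x : GC p} (hx : x ∈ part Q) :
    diag c x ∈ part Q := mem_part_iff.2 fun γ hγ => mem_part_iff.1 hx γ fun h =>
  hγ (by rw [coord_diag, h, mul_zero])

theorem diag_eq_smul {c : (ι → ℕ) → ℚ} {Q : (ι → ℕ) → Prop} {r : ℚ} (h : ∀ γ, Q γ → c γ = r)
    {x : GC p} (hx : x ∈ part Q) : diag c x = r • x := by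
  have := eq_of_part (f := diag c) (g := r • LinearMap.id) (p := p) (Q := Q)
    (fun γ hγ => by simp [diag_mono, h γ hγ]) hx
  simpa using this

open Classical in
/-- The projection onto the monomials whose exponent satisfies a condition. -/
def proj (Q : (ι → ℕ) → Prop) : GC p →ₗ[ℚ] GC p := diag fun γ => if Q γ then 1 else 0

theorem proj_mem (Q : (ι → ℕ) → Prop) (x : GC p) : proj Q x ∈ part Q :=
  mem_part_iff.2 fun γ hγ => by
    by_contra h
    exact hγ (by rw [proj, coord_diag, if_neg h, zero_mul])

theorem proj_mem_part (Q : (ι → ℕ) → Prop) {Q' : (ι → ℕ) → Prop} {x : GC p} (hx : x ∈ part Q') :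
    proj Q x ∈ part Q' := diag_mem_part _ hx

theorem proj_eq_self {Q : (ι → ℕ) → Prop} {x : GC p} (hx : x ∈ part Q) : proj Q x = x := by
  rw [proj, diag_eq_smul (r := 1) (fun γ hγ => if_pos hγ) hx, one_smul]

theorem proj_eq_zero {Q Q' : (ι → ℕ) → Prop} {x : GC p} (hx : x ∈ part Q')
    (h : ∀ γ, Q' γ → ¬ Q γ) : proj Q x = 0 := by
  rw [proj, diag_eq_smul (r := 0) (fun γ hγ => if_neg (h γ hγ)) hx, zero_smul]

theorem sub_proj_mem (Q : (ι → ℕ) → Prop) {Q' : (ι → ℕ) → Prop} {x : GC p} (hx : x ∈ part Q') :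
    x - proj Q x ∈ part (fun γ => Q' γ ∧ ¬ Q γ) := by
  refine mem_part_iff.2 fun γ hγ => ⟨mem_part_iff.1 hx γ fun h => hγ ?_, fun h => hγ ?_⟩
  · simp [proj, coord_diag, h]
  · simp [proj, coord_diag, h]

end GC

end GC

end Sullivan

/-! ### Parity, gradings, filtrations and odd derivations. -/

namespace Sullivan
namespace GC

variable {ι : Type*} {p : ι → ℕ} [DecidableEq ι] [GenList ι] [Fintype ι]
variable {κ : Type*} {q : κ → ℕ} [DecidableEq κ] [GenList κ] [Fintype κ]

section Preserve

variable {C : Type*} [Ring C] [Algebra ℚ C] {M : Type*} [AddCommMonoid M]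

/-- Any multiplicative family of submodules is allowed, so one argument serves gradings, parity and
both increasing and decreasing filtrations. -/
theorem hom_mono_mem (φ : GC p →ₐ[ℚ] C) (w : ι → M) (N : M → Submodule ℚ C) (h1 : 1 ∈ N 0)
    (hmul : ∀ a b, ∀ x ∈ N a, ∀ y ∈ N b, x * y ∈ N (a + b)) (hX : ∀ i, φ (X i) ∈ N (w i))
    (γ : ι → ℕ) : φ (mono γ) ∈ N (wt w γ) := by
  refine mono_induction (C := fun γ x => φ x ∈ N (wt w γ)) (by simpa using h1) ?_ γ
  intro i γ x hx
  rw [map_mul, wt_add, wt_single, add_comm]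
  exact hmul _ _ _ (hX i) _ hx

theorem hom_mono_congr {φ ψ : GC p →ₐ[ℚ] C} {γ : ι → ℕ}
    (h : ∀ i, γ i ≠ 0 → φ (X i) = ψ (X i)) : φ (mono γ) = ψ (mono γ) := by
  refine mono_induction
    (C := fun γ x => (∀ i, γ i ≠ 0 → φ (X i) = ψ (X i)) → φ x = ψ x) (by simp) ?_ γ h
  intro i γ x hx h
  rw [map_mul, map_mul, h i (by simp), hx fun j hj => h j (by simp [hj])]

theorem hom_mono_eq_zero {φ : GC p →ₐ[ℚ] C} {γ : ι → ℕ} {i : ι} (hi : γ i ≠ 0)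
    (h : φ (X i) = 0) : φ (mono γ) = 0 := by
  rw [mono, map_list_prod]
  apply List.prod_eq_zero
  simp only [List.map_map, List.mem_map]
  exact ⟨i, GenList.mem i, by simp [h, hi]⟩

end Preserve

theorem graded_mul {M : Type*} [AddCommMonoid M] (w : ι → M) (a b : M) :
    ∀ x ∈ (part (fun γ => wt w γ = a) : Submodule ℚ (GC p)), ∀ y ∈ part (fun γ => wt w γ = b),
      x * y ∈ part (fun γ => wt w γ = a + b) := fun _ hx _ hy =>
  mul_mem_part (by rintro γ γ' rfl rfl; exact wt_add ..) hx hy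

theorem filt_mul (w : ι → ℤ) (a b : ℤ) :
    ∀ x ∈ (part (fun γ => a ≤ wt w γ) : Submodule ℚ (GC p)), ∀ y ∈ part (fun γ => b ≤ wt w γ),
      x * y ∈ part (fun γ => a + b ≤ wt w γ) := fun _ hx _ hy =>
  mul_mem_part (by intro γ γ' h h'; rw [wt_add]; exact add_le_add h h') hx hy

theorem filt_le_mul (w : ι → ℤ) (a b : ℤ) :
    ∀ x ∈ (part (fun γ => wt w γ ≤ a) : Submodule ℚ (GC p)), ∀ y ∈ part (fun γ => wt w γ ≤ b),
      x * y ∈ part (fun γ => wt w γ ≤ a + b) := fun _ hx _ hy =>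
  mul_mem_part (by intro γ γ' h h'; rw [wt_add]; exact add_le_add h h') hx hy

/-- The degree of an exponent. -/
abbrev deg (p : ι → ℕ) (γ : ι → ℕ) : ℤ := wt (fun i => (p i : ℤ)) γ

theorem deg_eq (γ : ι → ℕ) : deg p γ = (wt p γ : ℕ) := by simp [deg, wt]

/-- The elements of given parity. -/
def par (n : ℕ) : Submodule ℚ (GC p) := part (fun γ => wt p γ % 2 = n % 2)

theorem par_mul {a b : ℕ} {x y : GC p} (hx : x ∈ par a) (hy : y ∈ par b) : x * y ∈ par (a + b) :=
  mul_mem_part (by intro γ γ' h h'; rw [wt_add]; omega) hx hy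

theorem par_congr {a b : ℕ} (h : a % 2 = b % 2) : (par a : Submodule ℚ (GC p)) = par b := by
  simp [par, h]

theorem X_mem_par (i : ι) : (X i : GC p) ∈ par (p i) := X_mem_part (by simp)

theorem one_mem_par : (1 : GC p) ∈ par 0 := one_mem_part (by simp)

theorem part_deg_le_par {n : ℤ} {k : ℕ} (h : n % 2 = k % 2) :
    (part (fun γ => deg p γ = n) : Submodule ℚ (GC p)) ≤ par k :=
  part_mono fun γ hγ => by rw [deg_eq] at hγ; omega

theorem hom_par {φ : GC p →ₐ[ℚ] GC q} (h : ∀ i, φ (X i) ∈ par (p i)) {n : ℕ} {x : GC p}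
    (hx : x ∈ par n) : φ x ∈ par n := by
  refine part_induction φ.toLinearMap _ (fun γ hγ => ?_) hx
  rw [← par_congr hγ]
  exact hom_mono_mem φ p par one_mem_par (fun a b x hx y hy => par_mul hx hy) h γ

theorem neg_one_pow_congr' {a b : ℕ} (h : a % 2 = b % 2) : (-1 : ℚ) ^ a = (-1) ^ b := by
  rw [neg_one_pow_eq_pow_mod_two, h, ← neg_one_pow_eq_pow_mod_two]

theorem mono_mul_X (γ : ι → ℕ) (i : ι) :
    (mono γ * X i : GC p) = (-1 : ℚ) ^ (wt p γ * p i) • (X i * mono γ) := by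
  refine mono_induction
    (C := fun γ x => (x * X i : GC p) = (-1 : ℚ) ^ (wt p γ * p i) • (X i * x)) (by simp) ?_ γ
  intro j γ x hx
  rw [mul_assoc, hx, mul_smul_comm, ← mul_assoc, X_mul_X j i, smul_mul_assoc, smul_smul,
    mul_assoc, wt_add, wt_single, add_mul, pow_add]

theorem mono_comm (γ γ' : ι → ℕ) :
    (mono γ * mono γ' : GC p) = (-1 : ℚ) ^ (wt p γ * wt p γ') • (mono γ' * mono γ) := by
  refine mono_induction (C := fun γ' x => (mono γ * x : GC p) =
    (-1 : ℚ) ^ (wt p γ * wt p γ') • (x * mono γ)) (by simp) ?_ γ'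
  intro j γ' x hx
  rw [← mul_assoc, mono_mul_X, smul_mul_assoc, mul_assoc, hx, mul_smul_comm, smul_smul,
    ← mul_assoc, wt_add, wt_single, mul_add, pow_add, mul_comm ((-1 : ℚ) ^ (_ * p j))]

theorem par_comm {a b : ℕ} {x y : GC p} (hx : x ∈ par a) (hy : y ∈ par b) :
    x * y = (-1 : ℚ) ^ (a * b) • (y * x) := by
  have h1 : ∀ γ, wt p γ % 2 = a % 2 →
      (mono γ : GC p) * y = (-1 : ℚ) ^ (a * b) • (y * mono γ) := by
    intro γ hγ
    refine eq_of_part (f := LinearMap.mulLeft ℚ (mono γ : GC p))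
      (g := (-1 : ℚ) ^ (a * b) • LinearMap.mulRight ℚ (mono γ : GC p)) ?_ hy
    intro γ' hγ'
    simp only [LinearMap.mulLeft_apply, LinearMap.smul_apply, LinearMap.mulRight_apply]
    rw [mono_comm]
    congr 1
    apply neg_one_pow_congr'
    rw [Nat.mul_mod, hγ, hγ', ← Nat.mul_mod]
  exact eq_of_part (f := LinearMap.mulRight ℚ y) (g := (-1 : ℚ) ^ (a * b) • LinearMap.mulLeft ℚ y)
    (fun γ hγ => by simpa using h1 γ hγ) hx

/-- The algebra map with prescribed values of matching parity on the generators. -/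
def liftPar (f : ι → GC q) (hf : ∀ i, f i ∈ par (p i)) : GC p →ₐ[ℚ] GC q :=
  lift f fun i j => par_comm (hf i) (hf j)

@[simp]
theorem liftPar_X (f : ι → GC q) (hf : ∀ i, f i ∈ par (p i)) (i : ι) :
    liftPar f hf (X i) = f i := lift_X ..

/-- The parity involution. -/
def sgn : GC p →ₐ[ℚ] GC p :=
  liftPar (fun i => (-1 : ℚ) ^ p i • X i) fun i => Submodule.smul_mem _ _ (X_mem_par i)

theorem sgn_X (i : ι) : sgn (X i : GC p) = (-1 : ℚ) ^ p i • X i := liftPar_X ..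

theorem sgn_mono (γ : ι → ℕ) : sgn (mono γ : GC p) = (-1 : ℚ) ^ wt p γ • mono γ := by
  refine mono_induction (C := fun γ x => sgn (x : GC p) = (-1 : ℚ) ^ wt p γ • x) (by simp) ?_ γ
  intro i γ x hx
  rw [map_mul, hx, sgn_X, smul_mul_smul_comm, wt_add, wt_single, pow_add, mul_comm]

theorem sgn_of_par {n : ℕ} {x : GC p} (hx : x ∈ par n) : sgn x = (-1 : ℚ) ^ n • x := by
  refine eq_of_part (f := sgn.toLinearMap) (g := (-1 : ℚ) ^ n • LinearMap.id) ?_ hx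
  intro γ hγ
  simp [sgn_mono, neg_one_pow_congr' hγ]

theorem sgn_comp (φ : GC p →ₐ[ℚ] GC q) (h : ∀ i, φ (X i) ∈ par (p i)) (x : GC p) :
    sgn (φ x) = φ (sgn x) := by
  have : (sgn.comp φ) = φ.comp sgn := algHom_ext fun i => by
    simp [sgn_X, sgn_of_par (h i)]
  exact DFunLike.congr_fun this x

/-- A derivation of odd degree along an algebra map. -/
def IsDer (φ : GC p →ₐ[ℚ] GC q) (δ : GC p →ₗ[ℚ] GC q) : Prop :=
  ∀ x y, δ (x * y) = δ x * φ y + φ (sgn x) * δ y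

namespace IsDer

variable {φ : GC p →ₐ[ℚ] GC q} {δ δ' : GC p →ₗ[ℚ] GC q}

theorem map_one (h : IsDer φ δ) : δ 1 = 0 := by
  have := h 1 1
  simpa using this

theorem map_X_mul (h : IsDer φ δ) (i : ι) (x : GC p) :
    δ (X i * x) = δ (X i) * φ x + (-1 : ℚ) ^ p i • (φ (X i) * δ x) := by
  rw [h, sgn_X]; simp

theorem mono_congr (h : IsDer φ δ) (h' : IsDer φ δ') {γ : ι → ℕ}
    (hX : ∀ i, γ i ≠ 0 → δ (X i) = δ' (X i)) : δ (mono γ) = δ' (mono γ) := by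
  refine mono_induction
    (C := fun γ x => (∀ i, γ i ≠ 0 → δ (X i) = δ' (X i)) → δ x = δ' x)
    (by simp [h.map_one, h'.map_one]) ?_ γ hX
  intro i γ x hx hX
  rw [h.map_X_mul, h'.map_X_mul, hX i (by simp), hx fun j hj => hX j (by simp [hj])]

theorem ext (h : IsDer φ δ) (h' : IsDer φ δ') (hX : ∀ i, δ (X i) = δ' (X i)) : δ = δ' :=
  linearMap_ext fun _ => h.mono_congr h' fun i _ => hX i

theorem zero : IsDer φ 0 := fun x y => by simp

theorem sub (h : IsDer φ δ) (h' : IsDer φ δ') : IsDer φ (δ - δ') := fun x y => by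
  simp only [LinearMap.sub_apply, h x y, h' x y, sub_mul, mul_sub]
  abel

/-- The analogue of `hom_mono_mem` for derivations that shift the weight by `r`. The values of `φ`
and `δ` are controlled together, as both occur in the Leibniz rule. -/
theorem mono_mem (h : IsDer φ δ) {M : Type*} [AddCommMonoid M] (w : ι → M) (r : M)
    (N : M → Submodule ℚ (GC q)) (h1 : 1 ∈ N 0)
    (hmul : ∀ a b, ∀ x ∈ N a, ∀ y ∈ N b, x * y ∈ N (a + b)) (hφ : ∀ i, φ (X i) ∈ N (w i))
    (hδ : ∀ i, δ (X i) ∈ N (w i + r)) (γ : ι → ℕ) : δ (mono γ) ∈ N (wt w γ + r) := by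
  refine (mono_induction (C := fun γ x => φ x ∈ N (wt w γ) ∧ δ x ∈ N (wt w γ + r)) ?_ ?_ γ).2
  · simp [h.map_one, h1]
  · rintro i γ x ⟨hx, hx'⟩
    rw [map_mul, h.map_X_mul, wt_add, wt_single, add_comm (wt w γ)]
    refine ⟨hmul _ _ _ (hφ i) _ hx, Submodule.add_mem _ ?_ (Submodule.smul_mem _ _ ?_)⟩
    · rw [add_right_comm]; exact hmul _ _ _ (hδ i) _ hx
    · rw [add_assoc]; exact hmul _ _ _ (hφ i) _ hx'

theorem graded (h : IsDer φ δ) {M : Type*} [AddCommMonoid M] (w : ι → M) (w' : κ → M) (r : M)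
    (hφ : ∀ i, φ (X i) ∈ part (fun γ => wt w' γ = w i))
    (hδ : ∀ i, δ (X i) ∈ part (fun γ => wt w' γ = w i + r)) {a : M} {x : GC p}
    (hx : x ∈ part (fun γ => wt w γ = a)) : δ x ∈ part (fun γ => wt w' γ = a + r) := by
  refine part_induction δ _ ?_ hx
  rintro γ rfl
  exact h.mono_mem w r (fun a => part (fun γ => wt w' γ = a)) (one_mem_part (by simp))
    (graded_mul w') hφ hδ γ

theorem filtered (h : IsDer φ δ) (w : ι → ℤ) (w' : κ → ℤ) (r : ℤ)
    (hφ : ∀ i, φ (X i) ∈ part (fun γ => w i ≤ wt w' γ))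
    (hδ : ∀ i, δ (X i) ∈ part (fun γ => w i + r ≤ wt w' γ)) {a : ℤ} {x : GC p}
    (hx : x ∈ part (fun γ => a ≤ wt w γ)) : δ x ∈ part (fun γ => a + r ≤ wt w' γ) := by
  refine part_induction δ _ ?_ hx
  intro γ hγ
  exact part_mono (fun γ' hγ' => by omega) (h.mono_mem w r (fun a => part (fun γ => a ≤ wt w' γ))
    (one_mem_part (by simp)) (filt_mul w') hφ hδ γ)

theorem filtered_le (h : IsDer φ δ) (w : ι → ℤ) (w' : κ → ℤ) (r : ℤ)
    (hφ : ∀ i, φ (X i) ∈ part (fun γ => wt w' γ ≤ w i))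
    (hδ : ∀ i, δ (X i) ∈ part (fun γ => wt w' γ ≤ w i + r)) {a : ℤ} {x : GC p}
    (hx : x ∈ part (fun γ => wt w γ ≤ a)) : δ x ∈ part (fun γ => wt w' γ ≤ a + r) := by
  refine part_induction δ _ ?_ hx
  intro γ hγ
  exact part_mono (fun γ' hγ' => by omega) (h.mono_mem w r (fun a => part (fun γ => wt w' γ ≤ a))
    (one_mem_part (by simp)) (filt_le_mul w') hφ hδ γ)

theorem par (h : IsDer φ δ) (hφ : ∀ i, φ (X i) ∈ par (p i))
    (hδ : ∀ i, δ (X i) ∈ GC.par (p i + 1)) {n : ℕ} {x : GC p} (hx : x ∈ GC.par n) :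
    δ x ∈ GC.par (n + 1) := by
  refine part_induction δ _ ?_ hx
  intro γ hγ
  rw [← par_congr (a := wt p γ + 1) (by omega)]
  exact h.mono_mem p 1 GC.par one_mem_par (fun a b x hx y hy => par_mul hx hy) hφ hδ γ

theorem hom_comp {κ' : Type*} {q' : κ' → ℕ} [DecidableEq κ'] [GenList κ'] [Fintype κ']
    (h : IsDer φ δ) (ψ : GC q →ₐ[ℚ] GC q') : IsDer (ψ.comp φ) (ψ.toLinearMap ∘ₗ δ) := fun x y => by
  simp [h x y]

theorem comp_hom {κ' : Type*} {q' : κ' → ℕ} [DecidableEq κ'] [GenList κ'] [Fintype κ']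
    (h : IsDer φ δ) {ψ : GC q' →ₐ[ℚ] GC p} (hψ : ∀ i, ψ (X i) ∈ GC.par (q' i)) :
    IsDer (φ.comp ψ) (δ ∘ₗ ψ.toLinearMap) := fun x y => by
  simp [h (ψ x) (ψ y), sgn_comp ψ hψ]

end IsDer

theorem hom_graded {M : Type*} [AddCommMonoid M] {φ : GC p →ₐ[ℚ] GC q} (w : ι → M) (w' : κ → M)
    (hφ : ∀ i, φ (X i) ∈ part (fun γ => wt w' γ = w i)) {a : M} {x : GC p}
    (hx : x ∈ part (fun γ => wt w γ = a)) : φ x ∈ part (fun γ => wt w' γ = a) := by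
  refine part_induction φ.toLinearMap _ ?_ hx
  rintro γ rfl
  exact hom_mono_mem φ w (fun a => part (fun γ => wt w' γ = a)) (one_mem_part (by simp))
    (graded_mul w') hφ γ

theorem hom_filtered {φ : GC p →ₐ[ℚ] GC q} (w : ι → ℤ) (w' : κ → ℤ)
    (hφ : ∀ i, φ (X i) ∈ part (fun γ => w i ≤ wt w' γ)) {a : ℤ} {x : GC p}
    (hx : x ∈ part (fun γ => a ≤ wt w γ)) : φ x ∈ part (fun γ => a ≤ wt w' γ) := by
  refine part_induction φ.toLinearMap _ ?_ hx
  intro γ hγ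
  exact part_mono (fun γ' hγ' => by omega) (hom_mono_mem φ w (fun a => part (fun γ => a ≤ wt w' γ))
    (one_mem_part (by simp)) (filt_mul w') hφ γ)

/-- An odd derivation is the upper right entry of an algebra map into triangular 2×2 matrices whose
diagonal is `sgn x`, `x`. The universal property supplies that map once the matrices of the
generators are seen to commute in the graded sense. -/
theorem exists_der (f : ι → GC p) (hf : ∀ i, f i ∈ par (p i + 1)) :
    ∃ δ : GC p →ₗ[ℚ] GC p, IsDer (AlgHom.id ℚ _) δ ∧ ∀ i, δ (X i) = f i := by
  let g : ι → Matrix (Fin 2) (Fin 2) (GC p) := fun i => !![sgn (X i), f i; 0, X i]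
  have hg : ∀ i j, g i * g j = (-1 : ℚ) ^ (p i * p j) • (g j * g i) := by
    intro i j
    have h1 : sgn (X i : GC p) * sgn (X j) = (-1 : ℚ) ^ (p i * p j) •
        (sgn (X j : GC p) * sgn (X i)) := by
      rw [← map_mul, X_mul_X, map_smul, map_mul]
    have h2 : sgn (X i : GC p) * f j + f i * X j = (-1 : ℚ) ^ (p i * p j) •
        (sgn (X j : GC p) * f i + f j * X i) := by
      rw [sgn_X, sgn_X, smul_mul_assoc, smul_mul_assoc, par_comm (X_mem_par i) (hf j),
        par_comm (hf i) (X_mem_par j), smul_add, smul_smul, smul_smul, add_comm]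
      congr 2
      · ring
      · rw [← pow_add]; exact neg_one_pow_congr' (by ring_nf; omega)
    ext a b
    fin_cases a <;> fin_cases b <;>
      simp [g, Matrix.mul_apply, Fin.sum_univ_two, h1, h2, X_mul_X i j]
  let Φ := lift (p := p) g hg
  have hΦ : ∀ x, Φ x 0 0 = sgn x ∧ Φ x 1 0 = 0 ∧ Φ x 1 1 = x := by
    intro x
    have hx : x ∈ Algebra.adjoin ℚ (Set.range (X : ι → GC p)) := by rw [adjoin_X]; trivial
    induction hx using Algebra.adjoin_induction with
    | mem x hx => obtain ⟨i, rfl⟩ := hx; simp [Φ, g]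
    | algebraMap r => simp [Matrix.algebraMap_matrix_apply]
    | add x y _ _ hx hy => simp [hx, hy]
    | mul x y _ _ hx hy => simp [Matrix.mul_apply, Fin.sum_univ_two, hx, hy]
  refine ⟨⟨⟨fun x => Φ x 0 1, by intro x y; simp⟩, by intro c x; simp⟩, ?_, ?_⟩
  · intro x y
    simp [Matrix.mul_apply, Fin.sum_univ_two, hΦ, add_comm]
  · intro i; simp [Φ, g]

/-- The odd derivation with prescribed values on the generators. -/
def der (f : ι → GC p) (hf : ∀ i, f i ∈ par (p i + 1)) : GC p →ₗ[ℚ] GC p :=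
  (exists_der f hf).choose

theorem isDer_der (f : ι → GC p) (hf : ∀ i, f i ∈ par (p i + 1)) :
    IsDer (AlgHom.id ℚ _) (der f hf) := (exists_der f hf).choose_spec.1

@[simp]
theorem der_X (f : ι → GC p) (hf : ∀ i, f i ∈ par (p i + 1)) (i : ι) :
    der f hf (X i) = f i := (exists_der f hf).choose_spec.2 i

end GC
end Sullivan

/-! ### Minimal differentials, the path algebra and its contraction. -/

namespace Sullivan

instance {ι κ : Type*} [GenList ι] [GenList κ] : GenList (ι ⊕ κ) where
  list := GenList.list.map Sum.inl ++ GenList.list.map Sum.inr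
  nodup := by
    refine List.Nodup.append (GenList.nodup.map Sum.inl_injective)
      (GenList.nodup.map Sum.inr_injective) ?_
    intro x hx hy
    simp only [List.mem_map] at hx hy
    obtain ⟨a, _, rfl⟩ := hx
    obtain ⟨b, _, hb⟩ := hy
    cases hb
  mem := by
    rintro (i | i) <;> simp [GenList.mem]

open GC

variable {ι : Type*} {p : ι → ℕ} [DecidableEq ι] [GenList ι] [Fintype ι]

/-- The word length of an exponent. -/
abbrev GC.len (γ : ι → ℕ) : ℤ := wt (fun _ => (1 : ℤ)) γ

namespace GC

theorem exists_add_single {γ : ι → ℕ} {i : ι} (h : γ i ≠ 0) :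
    ∃ γ' : ι → ℕ, γ = γ' + Pi.single i 1 := by
  refine ⟨γ - Pi.single i 1, ?_⟩
  funext j
  by_cases hj : j = i
  · subst hj; simp; omega
  · simp [hj]

theorem exists_ne_zero_of_wt {w : ι → ℤ} {γ : ι → ℕ} (h : wt w γ ≠ 0) :
    ∃ i, γ i ≠ 0 ∧ w i ≠ 0 := by
  by_contra hc
  push Not at hc
  refine h (Finset.sum_eq_zero fun i _ => ?_)
  by_cases hi : γ i = 0
  · simp [hi]
  · simp [hc i hi]

theorem wt_nonneg {w : ι → ℤ} (h : ∀ i, 0 ≤ w i) (γ : ι → ℕ) : 0 ≤ wt w γ :=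
  Finset.sum_nonneg fun i _ => nsmul_nonneg (h i) _

theorem wt_le_wt {w w' : ι → ℤ} (h : ∀ i, w i ≤ w' i) (γ : ι → ℕ) : wt w γ ≤ wt w' γ :=
  Finset.sum_le_sum fun i _ => nsmul_le_nsmul_right (h i) _

theorem finite_deg_eq (hp : ∀ i, 1 ≤ p i) (n : ℤ) : {γ : ι → ℕ | deg p γ = n}.Finite := by
  refine (Set.finite_Iic (fun _ : ι => n.toNat)).subset fun γ hγ i => ?_
  by_cases h : γ i = 0
  · simp [h]
  · have h1 : ((γ i : ℕ) : ℤ) * p i ≤ deg p γ := by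
      have := Finset.single_le_sum (f := fun i => γ i • (p i : ℤ)) (fun i _ => by positivity)
        (Finset.mem_univ i)
      rw [nsmul_eq_mul] at this
      exact this
    have h2 : (1 : ℤ) ≤ p i := by exact_mod_cast hp i
    have h3 : ((γ i : ℕ) : ℤ) ≤ n := by rw [← hγ]; nlinarith
    simp only
    omega

theorem finiteDimensional_part {Q : (ι → ℕ) → Prop} (h : {γ | Q γ}.Finite) :
    FiniteDimensional ℚ (part Q : Submodule ℚ (GC p)) :=
  FiniteDimensional.span_of_finite ℚ (h.image _)

theorem sgn_der {δ : GC p →ₗ[ℚ] GC p} (h : IsDer (AlgHom.id ℚ _) δ)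
    (hδ : ∀ i, δ (X i) ∈ par (p i + 1)) (x : GC p) : sgn (δ x) = -δ (sgn x) := by
  have : sgn.toLinearMap ∘ₗ δ = -(δ ∘ₗ sgn.toLinearMap) := by
    refine linearMap_ext fun γ => ?_
    have h1 : (mono γ : GC p) ∈ par (wt p γ) := mono_mem_part rfl
    simp [sgn_of_par (h.par (fun i => X_mem_par i) hδ h1), sgn_of_par h1, pow_succ]
  exact DFunLike.congr_fun this x

theorem sgn_sgn (x : GC p) : sgn (sgn x) = x := by
  have : (sgn.comp sgn : GC p →ₐ[ℚ] GC p) = AlgHom.id ℚ _ := algHom_ext fun i => by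
    simp [sgn_X, smul_smul, ← pow_add, Even.neg_one_pow (⟨p i, rfl⟩ : Even (p i + p i))]
  exact DFunLike.congr_fun this x

/-- The anticommutator of two odd derivations is an even derivation. -/
theorem anticomm_mul {δ δ' : GC p →ₗ[ℚ] GC p} (h : IsDer (AlgHom.id ℚ _) δ)
    (hδ : ∀ i, δ (X i) ∈ par (p i + 1)) (h' : IsDer (AlgHom.id ℚ _) δ')
    (hδ' : ∀ i, δ' (X i) ∈ par (p i + 1)) (x y : GC p) :
    δ (δ' (x * y)) + δ' (δ (x * y)) =
      (δ (δ' x) + δ' (δ x)) * y + x * (δ (δ' y) + δ' (δ y)) := by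
  rw [h' x y, h x y]
  simp only [map_add]
  rw [h, h, h', h']
  simp only [AlgHom.id_apply, sgn_der h hδ, sgn_der h' hδ', sgn_sgn, mul_add, add_mul, neg_mul]
  abel

/-- An even derivation that is diagonal on generators is diagonal on monomials, with additive
eigenvalues. With `δ = δ'` and weight 0 this gives square-zero; with a counting weight it gives a
contracting homotopy. -/
theorem anticomm_mono {δ δ' : GC p →ₗ[ℚ] GC p} (h : IsDer (AlgHom.id ℚ _) δ)
    (hδ : ∀ i, δ (X i) ∈ par (p i + 1)) (h' : IsDer (AlgHom.id ℚ _) δ')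
    (hδ' : ∀ i, δ' (X i) ∈ par (p i + 1)) (w : ι → ℤ)
    (hX : ∀ i, δ (δ' (X i)) + δ' (δ (X i)) = (w i : ℚ) • X i) (γ : ι → ℕ) :
    δ (δ' (mono γ)) + δ' (δ (mono γ)) = ((wt w γ : ℤ) : ℚ) • mono γ := by
  refine mono_induction (C := fun γ x => δ (δ' x) + δ' (δ x) = ((wt w γ : ℤ) : ℚ) • x) ?_ ?_ γ
  · simp [h.map_one, h'.map_one]
  · intro i γ x hx
    rw [anticomm_mul h hδ h' hδ', hx, hX, wt_add, wt_single]
    push_cast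
    rw [add_smul, smul_mul_assoc, mul_smul_comm, add_comm]

theorem sq_eq_zero {δ : GC p →ₗ[ℚ] GC p} (h : IsDer (AlgHom.id ℚ _) δ)
    (hδ : ∀ i, δ (X i) ∈ par (p i + 1)) (hX : ∀ i, δ (δ (X i)) = 0) (x : GC p) :
    δ (δ x) = 0 := by
  have : δ ∘ₗ δ = 0 := by
    refine linearMap_ext fun γ => ?_
    have := anticomm_mono h hδ h hδ 0 (fun i => by simp [hX]) γ
    have h0 : wt (0 : ι → ℤ) γ = 0 := by simp [wt]
    rw [h0, Int.cast_zero, zero_smul, ← two_smul ℚ] at this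
    simpa using this
  exact DFunLike.congr_fun this x

end GC

/-- A simply connected minimal differential on a free graded commutative algebra. -/
structure MinDGA (p : ι → ℕ) where
  /-- the differential -/
  d : GC p →ₗ[ℚ] GC p
  isDer : IsDer (AlgHom.id ℚ _) d
  d_X_deg : ∀ i, d (X i) ∈ part (fun γ => deg p γ = p i + 1)
  d_d : ∀ x, d (d x) = 0
  two_le : ∀ i, 2 ≤ p i
  d_X_len : ∀ i, d (X i) ∈ part (fun γ => 2 ≤ len γ)

namespace MinDGA

variable (D : MinDGA p)

include D in
theorem len_le_deg (γ : ι → ℕ) : 2 * len γ ≤ deg p γ := by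
  have : 2 * len γ = wt (fun _ => (2 : ℤ)) γ := by simp [wt, Finset.mul_sum, mul_comm]
  rw [this]
  exact wt_le_wt (fun i => by exact_mod_cast D.two_le i) γ

theorem d_X_par (i : ι) : D.d (X i) ∈ par (p i + 1) :=
  part_deg_le_par (by push_cast; rfl) (D.d_X_deg i)

theorem d_deg {n : ℤ} {x : GC p} (hx : x ∈ part (fun γ => deg p γ = n)) :
    D.d x ∈ part (fun γ => deg p γ = n + 1) :=
  D.isDer.graded _ _ 1 (fun i => X_mem_part (by simp)) D.d_X_deg hx

/-- Each monomial of `d (X i)` has degree `p i + 1` and at least two letters, each of degree at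
least 2. Deleting one letter leaves degree at least 2, so that letter has degree below `p i`. This
allows recursion on the degree of generators throughout. -/
theorem d_X_lower (i : ι) :
    D.d (X i) ∈ part (fun γ => (∃ j, γ j ≠ 0) ∧ ∀ j, γ j ≠ 0 → p j < p i) := by
  refine part_mono ?_ (mem_part_and (D.d_X_deg i) (D.d_X_len i))
  rintro γ ⟨h1, h2⟩
  refine ⟨?_, fun j hj => ?_⟩
  · obtain ⟨j, hj, _⟩ := exists_ne_zero_of_wt (w := fun _ => (1 : ℤ)) (γ := γ) (by
      change len γ ≠ 0; omega)
    exact ⟨j, hj⟩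
  · obtain ⟨γ', rfl⟩ := exists_add_single hj
    have := D.len_le_deg γ'
    simp only [deg, len, wt_add, wt_single] at h1 h2 this
    omega

/-- The degrees of the generators of the path algebra. -/
def bdeg (p : ι → ℕ) : ι ⊕ ι → ℕ := Sum.elim p fun i => p i - 1

@[simp]
theorem bdeg_inl (i : ι) : bdeg p (Sum.inl i) = p i := rfl

@[simp]
theorem bdeg_inr (i : ι) : bdeg p (Sum.inr i) = p i - 1 := rfl

include D in
theorem one_le_bdeg (j : ι ⊕ ι) : 1 ≤ bdeg p j := by
  rcases j with i | i <;> have := D.two_le i <;> simp <;> omega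

/-- The inclusion of the algebra in the path algebra. -/
def inc : GC p →ₐ[ℚ] GC (bdeg p) :=
  liftPar (fun i => X (Sum.inl i)) fun i => X_mem_par (p := bdeg p) (Sum.inl i)

@[simp]
theorem inc_X (i : ι) : inc (X i : GC p) = X (Sum.inl i) := liftPar_X ..

theorem inc_deg {n : ℤ} {x : GC p} (hx : x ∈ part (fun γ => deg p γ = n)) :
    inc x ∈ part (fun γ => deg (bdeg p) γ = n) :=
  hom_graded _ _ (fun i => by rw [inc_X]; exact X_mem_part (by simp)) hx

variable (m : ℕ)

/-- The projection of the path algebra which kills the generators of degree less than `m` and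
their suspensions. -/
def pr : GC (bdeg p) →ₐ[ℚ] GC (bdeg p) :=
  liftPar (fun j => if Sum.elim p p j < m then 0 else X j) fun j => by
    split_ifs
    · exact Submodule.zero_mem _
    · exact X_mem_par j

theorem pr_X (j : ι ⊕ ι) :
    pr m (X j : GC (bdeg p)) = if Sum.elim p p j < m then 0 else X j := liftPar_X ..

theorem pr_inl (i : ι) : pr m (X (Sum.inl i) : GC (bdeg p)) =
    if p i < m then 0 else X (Sum.inl i) := by
  rw [pr_X]; rfl

theorem pr_inr (i : ι) : pr m (X (Sum.inr i) : GC (bdeg p)) =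
    if p i < m then 0 else X (Sum.inr i) := by
  rw [pr_X]; rfl

theorem inc_X_par (i : ι) : inc (X i) ∈ GC.par (p := bdeg p) (p i) := by
  rw [inc_X]; exact X_mem_par (p := bdeg p) (Sum.inl i)

theorem pr_X_par (j : ι ⊕ ι) : pr m (X j) ∈ GC.par (p := bdeg p) (bdeg p j) := by
  rw [pr_X]
  split_ifs
  · exact Submodule.zero_mem _
  · exact X_mem_par j

theorem pr_inc_d_X {i : ι} (hi : p i ≤ m) : pr m (inc (D.d (X i))) = 0 := by
  have := eq_of_part (f := ((pr m).comp inc).toLinearMap) (g := 0) ?_ (D.d_X_lower i)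
  · simpa using this
  · rintro γ ⟨⟨j, hj⟩, hγ⟩
    exact hom_mono_eq_zero (φ := (pr m).comp inc) hj (by
      have := hγ j hj
      simp only [AlgHom.comp_apply, inc_X, pr_inl]
      rw [if_pos (by omega)])

/-- The values of the differential of the path algebra. -/
def dBVal : ι ⊕ ι → GC (bdeg p) :=
  Sum.elim (fun i => pr m (inc (D.d (X i)))) fun i => if p i < m then X (Sum.inl i) else 0

theorem dBVal_par (j : ι ⊕ ι) : D.dBVal m j ∈ par (bdeg p j + 1) := by
  rcases j with i | i
  · exact hom_par (pr_X_par m) (hom_par (fun i => inc_X_par i) (D.d_X_par i))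
  · simp only [dBVal, Sum.elim_inr, bdeg_inr]
    have := D.two_le i
    split_ifs
    · rw [show p i - 1 + 1 = p i by omega]
      exact X_mem_par (p := bdeg p) (Sum.inl i)
    · exact Submodule.zero_mem _

/-- The differential of the path algebra. -/
def dB : GC (bdeg p) →ₗ[ℚ] GC (bdeg p) := der (D.dBVal m) (D.dBVal_par m)

theorem isDer_dB : IsDer (AlgHom.id ℚ _) (D.dB m) := isDer_der _ _

theorem dB_par (j : ι ⊕ ι) : D.dB m (X j) ∈ par (bdeg p j + 1) := by
  rw [dB, der_X]; exact D.dBVal_par m j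

theorem dB_inl (i : ι) : D.dB m (X (Sum.inl i)) = pr m (inc (D.d (X i))) := der_X ..

theorem dB_inr (i : ι) :
    D.dB m (X (Sum.inr i)) = if p i < m then X (Sum.inl i) else 0 := der_X ..

theorem dB_pr_inc (x : GC p) : D.dB m (pr m (inc x)) = pr m (inc (D.d x)) := by
  have h1 : IsDer ((pr m).comp inc) (D.dB m ∘ₗ ((pr m).comp (inc (p := p))).toLinearMap) :=
    (D.isDer_dB m).comp_hom (fun i => hom_par (pr_X_par m) (inc_X_par i))
  have h2 : IsDer ((pr m).comp inc) (((pr m).comp (inc (p := p))).toLinearMap ∘ₗ D.d) :=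
    D.isDer.hom_comp _
  refine DFunLike.congr_fun (h1.ext h2 fun i => ?_) x
  simp only [LinearMap.comp_apply, AlgHom.toLinearMap_apply, AlgHom.comp_apply, inc_X, pr_inl]
  split_ifs with h
  · rw [map_zero, D.pr_inc_d_X m h.le]
  · rw [dB_inl]

theorem dB_dB (x : GC (bdeg p)) : D.dB m (D.dB m x) = 0 := by
  refine sq_eq_zero (D.isDer_dB m) (D.dB_par m) (fun j => ?_) x
  rcases j with i | i
  · rw [dB_inl, dB_pr_inc, D.d_d, map_zero, map_zero]
  · rw [dB_inr]
    split_ifs with h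
    · rw [dB_inl, D.pr_inc_d_X m h.le]
    · simp

/-- The values of the contracting derivation of the path algebra. -/
def sBVal (p : ι → ℕ) (m : ℕ) : ι ⊕ ι → GC (bdeg p) :=
  Sum.elim (fun i => if p i < m then X (Sum.inr i) else 0) fun _ => 0

include D in
theorem sBVal_par (j : ι ⊕ ι) : sBVal p m j ∈ par (bdeg p j + 1) := by
  rcases j with i | i
  · simp only [sBVal, Sum.elim_inl, bdeg_inl]
    have := D.two_le i
    split_ifs
    · rw [par_congr (b := p i - 1) (by omega)]
      exact X_mem_par (p := bdeg p) (Sum.inr i)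
    · exact Submodule.zero_mem _
  · exact Submodule.zero_mem _

/-- The contracting derivation of the path algebra. -/
def sB : GC (bdeg p) →ₗ[ℚ] GC (bdeg p) := der (sBVal p m) (D.sBVal_par m)

theorem isDer_sB : IsDer (AlgHom.id ℚ _) (D.sB m) := isDer_der _ _

theorem sB_par (j : ι ⊕ ι) : D.sB m (X j) ∈ par (bdeg p j + 1) := by
  rw [sB, der_X]; exact D.sBVal_par m j

theorem sB_inl (i : ι) :
    D.sB m (X (Sum.inl i)) = if p i < m then X (Sum.inr i) else 0 := der_X ..

theorem sB_inr (i : ι) : D.sB m (X (Sum.inr i)) = 0 := der_X ..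

theorem sB_pr (x : GC (bdeg p)) : D.sB m (pr m x) = 0 := by
  have h1 : IsDer (pr m) (D.sB m ∘ₗ (pr m).toLinearMap) := (D.isDer_sB m).comp_hom (pr_X_par m)
  refine DFunLike.congr_fun (h1.ext .zero fun j => ?_) x
  rcases j with i | i <;>
    simp only [LinearMap.comp_apply, AlgHom.toLinearMap_apply, pr_inl, pr_inr] <;>
    split_ifs with h <;> simp [sB_inl, sB_inr, h]

theorem pr_sB (x : GC (bdeg p)) : pr m (D.sB m x) = 0 := by
  have h1 : IsDer (pr m) ((pr m).toLinearMap ∘ₗ D.sB m) := (D.isDer_sB m).hom_comp _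
  refine DFunLike.congr_fun (h1.ext .zero fun j => ?_) x
  rcases j with i | i
  · simp only [LinearMap.comp_apply, sB_inl]
    split_ifs with h <;> simp [pr_inr, h]
  · simp [sB_inr]

/-- The number of generators killed by the projection. -/
def cnt (p : ι → ℕ) (m : ℕ) (j : ι ⊕ ι) : ℤ := if Sum.elim p p j < m then 1 else 0

theorem cnt_inl (i : ι) : cnt p m (Sum.inl i) = if p i < m then 1 else 0 := rfl

theorem cnt_inr (i : ι) : cnt p m (Sum.inr i) = if p i < m then 1 else 0 := rfl

/-- On a generator of degree below `m` and its suspension, `dB` and `sB` are mutually inverse; on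
all other generators the anticommutator is zero. Hence it counts the letters that `pr m` kills. -/
theorem anticomm_dB_sB (γ : ι ⊕ ι → ℕ) : D.dB m (D.sB m (mono γ)) + D.sB m (D.dB m (mono γ)) =
    ((wt (cnt p m) γ : ℤ) : ℚ) • mono γ := by
  refine anticomm_mono (D.isDer_dB m) (D.dB_par m) (D.isDer_sB m) (D.sB_par m) _ (fun j => ?_) γ
  rcases j with i | i
  · rw [dB_inl, sB_pr, sB_inl, add_zero, cnt_inl]
    split_ifs with h <;> simp [dB_inr, h]
  · rw [sB_inr, dB_inr, map_zero, zero_add, cnt_inr]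
    split_ifs with h <;> simp [sB_inl, h]

theorem cnt_nonneg (j : ι ⊕ ι) : 0 ≤ cnt p m j := by
  unfold cnt; split_ifs <;> simp

theorem pr_mono (γ : ι ⊕ ι → ℕ) :
    pr m (mono γ : GC (bdeg p)) = if wt (cnt p m) γ = 0 then mono γ else 0 := by
  split_ifs with h
  · refine hom_mono_congr (ψ := AlgHom.id ℚ _) fun j hj => ?_
    have : γ j • cnt p m j = 0 := (Finset.sum_eq_zero_iff_of_nonneg
      (fun j _ => nsmul_nonneg (cnt_nonneg m j) _)).1 h j (Finset.mem_univ j)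
    rw [pr_X, if_neg]
    · rfl
    · intro hlt
      simp [cnt, hlt, hj] at this
  · obtain ⟨j, hj, hc⟩ := exists_ne_zero_of_wt h
    refine hom_mono_eq_zero hj ?_
    rw [pr_X, if_pos]
    by_contra hlt
    simp [cnt, hlt] at hc

theorem pr_inc_mem_cnt (x : GC p) : pr m (inc x) ∈ part (fun γ => wt (cnt p m) γ = 0) := by
  refine part_induction ((pr m).comp (inc (p := p))).toLinearMap _ (fun γ _ => ?_)
    (mem_part_true x)
  refine part_mono (fun γ' h => h.trans ?_)
    (hom_mono_mem ((pr m).comp (inc (p := p))) (fun _ => (0 : ℤ))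
      (fun a => part (fun γ => wt (cnt p m) γ = a)) (one_mem_part (by simp)) (graded_mul _)
      (fun i => ?_) γ)
  · simp only [AlgHom.comp_apply, inc_X, pr_inl]
    split_ifs with h
    · exact Submodule.zero_mem _
    · exact X_mem_part (by simp [cnt_inl, h])
  · simp [wt]

theorem dB_cnt {a : ℤ} {x : GC (bdeg p)} (hx : x ∈ part (fun γ => wt (cnt p m) γ = a)) :
    D.dB m x ∈ part (fun γ => wt (cnt p m) γ = a) := by
  have := (D.isDer_dB m).graded (cnt p m) (cnt p m) 0 (fun j => X_mem_part (by simp)) ?_ hx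
  · simpa using this
  rintro (i | i)
  · rw [dB_inl]
    by_cases h : p i < m
    · rw [D.pr_inc_d_X m h.le]; exact Submodule.zero_mem _
    · have : cnt p m (Sum.inl i) + 0 = 0 := by simp [cnt_inl, h]
      rw [this]
      exact pr_inc_mem_cnt m _
  · rw [dB_inr]
    split_ifs with h
    · exact X_mem_part (by simp [cnt_inl, cnt_inr])
    · exact Submodule.zero_mem _

/-- The contracting homotopy of the path algebra. -/
def hB : GC (bdeg p) →ₗ[ℚ] GC (bdeg p) :=
  D.sB m ∘ₗ diag fun γ => ((wt (cnt p m) γ : ℤ) : ℚ)⁻¹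

theorem pr_hB (x : GC (bdeg p)) : pr m (D.hB m x) = 0 := pr_sB ..

/-- Dividing the anticommutator identity by the count of killed letters gives a homotopy from the
identity to `pr m`. In count 0 the convention `0⁻¹ = 0` produces the projection term. -/
theorem dB_hB (x : GC (bdeg p)) : D.dB m (D.hB m x) = x - pr m x - D.hB m (D.dB m x) := by
  have : D.dB m ∘ₗ D.hB m + D.hB m ∘ₗ D.dB m = LinearMap.id - (pr m).toLinearMap := by
    refine linearMap_ext fun γ => ?_
    have h1 : D.dB m (mono γ) ∈ part (fun γ' => wt (cnt p m) γ' = wt (cnt p m) γ) :=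
      D.dB_cnt m (mono_mem_part rfl)
    simp only [hB, LinearMap.add_apply, LinearMap.comp_apply, LinearMap.sub_apply,
      LinearMap.id_apply, AlgHom.toLinearMap_apply, diag_mono, map_smul, pr_mono]
    rw [diag_eq_smul (r := ((wt (cnt p m) γ : ℤ) : ℚ)⁻¹) (fun γ' h => by rw [h]) h1, map_smul,
      ← smul_add, anticomm_dB_sB, smul_smul]
    split_ifs with h
    · simp [h]
    · rw [inv_mul_cancel₀ (by exact_mod_cast h), one_smul, sub_zero]
  have := DFunLike.congr_fun this x
  simp only [LinearMap.add_apply, LinearMap.comp_apply, LinearMap.sub_apply,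
      LinearMap.id_apply, AlgHom.toLinearMap_apply] at this
  rw [← this, add_sub_cancel_right]

/-- The number of unsuspended generators. -/
def om (ι : Type*) : ι ⊕ ι → ℤ := Sum.elim (fun _ => 1) fun _ => 0

theorem hB_apply (x : GC (bdeg p)) :
    D.hB m x = D.sB m (diag (fun γ => ((wt (cnt p m) γ : ℤ) : ℚ)⁻¹) x) := rfl

theorem hB_deg {n : ℤ} {x : GC (bdeg p)} (hx : x ∈ part (fun γ => deg (bdeg p) γ = n + 1)) :
    D.hB m x ∈ part (fun γ => deg (bdeg p) γ = n) := by
  have := (D.isDer_sB m).graded (fun j => (bdeg p j : ℤ)) (fun j => (bdeg p j : ℤ)) (-1)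
    (fun j => X_mem_part (by simp)) ?_ (diag_mem_part (fun γ => ((wt (cnt p m) γ : ℤ) : ℚ)⁻¹) hx)
  · simpa [hB_apply, deg] using this
  rintro (i | i)
  · rw [sB_inl]
    split_ifs
    · have := D.two_le i
      exact X_mem_part (by simp; omega)
    · exact Submodule.zero_mem _
  · rw [sB_inr]; exact Submodule.zero_mem _

theorem hB_om {n : ℤ} {x : GC (bdeg p)} (hx : x ∈ part (fun γ => n + 1 ≤ wt (om ι) γ)) :
    D.hB m x ∈ part (fun γ => n ≤ wt (om ι) γ) := by
  have := (D.isDer_sB m).filtered (om ι) (om ι) (-1)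
    (fun j => X_mem_part (by simp)) ?_ (diag_mem_part (fun γ => ((wt (cnt p m) γ : ℤ) : ℚ)⁻¹) hx)
  · simpa [hB_apply, len] using this
  rintro (i | i)
  · rw [sB_inl]
    split_ifs
    · exact X_mem_part (by simp [om])
    · exact Submodule.zero_mem _
  · rw [sB_inr]; exact Submodule.zero_mem _

theorem hB_len {n : ℤ} {x : GC (bdeg p)} (hx : x ∈ part (fun γ => n ≤ len γ)) :
    D.hB m x ∈ part (fun γ => n ≤ len γ) := by
  have := (D.isDer_sB m).filtered (fun _ => 1) (fun _ => 1) 0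
    (fun j => X_mem_part (by simp)) ?_ (diag_mem_part (fun γ => ((wt (cnt p m) γ : ℤ) : ℚ)⁻¹) hx)
  · simpa [hB_apply, len] using this
  rintro (i | i)
  · rw [sB_inl]
    split_ifs
    · exact X_mem_part (by simp)
    · exact Submodule.zero_mem _
  · rw [sB_inr]; exact Submodule.zero_mem _

/-- The projection of ΛV onto its quotient by the generators of degree below `m` is to be lifted to
a cochain map into the contractible enlargement. The corrected value on a generator depends only on
values on generators of smaller degree, so the equation for ψ is solved degree by degree. The three
membership clauses record that ψ preserves degree and that the corrections never lose the last
unsuspended letter. -/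
theorem exists_psi (n : ℕ) : ∃ ψ : GC p →ₐ[ℚ] GC (bdeg p),
    (∀ i, ψ (X i) ∈ part (fun γ => deg (bdeg p) γ = p i)) ∧
    (∀ i, ψ (X i) ∈ part (fun γ => 1 ≤ wt (om ι) γ)) ∧
    (∀ i, ψ (X i) ∈ part (fun γ => 1 ≤ len γ)) ∧
    ∀ i, p i < n → ψ (X i) = X (Sum.inl i) + D.hB m (ψ (D.d (X i))) := by
  induction n with
  | zero =>
    refine ⟨inc, fun i => ?_, fun i => ?_, fun i => ?_, by simp⟩ <;> rw [inc_X] <;>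
      exact X_mem_part (by simp [om])
  | succ n ih =>
    obtain ⟨ψ, h1, h2, h3, h4⟩ := ih
    have g1 : ∀ i, X (Sum.inl i) + D.hB m (ψ (D.d (X i))) ∈
        part (fun γ => deg (bdeg p) γ = p i) := fun i =>
      Submodule.add_mem _ (X_mem_part (by simp))
        (D.hB_deg m (hom_graded _ _ h1 (D.d_X_deg i)))
    have g2 : ∀ i, X (Sum.inl i) + D.hB m (ψ (D.d (X i))) ∈
        part (fun γ => 1 ≤ wt (om ι) γ) := fun i =>
      Submodule.add_mem _ (X_mem_part (by simp [om]))
        (D.hB_om m (hom_filtered (fun _ => 1) _ h2 (D.d_X_len i)))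
    have g3 : ∀ i, X (Sum.inl i) + D.hB m (ψ (D.d (X i))) ∈
        part (fun γ => 1 ≤ len γ) := fun i =>
      Submodule.add_mem _ (X_mem_part (by simp))
        (D.hB_len m (part_mono (fun γ (h : 2 ≤ len γ) => (by omega : 1 ≤ len γ))
          (hom_filtered (fun _ => 1) (fun _ => 1) h3 (D.d_X_len i))))
    refine ⟨liftPar (fun i => X (Sum.inl i) + D.hB m (ψ (D.d (X i)))) fun i =>
      part_deg_le_par rfl (g1 i), ?_, ?_, ?_, ?_⟩
    · intro i; rw [liftPar_X]; exact g1 i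
    · intro i; rw [liftPar_X]; exact g2 i
    · intro i; rw [liftPar_X]; exact g3 i
    · intro i hi
      rw [liftPar_X]
      -- The new map and the old one agree on the letters of `d (X i)`, all of which have degree
      -- below `n`, where the old map already solves the equation.
      congr 2
      refine eq_of_part (f := ψ.toLinearMap) (g := AlgHom.toLinearMap _) ?_ (D.d_X_lower i)
      rintro γ ⟨_, hγ⟩
      refine hom_mono_congr fun j hj => ?_
      rw [liftPar_X]
      exact h4 j (by have := hγ j hj; omega)

/-- The twisted embedding of the algebra in the path algebra. -/
def psi : GC p →ₐ[ℚ] GC (bdeg p) := (D.exists_psi m (Finset.univ.sup p + 1)).choose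

theorem psi_deg (i : ι) : D.psi m (X i) ∈ part (fun γ => deg (bdeg p) γ = p i) :=
  (D.exists_psi m _).choose_spec.1 i

theorem psi_om (i : ι) : D.psi m (X i) ∈ part (fun γ => 1 ≤ wt (om ι) γ) :=
  (D.exists_psi m _).choose_spec.2.1 i

theorem psi_len (i : ι) : D.psi m (X i) ∈ part (fun γ => 1 ≤ len γ) :=
  (D.exists_psi m _).choose_spec.2.2.1 i

theorem psi_X (i : ι) : D.psi m (X i) = X (Sum.inl i) + D.hB m (D.psi m (D.d (X i))) :=
  (D.exists_psi m _).choose_spec.2.2.2 i (Nat.lt_succ_of_le (Finset.le_sup (Finset.mem_univ i)))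

theorem psi_par (i : ι) : D.psi m (X i) ∈ par (p i) := part_deg_le_par rfl (D.psi_deg m i)

theorem pr_psi (x : GC p) : pr m (D.psi m x) = pr m (inc x) := by
  have : (pr m).comp (D.psi m) = (pr m).comp inc := algHom_ext fun i => by
    simp only [AlgHom.comp_apply]
    rw [psi_X, map_add, pr_hB, add_zero, inc_X]
  exact DFunLike.congr_fun this x

/-- By induction on the degree of the generator, `psi (d (X i))` is a cocycle. The homotopy formula
for `dB (hB _)` then leaves `psi (d (X i))` minus its `pr`-image, and that image is exactly `dB (X
(inl i))`. -/
theorem dB_psi (x : GC p) : D.dB m (D.psi m x) = D.psi m (D.d x) := by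
  have h1 : IsDer (D.psi m) (D.dB m ∘ₗ (D.psi m).toLinearMap) :=
    (D.isDer_dB m).comp_hom (D.psi_par m)
  have h2 : IsDer (D.psi m) ((D.psi m).toLinearMap ∘ₗ D.d) := D.isDer.hom_comp _
  have key : ∀ n, ∀ i, p i < n → D.dB m (D.psi m (X i)) = D.psi m (D.d (X i)) := by
    intro n
    induction n with
    | zero => simp
    | succ n ih =>
      intro i hi
      have hd : D.dB m (D.psi m (D.d (X i))) = D.psi m (D.d (D.d (X i))) := by
        refine eq_of_part (f := D.dB m ∘ₗ (D.psi m).toLinearMap)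
          (g := (D.psi m).toLinearMap ∘ₗ D.d) ?_ (D.d_X_lower i)
        rintro γ ⟨_, hγ⟩
        exact h1.mono_congr h2 fun j hj => ih j (by have := hγ j hj; omega)
      rw [psi_X, map_add, dB_hB, dB_inl, pr_psi, hd, D.d_d]
      simp
  exact DFunLike.congr_fun (h1.ext h2 fun i => key _ i (Nat.lt_succ_self _)) x

end MinDGA
end Sullivan

/-! ### The twisted differential on the path algebra, and nilpotence of generators in quotients. -/

namespace Sullivan
open GC

variable {ι : Type*} {p : ι → ℕ} [DecidableEq ι] [GenList ι] [Fintype ι]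

namespace MinDGA

variable (D : MinDGA p) (m : ℕ)

/-- The endomorphism of the path algebra which extends the twisted embedding. -/
def phi : GC (bdeg p) →ₐ[ℚ] GC (bdeg p) :=
  liftPar (Sum.elim (fun i => D.psi m (X i)) fun i => X (Sum.inr i)) <| by
    rintro (i | i)
    · exact D.psi_par m i
    · exact X_mem_par (p := bdeg p) (Sum.inr i)

theorem phi_inl (i : ι) : D.phi m (X (Sum.inl i)) = D.psi m (X i) := liftPar_X ..

theorem phi_inr (i : ι) : D.phi m (X (Sum.inr i)) = X (Sum.inr i) := liftPar_X ..

theorem phi_inc (x : GC p) : D.phi m (inc x) = D.psi m x := by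
  have : (D.phi m).comp inc = D.psi m := algHom_ext fun i => by
    simp only [AlgHom.comp_apply]
    rw [inc_X, phi_inl]
  exact DFunLike.congr_fun this x

theorem phi_X_deg (j : ι ⊕ ι) :
    D.phi m (X j) ∈ part (fun γ => deg (bdeg p) γ = bdeg p j) := by
  rcases j with i | i
  · rw [phi_inl]; exact D.psi_deg m i
  · rw [phi_inr]; exact X_mem_part (by simp)

theorem phi_deg {n : ℤ} {x : GC (bdeg p)} (hx : x ∈ part (fun γ => deg (bdeg p) γ = n)) :
    D.phi m x ∈ part (fun γ => deg (bdeg p) γ = n) :=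
  hom_graded _ _ (D.phi_X_deg m) hx

theorem phi_X_par (j : ι ⊕ ι) : D.phi m (X j) ∈ par (bdeg p j) :=
  part_deg_le_par rfl (D.phi_X_deg m j)

/-- The elements of degree `n` in which each monomial has at least `k` unsuspended generators. -/
def bpart (p : ι → ℕ) (n k : ℤ) : Submodule ℚ (GC (bdeg p)) :=
  part (fun γ => deg (bdeg p) γ = n ∧ k ≤ wt (om ι) γ)

theorem bpart_mul {a b a' b' : ℤ} {x y : GC (bdeg p)} (hx : x ∈ bpart p a b)
    (hy : y ∈ bpart p a' b') : x * y ∈ bpart p (a + a') (b + b') :=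
  mul_mem_part (by
    rintro γ γ' ⟨h1, h2⟩ ⟨h3, h4⟩
    simp only [deg, wt_add] at *
    omega) hx hy

theorem mono_mem_map_phi {n : ℕ}
    (h : ∀ i, p i < n → ∃ x ∈ bpart p (p i) 1, D.phi m x = X (Sum.inl i)) (γ : ι ⊕ ι → ℕ)
    (hγ : ∀ i, γ (Sum.inl i) ≠ 0 → p i < n) :
    (mono γ : GC (bdeg p)) ∈ (bpart p (deg (bdeg p) γ) (wt (om ι) γ)).map
      (D.phi m).toLinearMap := by
  refine mono_induction (C := fun γ y => (∀ i, γ (Sum.inl i) ≠ 0 → p i < n) →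
    y ∈ (bpart p (deg (bdeg p) γ) (wt (om ι) γ)).map (D.phi m).toLinearMap) ?_ ?_ γ hγ
  · exact fun _ => ⟨1, one_mem_part (by simp [deg]), by simp⟩
  · intro j γ y ih hγ
    obtain ⟨z, hz, rfl⟩ := ih fun i hi => hγ i (by simp [hi])
    have : ∃ x ∈ bpart p (bdeg p j) (om ι j), D.phi m x = X j := by
      rcases j with i | i
      · exact h i (hγ i (by simp))
      · exact ⟨X (Sum.inr i), X_mem_part (by simp [deg, om]), D.phi_inr m i⟩
    obtain ⟨x, hx, hxj⟩ := this
    refine ⟨x * z, ?_, by simp [hxj]⟩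
    have := bpart_mul hx hz
    simp only [deg, wt_add, wt_single]
    rwa [add_comm (wt _ γ), add_comm (wt (om ι) γ)]

/-- The map `phi` is unipotent: it moves an unsuspended generator by a correction in which every
unsuspended letter has smaller degree. By induction the correction has a preimage, and subtracting
that preimage from the generator gives the required element. The bound on unsuspended letters is
carried along because `dl_inr` needs it. -/
theorem exists_phi_eq_inl (i : ι) : ∃ x ∈ bpart p (p i) 1, D.phi m x = X (Sum.inl i) := by
  have key : ∀ n, ∀ i, p i < n → ∃ x ∈ bpart p (p i) 1, D.phi m x = X (Sum.inl i) := by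
    intro n
    induction n with
    | zero => simp
    | succ n ih =>
      intro i hi
      have h1 : D.hB m (D.psi m (D.d (X i))) ∈
          (bpart p (p i) 1).map (D.phi m).toLinearMap := by
        have e1 := D.hB_deg m (hom_graded _ _ (D.psi_deg m) (D.d_X_deg i))
        have e2 := D.hB_om m (n := 1) (hom_filtered (fun _ => 1) _ (D.psi_om m) (D.d_X_len i))
        have e3 := D.hB_len m (hom_filtered (fun _ => 1) (fun _ => 1) (D.psi_len m) (D.d_X_len i))
        refine part_induction LinearMap.id _ ?_ (mem_part_and (mem_part_and e1 e2) e3)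
        rintro γ ⟨⟨g1, g2⟩, g3⟩
        have := D.mono_mem_map_phi m ih γ ?_
        · refine Submodule.map_mono ?_ this
          refine part_mono ?_
          rintro γ' ⟨g4, g5⟩
          exact ⟨g4.trans g1, g2.trans g5⟩
        · intro j hj
          obtain ⟨γ', rfl⟩ := exists_add_single hj
          have : len γ' ≤ deg (bdeg p) γ' :=
            wt_le_wt (fun j => by exact_mod_cast D.one_le_bdeg j) γ'
          simp only [deg, len, wt_add, wt_single, bdeg_inl] at g1 g3 this
          omega
      obtain ⟨z, hz, hz'⟩ := h1
      refine ⟨X (Sum.inl i) - z, ?_, ?_⟩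
      · exact Submodule.sub_mem _ (X_mem_part (by simp [deg, om])) hz
      · simp only [AlgHom.toLinearMap_apply] at hz'
        rw [map_sub, hz', phi_inl, psi_X, add_sub_cancel_right]
  exact key _ i (Nat.lt_succ_self _)

theorem phi_surjective : Function.Surjective (D.phi m) := by
  intro y
  have := part_induction LinearMap.id (LinearMap.range (D.phi m).toLinearMap) (fun γ _ => ?_)
    (mem_part_true y)
  · exact this
  · obtain ⟨z, _, hz⟩ := D.mono_mem_map_phi m (n := Finset.univ.sup p + 1)
      (fun i _ => D.exists_phi_eq_inl m i) γ
      (fun i _ => Nat.lt_succ_of_le (Finset.le_sup (Finset.mem_univ i)))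
    exact ⟨z, hz⟩

theorem phi_proj (n : ℤ) (x : GC (bdeg p)) :
    D.phi m (proj (fun γ => deg (bdeg p) γ = n) x) =
      proj (fun γ => deg (bdeg p) γ = n) (D.phi m x) := by
  have : (D.phi m).toLinearMap ∘ₗ proj (fun γ => deg (bdeg p) γ = n) =
      proj (fun γ => deg (bdeg p) γ = n) ∘ₗ (D.phi m).toLinearMap := by
    refine linearMap_ext fun γ => ?_
    have h1 := D.phi_deg m (mono_mem_part (p := bdeg p) (Q := fun γ' => deg (bdeg p) γ' =
      deg (bdeg p) γ) rfl)
    simp only [LinearMap.comp_apply, AlgHom.toLinearMap_apply]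
    by_cases h : deg (bdeg p) γ = n
    · subst h
      rw [proj_eq_self h1, proj_eq_self (mono_mem_part (Q := fun γ' => deg (bdeg p) γ' =
        deg (bdeg p) γ) rfl)]
    · rw [proj_eq_zero (mono_mem_part (Q := fun γ' => γ' = γ) rfl) (by rintro _ rfl; exact h),
        proj_eq_zero h1 (fun γ' h' => h' ▸ h), map_zero]
  exact DFunLike.congr_fun this x

/-- `phi` preserves degree, and all path generators have positive degree, so every homogeneous
component is finite dimensional. A surjective endomorphism of such a component is injective. -/
theorem phi_injective : Function.Injective (D.phi m) := by
  rw [injective_iff_map_eq_zero]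
  intro x hx
  have key : ∀ n : ℤ, proj (fun γ => deg (bdeg p) γ = n) x = 0 := by
    intro n
    have := finiteDimensional_part (p := bdeg p) (finite_deg_eq D.one_le_bdeg n)
    let f : (part (fun γ => deg (bdeg p) γ = n) : Submodule ℚ (GC (bdeg p))) →ₗ[ℚ]
        (part (fun γ => deg (bdeg p) γ = n) : Submodule ℚ (GC (bdeg p))) :=
      (D.phi m).toLinearMap.restrict fun x hx => D.phi_deg m hx
    have hs : Function.Surjective f := by
      rintro ⟨y, hy⟩
      obtain ⟨z, rfl⟩ := D.phi_surjective m y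
      refine ⟨⟨proj (fun γ => deg (bdeg p) γ = n) z, proj_mem _ _⟩, Subtype.ext ?_⟩
      change D.phi m (proj (fun γ => deg (bdeg p) γ = n) z) = D.phi m z
      rw [phi_proj, proj_eq_self hy]
    have hi : Function.Injective f := LinearMap.injective_iff_surjective.2 hs
    have h0 : f ⟨proj (fun γ => deg (bdeg p) γ = n) x, proj_mem _ _⟩ = f 0 := by
      refine Subtype.ext ?_
      change D.phi m (proj (fun γ => deg (bdeg p) γ = n) x) = D.phi m 0
      rw [phi_proj, hx, map_zero, map_zero]
    exact congrArg Subtype.val (hi h0)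
  refine coord_injective (Finsupp.ext fun γ => ?_)
  have := key (deg (bdeg p) γ)
  have := congrArg (fun y => coord y γ) this
  simpa [proj, coord_diag] using this

/-- The automorphism of the path algebra which extends the twisted embedding. -/
def phiE : GC (bdeg p) ≃ₐ[ℚ] GC (bdeg p) :=
  AlgEquiv.ofBijective (D.phi m) ⟨D.phi_injective m, D.phi_surjective m⟩

/-- The twisted differential of the path algebra. -/
def dl : GC (bdeg p) →ₗ[ℚ] GC (bdeg p) :=
  (D.phiE m).symm.toLinearMap ∘ₗ D.dB m ∘ₗ (D.phi m).toLinearMap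

theorem phi_dl (x : GC (bdeg p)) : D.phi m (D.dl m x) = D.dB m (D.phi m x) :=
  (D.phiE m).apply_symm_apply _

theorem dl_eq {x y : GC (bdeg p)} (h : D.phi m y = D.dB m (D.phi m x)) : D.dl m x = y :=
  D.phi_injective m (by rw [phi_dl, h])

theorem isDer_dl : IsDer (AlgHom.id ℚ _) (D.dl m) := fun x y => D.dl_eq m (by
  simp only [map_add, map_mul, phi_dl, AlgHom.id_apply, ← sgn_comp _ (D.phi_X_par m)]
  exact (D.isDer_dB m _ _).symm)

theorem dl_dl (x : GC (bdeg p)) : D.dl m (D.dl m x) = 0 := D.dl_eq m (by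
  rw [phi_dl, dB_dB, map_zero])

/-- Conjugating by `phi` straightens the twisted embedding into the standard inclusion. With `dl`,
the path algebra is thus an extension of ΛV by suspended generators. -/
theorem dl_inc (x : GC p) : D.dl m (inc x) = inc (D.d x) := D.dl_eq m (by
  rw [phi_inc, phi_inc, dB_psi])

theorem dl_inr (i : ι) : D.dl m (X (Sum.inr i)) ∈ bpart p (p i) 1 := by
  by_cases h : p i < m
  · obtain ⟨x, hx, hx'⟩ := D.exists_phi_eq_inl m i
    rwa [D.dl_eq m (y := x) (by rw [hx', phi_inr, dB_inr, if_pos h])]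
  · rw [D.dl_eq m (y := 0) (by rw [phi_inr, dB_inr, if_neg h, map_zero])]
    exact Submodule.zero_mem _

/-- The degree of the suspended generators. -/
def nu (p : ι → ℕ) : ι ⊕ ι → ℤ := Sum.elim (fun _ => 0) fun i => ((p i - 1 : ℕ) : ℤ)

theorem nu_nonneg (j : ι ⊕ ι) : 0 ≤ nu p j := by
  rcases j with i | i <;> simp [nu]

include D in
-- Each unsuspended letter contributes at least 2 to the degree and nothing to `nu`.
theorem nu_add_om_le (γ : ι ⊕ ι → ℕ) : wt (nu p) γ + 2 * wt (om ι) γ ≤ deg (bdeg p) γ := by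
  have : wt (nu p) γ + 2 * wt (om ι) γ = wt (fun j => nu p j + 2 * om ι j) γ := by
    simp [wt, Finset.mul_sum, Finset.sum_add_distrib, mul_add, mul_left_comm]
  rw [this]
  refine wt_le_wt (fun j => ?_) γ
  rcases j with i | i
  · have := D.two_le i
    simp [nu, om]; omega
  · simp [nu, om]

theorem dl_inr_nu (i : ι) :
    D.dl m (X (Sum.inr i)) ∈ part (fun γ => wt (nu p) γ ≤ nu p (Sum.inr i) + -1) := by
  refine part_mono ?_ (D.dl_inr m i)
  rintro γ ⟨h1, h2⟩
  have h3 := D.nu_add_om_le γ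
  have h4 := D.two_le i
  simp only [nu, Sum.elim_inr] at *
  omega

/-- The untwisted differential. -/
def dZero : GC (bdeg p) →ₗ[ℚ] GC (bdeg p) :=
  der (Sum.elim (fun i => inc (D.d (X i))) fun _ => 0) <| by
    rintro (i | i)
    · exact hom_par (fun i => inc_X_par i) (D.d_X_par i)
    · exact Submodule.zero_mem _

theorem isDer_dZero : IsDer (AlgHom.id ℚ _) D.dZero := isDer_der _ _

theorem dZero_inl (i : ι) : D.dZero (X (Sum.inl i)) = inc (D.d (X i)) := der_X ..

theorem dZero_inr (i : ι) : D.dZero (X (Sum.inr i)) = 0 := der_X ..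

theorem dZero_inc (x : GC p) : D.dZero (inc x) = inc (D.d x) := by
  have h1 : IsDer inc (D.dZero ∘ₗ inc.toLinearMap) :=
    D.isDer_dZero.comp_hom (fun i => inc_X_par i)
  have h2 : IsDer inc (inc.toLinearMap ∘ₗ D.d) := D.isDer.hom_comp _
  refine DFunLike.congr_fun (h1.ext h2 fun i => ?_) x
  simp only [LinearMap.comp_apply, AlgHom.toLinearMap_apply]
  rw [inc_X, dZero_inl]

theorem inc_nu (x : GC p) : inc x ∈ part (fun γ => wt (nu p) γ = 0) := by
  have hx : x ∈ part (fun γ => wt (fun _ => (0 : ℤ)) γ = 0) :=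
    mem_part_iff.2 fun γ _ => by simp [wt]
  exact hom_graded _ _ (fun i => by rw [inc_X]; exact X_mem_part (by simp [nu])) hx

theorem dZero_nu {k : ℤ} {x : GC (bdeg p)} (hx : x ∈ part (fun γ => wt (nu p) γ = k)) :
    D.dZero x ∈ part (fun γ => wt (nu p) γ = k) := by
  have := D.isDer_dZero.graded (nu p) (nu p) 0 (fun j => X_mem_part (by simp)) ?_ hx
  · simpa using this
  rintro (i | i)
  · rw [dZero_inl]; exact inc_nu _
  · rw [dZero_inr]; exact Submodule.zero_mem _

/-- The two differentials agree on ΛV, and `dl` turns a suspended generator into terms with an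
unsuspended letter, which lowers the suspended degree. Hence `dZero`, the differential of ΛV with
suspended generators as constants, is the leading part of `dl`. -/
theorem dl_sub_dZero_nu {k : ℤ} {x : GC (bdeg p)} (hx : x ∈ part (fun γ => wt (nu p) γ ≤ k)) :
    D.dl m x - D.dZero x ∈ part (fun γ => wt (nu p) γ ≤ k + -1) := by
  refine ((D.isDer_dl m).sub D.isDer_dZero).filtered_le (nu p) (nu p) (-1)
    (fun j => X_mem_part (by simp)) ?_ hx
  rintro (i | i)
  · rw [LinearMap.sub_apply, dZero_inl, ← inc_X, dl_inc, sub_self]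
    exact Submodule.zero_mem _
  · rw [LinearMap.sub_apply, dZero_inr, sub_zero]
    exact D.dl_inr_nu m i

theorem dl_deg {n : ℤ} {x : GC (bdeg p)} (hx : x ∈ part (fun γ => deg (bdeg p) γ = n)) :
    D.dl m x ∈ part (fun γ => deg (bdeg p) γ = n + 1) := by
  refine (D.isDer_dl m).graded _ _ 1 (fun j => X_mem_part (by simp)) ?_ hx
  rintro (i | i)
  · rw [← inc_X, dl_inc]; exact inc_deg (D.d_X_deg i)
  · refine part_mono ?_ (D.dl_inr m i)
    rintro γ ⟨h1, _⟩
    have := D.two_le i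
    simp only [deg, bdeg_inr] at *
    omega

/-- The monomial in the suspended generators with given exponent. -/
def wmon (β : ι → ℕ) : GC (bdeg p) := mono (Sum.elim 0 β)

theorem mono_sum (γ : ι ⊕ ι → ℕ) : (mono γ : GC (bdeg p)) =
    inc (mono fun i => γ (Sum.inl i)) * wmon fun i => γ (Sum.inr i) := by
  have h1 : ∀ γ : ι ⊕ ι → ℕ, (mono γ : GC (bdeg p)) =
      (GenList.list.map fun i => X (Sum.inl i) ^ γ (Sum.inl i)).prod *
        (GenList.list.map fun i => X (Sum.inr i) ^ γ (Sum.inr i)).prod := by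
    intro γ
    change ((GenList.list.map Sum.inl ++ GenList.list.map Sum.inr).map _).prod = _
    rw [List.map_append, List.prod_append, List.map_map, List.map_map]
    rfl
  rw [h1 γ, wmon, h1]
  have h2 : (inc (mono fun i => γ (Sum.inl i)) : GC (bdeg p)) =
      (GenList.list.map fun i => X (Sum.inl i) ^ γ (Sum.inl i)).prod := by
    rw [mono, map_list_prod, List.map_map]
    congr 2
    funext i
    simp
  rw [h2]
  simp

theorem dZero_inc_mul (c : GC p) (β : ι → ℕ) :
    D.dZero (inc c * wmon β) = inc (D.d c) * wmon β := by
  have h : D.dZero (wmon β) = 0 := by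
    refine D.isDer_dZero.mono_congr (δ' := 0) .zero ?_
    rintro (i | i) hi
    · simp at hi
    · rw [dZero_inr]; rfl
  rw [D.isDer_dZero, h, mul_zero, add_zero, dZero_inc]
  rfl

open Classical in
/-- The coefficient of a monomial in the suspended generators. -/
def coef (β : ι → ℕ) : GC (bdeg p) →ₗ[ℚ] GC p :=
  Finsupp.lsum ℚ (fun γ => LinearMap.toSpanSingleton ℚ _
    (if (fun i => γ (Sum.inr i)) = β then mono fun i => γ (Sum.inl i) else 0)) ∘ₗ coord

open Classical in
theorem coef_mono {β : ι → ℕ} {γ : ι ⊕ ι → ℕ} (h : Valid (fun i => p i - 1) β) :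
    coef β (mono γ : GC (bdeg p)) =
      if (fun i => γ (Sum.inr i)) = β then (mono fun i => γ (Sum.inl i) : GC p) else 0 := by
  by_cases hγ : Valid (bdeg p) γ
  · simp [coef, coord_mono hγ]
  · rw [mono_eq_zero hγ, map_zero]
    split_ifs with e
    · rw [mono_eq_zero]
      intro h'
      apply hγ
      subst e
      rintro (i | i) hi
      · exact h' i hi
      · exact h i hi
    · rfl

open Classical in
theorem coef_inc_mul {β β' : ι → ℕ} (h : Valid (fun i => p i - 1) β) (c : GC p) :
    coef β (inc c * wmon β') = if β' = β then c else 0 := by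
  have : coef β ∘ₗ LinearMap.mulRight ℚ (wmon β') ∘ₗ inc.toLinearMap =
      if β' = β then LinearMap.id else (0 : GC p →ₗ[ℚ] GC p) := by
    refine linearMap_ext fun α => ?_
    simp only [LinearMap.comp_apply, AlgHom.toLinearMap_apply, LinearMap.mulRight_apply]
    have e := mono_sum (p := p) (Sum.elim α β')
    simp only [Sum.elim_inl, Sum.elim_inr] at e
    rw [← e, coef_mono h]
    change (if β' = β then (mono α : GC p) else 0) = _
    split_ifs <;> simp
  have := DFunLike.congr_fun this c
  simp only [LinearMap.comp_apply, AlgHom.toLinearMap_apply, LinearMap.mulRight_apply] at this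
  rw [this]
  split_ifs <;> rfl

theorem coef_dZero {β : ι → ℕ} (h : Valid (fun i => p i - 1) β) (x : GC (bdeg p)) :
    coef β (D.dZero x) = D.d (coef β x) := by
  classical
  have : coef β ∘ₗ D.dZero = D.d ∘ₗ coef β := by
    refine linearMap_ext fun γ => ?_
    simp only [LinearMap.comp_apply]
    rw [mono_sum, dZero_inc_mul, coef_inc_mul h, coef_inc_mul h]
    split_ifs <;> simp
  exact DFunLike.congr_fun this x

theorem exists_sum_coef (x : GC (bdeg p)) : ∃ S : Finset (ι → ℕ),
    (∀ β ∈ S, Valid (fun i => p i - 1) β ∧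
      ∃ γ : ι ⊕ ι → ℕ, coord x γ ≠ 0 ∧ β = fun i => γ (Sum.inr i)) ∧
    ∑ β ∈ S, inc (coef β x) * wmon β = x := by
  classical
  refine ⟨(coord x).support.image fun γ i => γ (Sum.inr i), ?_, ?_⟩
  · intro β hβ
    rw [Finset.mem_image] at hβ
    obtain ⟨γ, hγ, rfl⟩ := hβ
    rw [Finsupp.mem_support_iff] at hγ
    exact ⟨fun i hi => valid_of_coord_ne_zero hγ (Sum.inr i) hi, γ, hγ, rfl⟩
  · nth_rewrite 3 [← ofCoord_coord x]
    rw [ofCoord, Finsupp.linearCombination_apply, Finsupp.sum,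
      ← Finset.sum_fiberwise_of_maps_to (fun γ hγ => Finset.mem_image_of_mem
        (fun (γ : ι ⊕ ι → ℕ) i => γ (Sum.inr i)) hγ)]
    refine Finset.sum_congr rfl fun β hβ => ?_
    have : coef β x = ∑ γ ∈ (coord x).support with (fun i => γ (Sum.inr i)) = β,
        coord x γ • (mono fun i => γ (Sum.inl i) : GC p) := by
      rw [coef, LinearMap.comp_apply, Finsupp.lsum_apply, Finsupp.sum, Finset.sum_filter]
      refine Finset.sum_congr rfl fun γ _ => ?_
      split_ifs <;> simp
    rw [this, map_sum, Finset.sum_mul]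
    refine Finset.sum_congr rfl fun γ hγ => ?_
    rw [Finset.mem_filter] at hγ
    rw [map_smul, smul_mul_assoc, mono_sum γ, hγ.2]

theorem coef_deg {n : ℤ} {β : ι → ℕ} (h : Valid (fun i => p i - 1) β) {x : GC (bdeg p)}
    (hx : x ∈ part (fun γ => deg (bdeg p) γ = n)) :
    coef β x ∈ part (fun γ => deg p γ = n - wt (nu p) (Sum.elim 0 β)) := by
  refine part_induction _ _ (fun γ hγ => ?_) hx
  rw [coef_mono h]
  split_ifs with e
  · subst e
    refine mono_mem_part ?_
    rw [← hγ]
    simp [deg, wt, Fintype.sum_sum_type, nu]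
  · exact Submodule.zero_mem _

/-- Every cocycle of degree greater than `n₀` is a coboundary. -/
def VanishAbove (n₀ : ℤ) : Prop := ∀ n > n₀, ∀ z ∈ part (fun γ => deg p γ = n), D.d z = 0 →
  ∃ y ∈ part (fun γ => deg p γ = n - 1), D.d y = z

variable {D m}

/-- The complex for `dZero` is a direct sum of shifted copies of ΛV, one for each monomial in the
suspended generators. A cocycle of total degree `n` and suspended degree `k` has coefficients that
are cocycles of degree `n - k`, hence coboundaries. -/
theorem VanishAbove.dZero_exact {n₀ : ℤ} (H : D.VanishAbove n₀) {n k : ℤ} (hn : n₀ < n - k)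
    {z : GC (bdeg p)} (h1 : z ∈ part (fun γ => deg (bdeg p) γ = n))
    (h2 : z ∈ part (fun γ => wt (nu p) γ = k)) (hz : D.dZero z = 0) :
    ∃ y ∈ part (fun γ => deg (bdeg p) γ = n - 1), y ∈ part (fun γ => wt (nu p) γ = k) ∧
      D.dZero y = z := by
  obtain ⟨S, hS, hsum⟩ := exists_sum_coef z
  have hk : ∀ β ∈ S, wt (nu p) (Sum.elim 0 β) = k := by
    intro β hβ
    obtain ⟨_, γ, hγ, rfl⟩ := hS β hβ
    rw [← mem_part_iff.1 h2 γ hγ]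
    simp [wt, nu]
  have hex : ∀ β ∈ S, ∃ y ∈ part (fun γ => deg p γ = n - k - 1), D.d y = coef β z := by
    intro β hβ
    refine H (n - k) hn _ ?_ ?_
    · rw [← hk β hβ]; exact coef_deg (hS β hβ).1 h1
    · rw [← D.coef_dZero (hS β hβ).1, hz, map_zero]
  choose! y hy hyd using hex
  refine ⟨∑ β ∈ S, inc (y β) * wmon β, ?_, ?_, ?_⟩
  · refine Submodule.sum_mem _ fun β hβ => ?_
    have : (wmon β : GC (bdeg p)) ∈ part (fun γ => deg (bdeg p) γ = k) := by
      refine mono_mem_part ?_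
      rw [← hk β hβ]
      simp [deg, wt, nu]
    have := graded_mul _ _ _ _ (inc_deg (hy β hβ)) _ this
    rwa [show n - k - 1 + k = n - 1 by ring] at this
  · refine Submodule.sum_mem _ fun β hβ => ?_
    have : (wmon β : GC (bdeg p)) ∈ part (fun γ => wt (nu p) γ = k) := mono_mem_part (hk β hβ)
    have := graded_mul _ _ _ _ (inc_nu (y β)) _ this
    rwa [zero_add] at this
  · rw [map_sum, ← hsum]
    refine Finset.sum_congr rfl fun β hβ => ?_
    rw [dZero_inc_mul, hyd β hβ]

/-- Induction on the filtration by suspended degree: the top part of a `dl`-cocycle is a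
`dZero`-cocycle. Writing it as `dZero y` and subtracting `dl y` lowers the filtration. -/
theorem VanishAbove.dl_exact {n₀ : ℤ} (H : D.VanishAbove n₀) {n : ℤ} (k : ℕ) (hn : n₀ + k ≤ n)
    {z : GC (bdeg p)} (h1 : z ∈ part (fun γ => deg (bdeg p) γ = n))
    (h2 : z ∈ part (fun γ => wt (nu p) γ < k)) (hz : D.dl m z = 0) : ∃ y, D.dl m y = z := by
  induction k generalizing z with
  | zero =>
    refine ⟨0, ?_⟩
    rw [map_zero]
    refine (coord_injective (Finsupp.ext fun γ => ?_)).symm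
    by_contra hγ
    have := mem_part_iff.1 h2 γ (by simpa using hγ)
    have := wt_nonneg (nu_nonneg (p := p)) γ
    simp at *
    omega
  | succ k ih =>
    set t := proj (fun γ => wt (nu p) γ = k) z with ht
    have ht1 : t ∈ part (fun γ => deg (bdeg p) γ = n) := proj_mem_part _ h1
    have ht2 : t ∈ part (fun γ => wt (nu p) γ = k) := proj_mem _ _
    have hr : z - t ∈ part (fun γ => wt (nu p) γ < k) := by
      refine part_mono ?_ (sub_proj_mem (fun γ => wt (nu p) γ = k) h2)
      rintro γ ⟨h3, h4⟩
      push_cast at h3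
      omega
    have hlow : ∀ {x : GC (bdeg p)}, x ∈ part (fun γ => wt (nu p) γ < k) →
        D.dl m x ∈ part (fun γ => wt (nu p) γ < k) := by
      intro x hx
      have e1 := D.dl_sub_dZero_nu m (k := k - 1) (part_mono (fun γ hγ => by omega) hx)
      have e2 : D.dZero x ∈ part (fun γ => wt (nu p) γ < k) := by
        refine part_induction _ _ (fun γ (hγ : wt (nu p) γ < k) => ?_) hx
        exact part_mono (fun γ' h' => by rw [h']; exact hγ)
          (D.dZero_nu (mono_mem_part (Q := fun γ' => wt (nu p) γ' = wt (nu p) γ) rfl))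
      have := Submodule.add_mem _ (part_mono (fun γ hγ => by omega) e1) e2
      simpa using this
    have hd : D.dZero t = 0 := by
      have e1 : D.dZero t ∈ part (fun γ => wt (nu p) γ < k) := by
        have e3 := D.dl_sub_dZero_nu m (k := k) (x := t) (part_mono (fun γ hγ => by omega) ht2)
        have e4 := hlow hr
        rw [map_sub, hz, zero_sub] at e4
        have e5 : D.dl m t - D.dZero t ∈ part (fun γ => wt (nu p) γ < k) :=
          part_mono (fun γ hγ => by omega) e3
        have := Submodule.sub_mem _ (Submodule.neg_mem _ e4) e5
        simpa using this
      rw [← proj_eq_self (D.dZero_nu ht2)]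
      exact proj_eq_zero e1 fun γ h h' => by omega
    obtain ⟨y, hy1, hy2, hy⟩ := H.dZero_exact (n := n) (k := k) (by push_cast at hn; omega)
      ht1 ht2 hd
    have hzy : z - D.dl m y ∈ part (fun γ => wt (nu p) γ < k) := by
      have e3 := D.dl_sub_dZero_nu m (k := k) (x := y) (part_mono (fun γ hγ => by omega) hy2)
      rw [hy] at e3
      have := Submodule.sub_mem _ hr (part_mono (fun γ hγ => by omega) e3)
      rwa [sub_sub_sub_cancel_right] at this
    obtain ⟨y', hy'⟩ := ih (by push_cast at hn; omega) (Submodule.sub_mem _ h1 (by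
      have := D.dl_deg m hy1
      rwa [sub_add_cancel] at this)) hzy (by rw [map_sub, hz, dl_dl, sub_zero])
    exact ⟨y' + y, by rw [map_add, hy', sub_add_cancel]⟩

/-- The projection which kills the generators of degree less than `m`. -/
def kill (p : ι → ℕ) (m : ℕ) : GC p →ₐ[ℚ] GC p :=
  liftPar (fun i => if p i < m then 0 else X i) fun i => by
    split_ifs
    · exact Submodule.zero_mem _
    · exact X_mem_par i

theorem kill_X (i : ι) : kill p m (X i) = if p i < m then 0 else X i := liftPar_X ..

theorem kill_d_X {i : ι} (hi : p i ≤ m) : kill p m (D.d (X i)) = 0 := by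
  have := eq_of_part (f := (kill p m).toLinearMap) (g := 0) ?_ (D.d_X_lower i)
  · simpa using this
  · rintro γ ⟨⟨j, hj⟩, hγ⟩
    exact hom_mono_eq_zero (φ := kill p m) hj (by
      have := hγ j hj
      rw [kill_X, if_pos (by omega)])

/-- The retraction of the path algebra which kills the suspended generators and the generators of
degree less than `m`. -/
def retr (p : ι → ℕ) (m : ℕ) : GC (bdeg p) →ₐ[ℚ] GC p :=
  liftPar (Sum.elim (fun i => if p i < m then 0 else X i) fun _ => 0) <| by
    rintro (i | i)
    · simp only [Sum.elim_inl, bdeg_inl]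
      split_ifs
      · exact Submodule.zero_mem _
      · exact X_mem_par i
    · exact Submodule.zero_mem _

theorem retr_inl (i : ι) : retr p m (X (Sum.inl i)) = if p i < m then 0 else X i := liftPar_X ..

theorem retr_inr (i : ι) : retr p m (X (Sum.inr i)) = 0 := liftPar_X ..

theorem retr_par (j : ι ⊕ ι) : retr p m (X j) ∈ par (bdeg p j) := by
  rcases j with i | i
  · rw [retr_inl]
    split_ifs
    · exact Submodule.zero_mem _
    · exact X_mem_par i
  · rw [retr_inr]; exact Submodule.zero_mem _

theorem kill_retr (x : GC (bdeg p)) : kill p m (retr p m x) = retr p m x := by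
  have : (kill p m).comp (retr p m) = retr p m := algHom_ext fun j => by
    rcases j with i | i
    · simp only [AlgHom.comp_apply, retr_inl]
      split_ifs with h <;> simp [kill_X, h]
    · simp [retr_inr]
  exact DFunLike.congr_fun this x

theorem retr_pr_inc (x : GC p) : retr p m (pr m (inc x)) = kill p m x := by
  have : ((retr p m).comp (pr m)).comp inc = kill p m := algHom_ext fun i => by
    simp only [AlgHom.comp_apply, inc_X, pr_inl, kill_X]
    split_ifs with h
    · simp
    · rw [retr_inl, if_neg h]
  exact DFunLike.congr_fun this x

/-- The retraction is a cochain map onto the quotient of ΛV by generators of degree below `m`, whose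
differential is represented by `kill ∘ d`. It carries exactness in the path algebra to the quotient.
-/
theorem retr_dB (x : GC (bdeg p)) : retr p m (D.dB m x) = kill p m (D.d (retr p m x)) := by
  have h1 : IsDer (retr p m) ((retr p m).toLinearMap ∘ₗ D.dB m) := (D.isDer_dB m).hom_comp _
  have h2 : IsDer (retr p m) ((kill p m).toLinearMap ∘ₗ D.d ∘ₗ (retr p m).toLinearMap) := by
    have e : (kill p m).comp (retr p m) = retr p m := AlgHom.ext kill_retr
    have := (D.isDer.comp_hom (retr_par (m := m))).hom_comp (kill p m)
    rwa [AlgHom.id_comp, e] at this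
  refine DFunLike.congr_fun (h1.ext h2 fun j => ?_) x
  rcases j with i | i
  · simp only [LinearMap.comp_apply, AlgHom.toLinearMap_apply, dB_inl, retr_pr_inc, retr_inl]
    split_ifs with h
    · rw [kill_d_X h.le]; simp
    · rfl
  · simp only [LinearMap.comp_apply, AlgHom.toLinearMap_apply, dB_inr, retr_inr, map_zero]
    split_ifs with h
    · rw [retr_inl, if_pos h]
    · simp

/-- If the cohomology is bounded above, each generator `x` is nilpotent in the cohomology of the
quotient by the generators of smaller degree. -/
theorem VanishAbove.exists_pow_eq {n₀ : ℕ} (H : D.VanishAbove n₀) (i : ι) :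
    ∃ N y, (X i : GC p) ^ N = kill p (p i) (D.d y) := by
  obtain ⟨x, hx, hxi⟩ := D.exists_phi_eq_inl (p i) i
  have hdx : D.dl (p i) x = 0 := D.dl_eq _ (by
    rw [hxi, dB_inl, D.pr_inc_d_X _ le_rfl, map_zero])
  have hpow : ∀ N : ℕ, x ^ N ∈ bpart p (N * p i) N ∧ D.dl (p i) (x ^ N) = 0 := by
    intro N
    induction N with
    | zero =>
      refine ⟨?_, by simpa using (D.isDer_dl (p i)).map_one⟩
      rw [pow_zero]
      exact one_mem_part (by simp [deg])
    | succ N ih =>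
      rw [pow_succ']
      refine ⟨?_, ?_⟩
      · have := bpart_mul hx ih.1
        push_cast
        rwa [show ((N : ℤ) + 1) * p i = p i + N * p i by ring, add_comm (N : ℤ)]
      · rw [D.isDer_dl, hdx, ih.2]; simp
  -- With N = n₀ + 1, the power has degree N · p i and at least N unsuspended letters, so its
  -- suspended degree is at most N(p i - 2) < N(p i - 1). Since n₀ + N(p i - 1) ≤ N · p i, the
  -- vanishing range applies.
  obtain ⟨h1, h2⟩ := hpow (n₀ + 1)
  have h3 := D.two_le i
  obtain ⟨y, hy⟩ := H.dl_exact (m := p i) (n := ((n₀ + 1 : ℕ) : ℤ) * p i)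
    ((n₀ + 1) * (p i - 1)) (z := x ^ (n₀ + 1)) (by
      push_cast [Nat.cast_sub (show 1 ≤ p i by omega)]
      nlinarith) (part_mono (fun γ h => h.1) h1) (by
      refine part_mono ?_ h1
      rintro γ ⟨g1, g2⟩
      have := D.nu_add_om_le γ
      push_cast [Nat.cast_sub (show 1 ≤ p i by omega)] at *
      nlinarith) h2
  refine ⟨n₀ + 1, retr p (p i) (D.phi (p i) y), ?_⟩
  rw [← retr_dB, ← phi_dl, hy, map_pow, map_pow, hxi, retr_inl, if_neg (lt_irrefl _)]

end MinDGA
end Sullivan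

/-! ### The associated pure algebra: finiteness of its cohomology and exactness in large weight. -/

namespace Sullivan
open GC

variable {ι : Type*} {p : ι → ℕ} [DecidableEq ι] [GenList ι] [Fintype ι]

namespace GC

theorem proj_comm {f : GC p →ₗ[ℚ] GC p} (w : ι → ℤ) (r : ℤ)
    (h : ∀ a, ∀ x ∈ part (fun γ => wt w γ = a), f x ∈ part (fun γ => wt w γ = a + r)) (a : ℤ)
    (x : GC p) : proj (fun γ => wt w γ = a + r) (f x) = f (proj (fun γ => wt w γ = a) x) := by
  have : proj (fun γ => wt w γ = a + r) ∘ₗ f = f ∘ₗ proj (fun γ => wt w γ = a) := by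
    refine linearMap_ext fun γ => ?_
    have h0 : (mono γ : GC p) ∈ part (fun γ' => wt w γ' = wt w γ) := mono_mem_part rfl
    have h1 := h _ _ h0
    simp only [LinearMap.comp_apply]
    by_cases e : wt w γ = a
    · rw [e] at h0 h1
      rw [proj_eq_self h0, proj_eq_self h1]
    · rw [proj_eq_zero h0 (by intro γ' h' h''; omega),
        proj_eq_zero h1 (by intro γ' h' h''; omega), map_zero]
  exact DFunLike.congr_fun this x

theorem mem_center_of_par {x : GC p} (hx : x ∈ par 0) : x ∈ Subalgebra.center ℚ (GC p) := by
  rw [Subalgebra.mem_center_iff]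
  intro y
  have : LinearMap.mulRight ℚ x = LinearMap.mulLeft ℚ x := by
    refine linearMap_ext fun γ => ?_
    have := par_comm hx (mono_mem_part (p := p) (Q := fun γ' => wt p γ' % 2 = wt p γ % 2) rfl)
    simpa using this.symm
  exact DFunLike.congr_fun this y

/-- The number of odd generators in a monomial. -/
def oddWt (p : ι → ℕ) (i : ι) : ℤ := if Odd (p i) then 1 else 0

theorem oddWt_nonneg (i : ι) : 0 ≤ oddWt p i := by unfold oddWt; split_ifs <;> simp

/-- The projection which kills the odd generators. -/
def evenPr : GC p →ₐ[ℚ] GC p :=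
  liftPar (fun i => if Odd (p i) then 0 else X i) fun i => by
    split_ifs
    · exact Submodule.zero_mem _
    · exact X_mem_par i

theorem evenPr_X (i : ι) : evenPr (X i : GC p) = if Odd (p i) then 0 else X i := liftPar_X ..

theorem evenPr_X_par (i : ι) : evenPr (X i : GC p) ∈ par (p i) := by
  rw [evenPr_X]
  split_ifs
  · exact Submodule.zero_mem _
  · exact X_mem_par i

theorem evenPr_mono (γ : ι → ℕ) :
    evenPr (mono γ : GC p) = if wt (oddWt p) γ = 0 then mono γ else 0 := by
  split_ifs with h
  · refine hom_mono_congr (ψ := AlgHom.id ℚ _) fun j hj => ?_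
    have : γ j • oddWt p j = 0 := (Finset.sum_eq_zero_iff_of_nonneg
      (fun j _ => nsmul_nonneg (oddWt_nonneg j) _)).1 h j (Finset.mem_univ j)
    rw [evenPr_X, if_neg]
    · rfl
    · intro hlt
      simp [oddWt, hlt, hj] at this
  · obtain ⟨j, hj, hc⟩ := exists_ne_zero_of_wt h
    refine hom_mono_eq_zero hj ?_
    rw [evenPr_X, if_pos]
    by_contra hlt
    simp [oddWt, hlt] at hc

theorem evenPr_eq_proj (x : GC p) : evenPr x = proj (fun γ => wt (oddWt p) γ = 0) x := by
  have : evenPr.toLinearMap = proj (p := p) (fun γ => wt (oddWt p) γ = 0) := by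
    refine linearMap_ext fun γ => ?_
    rw [proj, diag_mono, AlgHom.toLinearMap_apply, evenPr_mono]
    split_ifs <;> simp
  exact DFunLike.congr_fun this x

theorem evenPr_mem (x : GC p) : evenPr x ∈ part (fun γ => wt (oddWt p) γ = 0) := by
  rw [evenPr_eq_proj]; exact proj_mem _ _

theorem oddWt_mod_two (γ : ι → ℕ) : wt (oddWt p) γ % 2 = (wt p γ : ℕ) % 2 := by
  unfold wt
  push_cast
  rw [Finset.sum_int_mod, Finset.sum_int_mod (f := fun i => ((γ i • p i : ℕ) : ℤ))]
  congr 1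
  refine Finset.sum_congr rfl fun i _ => ?_
  have : oddWt p i % 2 = (p i : ℤ) % 2 := by
    unfold oddWt
    split_ifs with h
    · obtain ⟨k, hk⟩ := h; omega
    · obtain ⟨k, hk⟩ := Nat.not_odd_iff_even.1 h; omega
  push_cast [nsmul_eq_mul]
  rw [Int.mul_emod, this, ← Int.mul_emod]

/-- The degree plus the number of odd generators. -/
def pureWt (p : ι → ℕ) (i : ι) : ℤ := p i + oddWt p i

theorem pureWt_eq (γ : ι → ℕ) : wt (pureWt p) γ = deg p γ + wt (oddWt p) γ := by
  simp [wt, pureWt, Finset.sum_add_distrib, mul_add]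

end GC

namespace MinDGA

variable (D : MinDGA p)

/-- The differential of the associated pure algebra. -/
def dS : GC p →ₗ[ℚ] GC p :=
  der (fun i => if Odd (p i) then evenPr (D.d (X i)) else 0) fun i => by
    split_ifs
    · exact hom_par evenPr_X_par (D.d_X_par i)
    · exact Submodule.zero_mem _

theorem isDer_dS : IsDer (AlgHom.id ℚ _) D.dS := isDer_der _ _

theorem dS_X (i : ι) : D.dS (X i) = if Odd (p i) then evenPr (D.d (X i)) else 0 := der_X ..

theorem dS_X_par (i : ι) : D.dS (X i) ∈ par (p i + 1) := by
  rw [dS_X]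
  split_ifs
  · exact hom_par evenPr_X_par (D.d_X_par i)
  · exact Submodule.zero_mem _

theorem dS_oddWt_zero {x : GC p} (hx : x ∈ part (fun γ => wt (oddWt p) γ = 0)) :
    D.dS x = 0 := by
  refine eq_of_part (f := D.dS) (g := 0) (fun γ hγ => ?_) hx
  refine D.isDer_dS.mono_congr .zero fun j hj => ?_
  have : γ j • oddWt p j = 0 := (Finset.sum_eq_zero_iff_of_nonneg
      (fun j _ => nsmul_nonneg (oddWt_nonneg j) _)).1 hγ j (Finset.mem_univ j)
  rw [dS_X, if_neg]
  · rfl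
  · intro hlt
    simp [oddWt, hlt, hj] at this

theorem dS_dS (x : GC p) : D.dS (D.dS x) = 0 := by
  refine sq_eq_zero D.isDer_dS D.dS_X_par (fun i => ?_) x
  rw [dS_X]
  split_ifs
  · exact D.dS_oddWt_zero (evenPr_mem _)
  · simp

theorem dS_oddWt {a : ℤ} {x : GC p} (hx : x ∈ part (fun γ => wt (oddWt p) γ = a)) :
    D.dS x ∈ part (fun γ => wt (oddWt p) γ = a + -1) := by
  refine D.isDer_dS.graded _ _ (-1) (fun i => X_mem_part (by simp)) (fun i => ?_) hx
  rw [dS_X]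
  split_ifs with h
  · simpa [oddWt, h] using evenPr_mem (D.d (X i))
  · exact Submodule.zero_mem _

theorem dS_deg {a : ℤ} {x : GC p} (hx : x ∈ part (fun γ => deg p γ = a)) :
    D.dS x ∈ part (fun γ => deg p γ = a + 1) := by
  refine D.isDer_dS.graded _ _ 1 (fun i => X_mem_part (by simp)) (fun i => ?_) hx
  rw [dS_X]
  split_ifs with h
  · rw [evenPr_eq_proj]; exact proj_mem_part _ (D.d_X_deg i)
  · exact Submodule.zero_mem _

theorem dS_pureWt {a : ℤ} {x : GC p} (hx : x ∈ part (fun γ => wt (pureWt p) γ = a)) :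
    D.dS x ∈ part (fun γ => wt (pureWt p) γ = a) := by
  have := D.isDer_dS.graded (pureWt p) (pureWt p) 0 (fun i => X_mem_part (by simp)) (fun i => ?_) hx
  · simpa using this
  rw [dS_X]
  split_ifs with h
  · rw [evenPr_eq_proj]
    refine part_mono ?_ (mem_part_and (proj_mem_part _ (D.d_X_deg i)) (proj_mem _ _))
    rintro γ ⟨h1, h2⟩
    rw [pureWt_eq, h1, h2]
    simp [pureWt, oddWt, h]
  · exact Submodule.zero_mem _

/-- Both sides are derivations along `evenPr`. They agree on odd generators by definition of `dS`;
on an even generator `d` has odd degree, so each of its monomials contains an odd letter and is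
killed. -/
theorem evenPr_d (x : GC p) : evenPr (D.d x) = evenPr (D.dS x) := by
  have h1 : IsDer evenPr (evenPr.toLinearMap ∘ₗ D.d) := D.isDer.hom_comp _
  have h2 : IsDer evenPr (evenPr.toLinearMap ∘ₗ D.dS) := D.isDer_dS.hom_comp _
  refine DFunLike.congr_fun (h1.ext h2 fun i => ?_) x
  simp only [LinearMap.comp_apply, AlgHom.toLinearMap_apply, dS_X]
  split_ifs with h
  · rw [evenPr_eq_proj (evenPr _), proj_eq_self (evenPr_mem _)]
  · rw [map_zero, evenPr_eq_proj]
    refine proj_eq_zero (D.d_X_par i) fun γ hγ h0 => ?_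
    have := oddWt_mod_two (p := p) γ
    obtain ⟨k, hk⟩ := Nat.not_odd_iff_even.1 h
    omega

/-- `dS` removes exactly one odd letter, so the purely even part of `dS x` comes from the part of
`x` with one odd letter. -/
theorem exists_dS_eq_evenPr_d (x : GC p) : ∃ y, D.dS y = evenPr (D.d x) :=
  ⟨proj (fun γ => wt (oddWt p) γ = 1) x, by
    rw [evenPr_d, evenPr_eq_proj, ← proj_comm (oddWt p) (-1) (fun a x hx => D.dS_oddWt hx)]
    rfl⟩

/-- The ring of polynomials in the even generators. -/
abbrev EvenRing (p : ι → ℕ) : Type _ := MvPolynomial {i // Even (p i)} ℚ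

theorem X_mem_par_zero {i : ι} (hi : Even (p i)) : (X i : GC p) ∈ par 0 :=
  X_mem_part (by rw [wt_single]; obtain ⟨k, hk⟩ := hi; omega)

/-- The map of the ring of polynomials in the even generators to the algebra. -/
def ev (p : ι → ℕ) : EvenRing p →ₐ[ℚ] GC p :=
  (Subalgebra.center ℚ (GC p)).val.comp
    (MvPolynomial.aeval fun i => ⟨X i.1, mem_center_of_par (X_mem_par_zero i.2)⟩)

theorem ev_X (i : {i // Even (p i)}) : ev p (MvPolynomial.X i) = X i.1 := by simp [ev]

theorem ev_comm (f : EvenRing p) (x : GC p) : x * ev p f = ev p f * x :=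
  Subalgebra.mem_center_iff.1 (MvPolynomial.aeval (R := ℚ)
    (fun i : {i // Even (p i)} => (⟨X i.1, mem_center_of_par (X_mem_par_zero i.2)⟩ :
      Subalgebra.center ℚ (GC p))) f).2 x

theorem ev_mem (f : EvenRing p) : ev p f ∈ part (fun γ => wt (oddWt p) γ = 0) := by
  induction f using MvPolynomial.induction_on with
  | C a =>
    rw [← MvPolynomial.algebraMap_eq, AlgHom.commutes, Algebra.algebraMap_eq_smul_one]
    exact Submodule.smul_mem _ _ (one_mem_part (by simp))
  | add f g hf hg => rw [map_add]; exact Submodule.add_mem _ hf hg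
  | mul_X f i hf =>
    rw [map_mul, ev_X]
    refine mul_mem_part ?_ hf (X_mem_part (Q := fun γ => wt (oddWt p) γ = 0) ?_)
    · intro a b h h'; rw [wt_add, h, h', add_zero]
    · simp [oddWt, i.2]

theorem exists_ev_eq {x : GC p} (hx : x ∈ part (fun γ => wt (oddWt p) γ = 0)) :
    ∃ f, ev p f = x := by
  refine part_induction LinearMap.id (LinearMap.range (ev p).toLinearMap) (fun γ hγ => ?_) hx
  have : ∀ j, γ j ≠ 0 → Even (p j) := by
    intro j hj
    have : γ j • oddWt p j = 0 := (Finset.sum_eq_zero_iff_of_nonneg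
      (fun j _ => nsmul_nonneg (oddWt_nonneg j) _)).1 hγ j (Finset.mem_univ j)
    rw [← Nat.not_odd_iff_even]
    intro hlt
    simp [oddWt, hlt, hj] at this
  refine mono_induction (C := fun γ x => (∀ j, γ j ≠ 0 → Even (p j)) →
    x ∈ LinearMap.range (ev p).toLinearMap) (fun _ => ⟨1, by simp⟩) ?_ γ this
  intro i γ x ih h
  obtain ⟨f, rfl⟩ := ih fun j hj => h j (by simp [hj])
  exact ⟨MvPolynomial.X ⟨i, h i (by simp)⟩ * f, by simp [ev_X]⟩

theorem dS_ev_mul (f : EvenRing p) (x : GC p) : D.dS (ev p f * x) = ev p f * D.dS x := by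
  have h : ev p f ∈ par 0 := part_mono (fun γ h => by
    have := oddWt_mod_two (p := p) γ; omega) (ev_mem f)
  rw [D.isDer_dS, D.dS_oddWt_zero (ev_mem f), sgn_of_par h]
  simp

instance : Module (EvenRing p) (GC p) := Module.compHom (GC p) (ev p).toRingHom

theorem ev_smul (f : EvenRing p) (x : GC p) : f • x = ev p f * x := rfl

instance : Module.Finite (EvenRing p) (GC p) := by
  refine ⟨Submodule.fg_def.2 ⟨mono '' Set.Iic (fun _ : ι => 1), (Set.finite_Iic _).image _, ?_⟩⟩
  set S := Submodule.span (EvenRing p) (mono '' Set.Iic (fun _ : ι => 1) : Set (GC p)) with hS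
  have hX : ∀ i, ∀ x ∈ S, X i * x ∈ S := by
    intro i x hx
    by_cases hi : Even (p i)
    · have := S.smul_mem (MvPolynomial.X ⟨i, hi⟩) hx
      rwa [ev_smul, ev_X] at this
    · induction hx using Submodule.span_induction with
      | mem x hx =>
        obtain ⟨γ, hγ, rfl⟩ := hx
        obtain ⟨c, hc⟩ := X_mul_mono (p := p) i γ
        have hc' : (X i * mono γ : GC p) =
            (MvPolynomial.C c : EvenRing p) • mono (γ + Pi.single i 1) := by
          rw [hc, ev_smul, ← MvPolynomial.algebraMap_eq, AlgHom.commutes, Algebra.smul_def]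
        rw [hc']
        by_cases hγi : γ i = 0
        · refine S.smul_mem _ (Submodule.subset_span ⟨_, fun j => ?_, rfl⟩)
          by_cases hj : j = i
          · subst hj; simp [hγi]
          · simpa [hj] using hγ j
        · rw [mono_eq_zero, smul_zero]
          · exact S.zero_mem
          · intro h
            have := h i (Nat.not_even_iff_odd.1 hi)
            simp at this
            omega
      | zero => rw [mul_zero]; exact S.zero_mem
      | add x y _ _ hx hy => rw [mul_add]; exact S.add_mem hx hy
      | smul f x _ hx =>
        rw [ev_smul, ← mul_assoc, ev_comm, mul_assoc]
        exact S.smul_mem f hx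
  rw [eq_top_iff]
  intro x _
  rw [← ofCoord_coord x, ofCoord, Finsupp.linearCombination_apply]
  refine Submodule.sum_mem _ fun γ _ => ?_
  have hm : (mono γ : GC p) ∈ S :=
    mono_induction (C := fun _ x => x ∈ S)
      (Submodule.subset_span ⟨0, fun _ => Nat.zero_le _, mono_zero⟩)
      (fun i _ x hx => hX i x hx) γ
  have : (coord x γ) • (mono γ : GC p) = (MvPolynomial.C (coord x γ) : EvenRing p) • mono γ := by
    rw [ev_smul, ← MvPolynomial.algebraMap_eq, AlgHom.commutes, Algebra.smul_def]
  simp only [this]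
  exact S.smul_mem _ hm

/-- The polynomials in the even generators which are coboundaries in the pure algebra. -/
def bdryIdeal : Ideal (EvenRing p) where
  carrier := {f | ∃ y, D.dS y = ev p f}
  add_mem' := by
    rintro f g ⟨y, hy⟩ ⟨z, hz⟩
    exact ⟨y + z, by rw [map_add, map_add, hy, hz]⟩
  zero_mem' := ⟨0, by simp⟩
  smul_mem' := by
    rintro f g ⟨y, hy⟩
    exact ⟨ev p f * y, by rw [dS_ev_mul, hy, smul_eq_mul, map_mul]⟩

variable {D}

/-- Induction on the degree of the even generator. The purely even part of the nilpotence relation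
shows that a power of it is a coboundary polynomial with the smaller variables set to zero. Those
variables are already in the radical, so restoring them changes nothing modulo the radical. -/
theorem VanishAbove.X_mem_radical {n₀ : ℕ} (H : D.VanishAbove n₀) (i : {i // Even (p i)}) :
    MvPolynomial.X i ∈ D.bdryIdeal.radical := by
  have key : ∀ n, ∀ i : {i // Even (p i)}, p i.1 < n →
      MvPolynomial.X i ∈ D.bdryIdeal.radical := by
    intro n
    induction n with
    | zero => simp
    | succ n ih =>
      intro i hi
      obtain ⟨N, y, hy⟩ := H.exists_pow_eq i.1
      have hcomm : ∀ x : GC p, evenPr (kill p (p i.1) x) = kill p (p i.1) (evenPr x) := by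
        intro x
        have : (evenPr.comp (kill p (p i.1)) : GC p →ₐ[ℚ] GC p) = (kill p (p i.1)).comp evenPr :=
          algHom_ext fun j => by
            by_cases h1 : Odd (p j) <;> by_cases h2 : p j < p i.1 <;>
              simp only [AlgHom.comp_apply, evenPr_X, kill_X, if_pos, if_neg, h1, h2, map_zero,
                not_false_eq_true]
        exact DFunLike.congr_fun this x
      have hy' := congrArg evenPr hy
      rw [map_pow, evenPr_X, if_neg (by simpa using i.2), hcomm] at hy'
      obtain ⟨F, hF⟩ := exists_ev_eq (evenPr_mem (D.d y))
      have hFa : F ∈ D.bdryIdeal := by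
        obtain ⟨z, hz⟩ := D.exists_dS_eq_evenPr_d y
        exact ⟨z, by rw [hz, hF]⟩
      let k : EvenRing p →ₐ[ℚ] EvenRing p :=
        MvPolynomial.aeval fun j => if p j.1 < p i.1 then 0 else MvPolynomial.X j
      have hk : (kill p (p i.1)).comp (ev p) = (ev p).comp k := by
        refine MvPolynomial.algHom_ext fun j => ?_
        simp only [AlgHom.comp_apply, ev_X, kill_X, k, MvPolynomial.aeval_X]
        split_ifs <;> simp [ev_X]
      -- Modulo the radical, setting the smaller variables to zero is the identity, as the induction
      -- hypothesis makes them zero there.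
      have hk' : F - k F ∈ D.bdryIdeal.radical := by
        have : (Ideal.Quotient.mkₐ ℚ D.bdryIdeal.radical) =
            (Ideal.Quotient.mkₐ ℚ D.bdryIdeal.radical).comp k := by
          refine MvPolynomial.algHom_ext fun j => ?_
          simp only [AlgHom.comp_apply, k, MvPolynomial.aeval_X]
          split_ifs with h
          · rw [map_zero]
            exact Ideal.Quotient.eq_zero_iff_mem.2 (ih j (by omega))
          · rfl
        have := DFunLike.congr_fun this F
        exact Ideal.Quotient.eq.1 this
      have hG : MvPolynomial.X i ^ N + (F - k F) ∈ D.bdryIdeal := by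
        obtain ⟨z, hz⟩ := hFa
        refine ⟨z, ?_⟩
        have e := DFunLike.congr_fun hk F
        simp only [AlgHom.comp_apply] at e
        rw [map_add, map_sub, map_pow, ev_X, hz, hy', ← hF, e]
        abel
      have := Ideal.sub_mem _ (Ideal.le_radical hG) hk'
      rw [add_sub_cancel_right] at this
      exact Ideal.mem_radical_of_pow_mem this
  exact key _ i (Nat.lt_succ_self _)

theorem exists_bound (T : Set (GC p)) (hT : T.Finite) : ∃ M : ℕ, ∀ t ∈ T,
    t ∈ part (fun γ => wt (pureWt p) γ ≤ M) := by
  have hfin : (⋃ t ∈ T, (fun γ => (wt (pureWt p) γ).toNat) '' ((coord t).support : Set (ι → ℕ))).Finite :=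
    hT.biUnion fun t _ => (Finset.finite_toSet _).image _
  obtain ⟨M, hM⟩ := hfin.bddAbove
  refine ⟨M, fun t ht => mem_part_iff.2 fun γ hγ => ?_⟩
  have := hM (Set.mem_biUnion ht ⟨γ, by simpa using hγ, rfl⟩)
  simp only at this
  omega

/-- The `dS`-cocycles form a finitely generated module over the polynomial ring on the even
generators. A high power of each variable is a coboundary and so kills cocycle classes. Hence
monomials with bounded exponents, times the module generators, span the cohomology. -/
theorem VanishAbove.dS_finite {n₀ : ℕ} (H : D.VanishAbove n₀) :
    ∃ T : Set (GC p), T.Finite ∧ ∀ z, D.dS z = 0 →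
      z ∈ LinearMap.range D.dS ⊔ Submodule.span ℚ T := by
  have hN : ∀ i : {i // Even (p i)}, ∃ N y, D.dS y = (X i.1 : GC p) ^ N := by
    intro i
    obtain ⟨N, y, hy⟩ := H.X_mem_radical i
    exact ⟨N, y, by rw [hy, map_pow, ev_X]⟩
  choose N y hy using hN
  let K : Submodule (EvenRing p) (GC p) :=
    { carrier := {z | D.dS z = 0}
      add_mem' := by
        intro a b (ha : D.dS a = 0) (hb : D.dS b = 0)
        change D.dS (a + b) = 0
        rw [map_add, ha, hb, add_zero]
      zero_mem' := map_zero _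
      smul_mem' := by
        intro f a (ha : D.dS a = 0)
        change D.dS (ev p f * a) = 0
        rw [dS_ev_mul, ha, mul_zero] }
  have : IsNoetherian (EvenRing p) (GC p) := isNoetherian_of_isNoetherianRing_of_finite _ _
  obtain ⟨G, hG⟩ : K.FG := IsNoetherian.noetherian K
  have hbox : {β : {i // Even (p i)} →₀ ℕ | ∀ i, β i ≤ N i}.Finite := by
    refine Set.Finite.of_injOn (f := fun β : {i // Even (p i)} →₀ ℕ => (β : {i // Even (p i)} → ℕ))
      (t := Set.Iic N) (fun β hβ i => hβ i) (fun a _ b _ h => DFunLike.coe_injective h)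
      (Set.finite_Iic N)
  refine ⟨Set.image2 (fun β g => ev p (MvPolynomial.monomial β 1) * g)
    {β | ∀ i, β i ≤ N i} (G : Set (GC p)), hbox.image2 _ G.finite_toSet, fun z hz => ?_⟩
  set U := LinearMap.range D.dS ⊔ Submodule.span ℚ
    (Set.image2 (fun β g => ev p (MvPolynomial.monomial β 1) * g) {β | ∀ i, β i ≤ N i}
      (G : Set (GC p))) with hU
  have hmon : ∀ β, ∀ g ∈ G, ev p (MvPolynomial.monomial β 1) * g ∈ U := by
    intro β g hg
    by_cases hβ : ∀ i, β i ≤ N i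
    · exact Submodule.mem_sup_right (Submodule.subset_span ⟨β, hβ, g, hg, rfl⟩)
    · push Not at hβ
      obtain ⟨i, hi⟩ := hβ
      refine Submodule.mem_sup_left ?_
      have hgK : D.dS g = 0 := by
        have : g ∈ K := by rw [← hG]; exact Submodule.subset_span hg
        exact this
      have e : β = Finsupp.single i (N i) + (β - Finsupp.single i (N i)) := by
        rw [add_tsub_cancel_of_le]
        rw [Finsupp.single_le_iff]
        exact hi.le
      -- If `dS y` is the power of the variable and `g` is a cocycle, then the Leibniz rule makes
      -- `dS` of this product equal to that power times the remaining factors.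
      refine ⟨y i * (ev p (MvPolynomial.monomial (β - Finsupp.single i (N i)) 1) * g), ?_⟩
      have e' : (MvPolynomial.monomial β 1 : EvenRing p) = MvPolynomial.X i ^ N i *
          MvPolynomial.monomial (β - Finsupp.single i (N i)) 1 := by
        rw [MvPolynomial.X_pow_eq_monomial, MvPolynomial.monomial_mul, ← e, one_mul]
      rw [D.isDer_dS, dS_ev_mul, hgK, hy, e']
      simp [ev_X, mul_assoc]
  have hsm : ∀ f : EvenRing p, ∀ g ∈ G, ev p f * g ∈ U := by
    intro f g hg
    induction f using MvPolynomial.induction_on' with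
    | monomial β c =>
      have := U.smul_mem c (hmon β g hg)
      rwa [← smul_mul_assoc, ← map_smul, MvPolynomial.smul_monomial, smul_eq_mul, mul_one] at this
    | add f f' hf hf' => rw [map_add, add_mul]; exact U.add_mem hf hf'
  have hz' : z ∈ Submodule.span (EvenRing p) (G : Set (GC p)) := by rw [hG]; exact hz
  obtain ⟨f, _, rfl⟩ := Submodule.mem_span_finset.1 hz'
  exact Submodule.sum_mem _ fun g hg => hsm (f g) g hg

/-- Finitely many representatives have bounded weight. Since `dS` preserves weight and raises degree
by one, projecting to a weight above the bound removes the representatives and leaves a homogeneous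
primitive. -/
theorem VanishAbove.dS_exact {n₀ : ℕ} (H : D.VanishAbove n₀) : ∃ M : ℕ, ∀ n k : ℤ, M < k →
    ∀ z ∈ part (fun γ => deg p γ = n), z ∈ part (fun γ => wt (pureWt p) γ = k) → D.dS z = 0 →
      ∃ y ∈ part (fun γ => deg p γ = n - 1), y ∈ part (fun γ => wt (pureWt p) γ = k) ∧
        D.dS y = z := by
  obtain ⟨T, hT, hTz⟩ := H.dS_finite
  obtain ⟨M, hM⟩ := exists_bound T hT
  refine ⟨M, fun n k hk z hz1 hz2 hz => ?_⟩
  obtain ⟨_, ⟨y, rfl⟩, t, ht, hyt⟩ := Submodule.mem_sup.1 (hTz z hz)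
  have ht' : t ∈ part (fun γ => wt (pureWt p) γ ≤ M) := (Submodule.span_le.2 hM) ht
  refine ⟨proj (fun γ => deg p γ = n - 1) (proj (fun γ => wt (pureWt p) γ = k) y), proj_mem _ _,
    proj_mem_part _ (proj_mem _ _), ?_⟩
  rw [← proj_comm (fun i => (p i : ℤ)) 1 (fun a x hx => D.dS_deg hx), sub_add_cancel]
  have h1 := proj_comm (f := D.dS) (pureWt p) 0
    (fun a x hx => by simpa using D.dS_pureWt hx) k y
  rw [add_zero] at h1
  rw [← h1, eq_sub_of_add_eq hyt, map_sub, proj_eq_self hz2,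
    proj_eq_zero ht' (by intro γ h h'; omega), sub_zero]
  exact proj_eq_self hz1

variable (D)

/-- For an odd generator, what remains of `d` after its purely even part is removed contains odd
letters. For an even generator all of `d` does, by parity. Degree plus number of odd letters
therefore rises, so `dS` is the leading part of `d`. -/
theorem d_sub_dS_pureWt {k : ℤ} {x : GC p} (hx : x ∈ part (fun γ => k ≤ wt (pureWt p) γ)) :
    D.d x - D.dS x ∈ part (fun γ => k + 1 ≤ wt (pureWt p) γ) := by
  refine (D.isDer.sub D.isDer_dS).filtered (pureWt p) (pureWt p) 1
    (fun i => X_mem_part (by simp)) (fun i => ?_) hx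
  rw [LinearMap.sub_apply, dS_X]
  split_ifs with h
  · rw [evenPr_eq_proj]
    refine part_mono ?_ (sub_proj_mem (fun γ => wt (oddWt p) γ = 0) (D.d_X_deg i))
    rintro γ ⟨h1, h2⟩
    have h3 := wt_nonneg (oddWt_nonneg (p := p)) γ
    rw [pureWt_eq, h1]
    simp only [pureWt, oddWt, if_pos h]
    omega
  · rw [sub_zero]
    refine part_mono ?_ (mem_part_and (D.d_X_deg i) (D.d_X_par i))
    rintro γ ⟨h1, h2⟩
    have h3 := wt_nonneg (oddWt_nonneg (p := p)) γ
    have h4 := oddWt_mod_two (p := p) γ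
    obtain ⟨k, hk⟩ := Nat.not_odd_iff_even.1 h
    rw [pureWt_eq, h1]
    simp only [pureWt, oddWt, if_neg h]
    omega

theorem dS_pureWt_le {k : ℤ} {x : GC p} (hx : x ∈ part (fun γ => k ≤ wt (pureWt p) γ)) :
    D.dS x ∈ part (fun γ => k ≤ wt (pureWt p) γ) := by
  refine part_induction _ _ (fun γ (hγ : k ≤ wt (pureWt p) γ) => ?_) hx
  exact part_mono (fun γ' h' => by rw [h']; exact hγ)
    (D.dS_pureWt (mono_mem_part (Q := fun γ' => wt (pureWt p) γ' = wt (pureWt p) γ) rfl))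

theorem d_pureWt_le {k : ℤ} {x : GC p} (hx : x ∈ part (fun γ => k ≤ wt (pureWt p) γ)) :
    D.d x ∈ part (fun γ => k ≤ wt (pureWt p) γ) := by
  have := Submodule.add_mem _ (part_mono (fun γ hγ => by omega) (D.d_sub_dS_pureWt hx))
    (D.dS_pureWt_le hx)
  simpa using this

include D in
theorem pureWt_le (γ : ι → ℕ) : wt (pureWt p) γ ≤ 2 * deg p γ := by
  have : 2 * deg p γ = wt (fun i => 2 * (p i : ℤ)) γ := by
    simp [deg, wt, Finset.mul_sum, mul_left_comm]
  rw [this]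
  refine wt_le_wt (fun i => ?_) γ
  have := D.two_le i
  unfold pureWt oddWt
  split_ifs <;> omega

variable {D}

/-- The part of large weight is acyclic. -/
theorem VanishAbove.exact_of_lt {n₀ : ℕ} (H : D.VanishAbove n₀) : ∃ M : ℕ,
    (∀ n k : ℤ, M < k → ∀ z ∈ part (fun γ => deg p γ = n),
      z ∈ part (fun γ => wt (pureWt p) γ = k) → D.dS z = 0 →
      ∃ y ∈ part (fun γ => deg p γ = n - 1), y ∈ part (fun γ => wt (pureWt p) γ = k) ∧
        D.dS y = z) ∧
    ∀ n k : ℤ, M < k → ∀ z ∈ part (fun γ => deg p γ = n),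
      z ∈ part (fun γ => k ≤ wt (pureWt p) γ) → D.d z = 0 →
      ∃ y ∈ part (fun γ => deg p γ = n - 1), y ∈ part (fun γ => k ≤ wt (pureWt p) γ) ∧
        D.d y = z := by
  obtain ⟨M, hM⟩ := H.dS_exact
  refine ⟨M, hM, ?_⟩
  intro n k hk z hz1 hz2 hz
  -- Weight is at most twice the degree, so in degree `n` the filtration is zero from weight `2 * n
  -- + 1` on. The induction is on the number of steps left.
  obtain ⟨r, hr⟩ : ∃ r : ℕ, 2 * n + 1 - k ≤ r := ⟨(2 * n + 1 - k).toNat, by omega⟩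
  induction r generalizing k z with
  | zero =>
    refine ⟨0, Submodule.zero_mem _, Submodule.zero_mem _, ?_⟩
    rw [map_zero]
    refine (coord_injective (Finsupp.ext fun γ => ?_)).symm
    by_contra hγ
    rw [map_zero, Finsupp.zero_apply] at hγ
    have h1 := mem_part_iff.1 hz1 γ hγ
    have h2 := mem_part_iff.1 hz2 γ hγ
    have h3 := D.pureWt_le γ
    push_cast at hr
    omega
  | succ r ih =>
    set t := proj (fun γ => wt (pureWt p) γ = k) z with ht
    have ht1 : t ∈ part (fun γ => deg p γ = n) := proj_mem_part _ hz1
    have ht2 : t ∈ part (fun γ => wt (pureWt p) γ = k) := proj_mem _ _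
    have hr' : z - t ∈ part (fun γ => k + 1 ≤ wt (pureWt p) γ) := by
      refine part_mono ?_ (sub_proj_mem (fun γ => wt (pureWt p) γ = k) hz2)
      rintro γ ⟨h3, h4⟩
      omega
    have hd : D.dS t = 0 := by
      have e1 : D.dS t ∈ part (fun γ => k + 1 ≤ wt (pureWt p) γ) := by
        have e3 := D.d_sub_dS_pureWt (k := k) (x := t) (part_mono (fun γ hγ => hγ.ge) ht2)
        have e4 := D.d_pureWt_le hr'
        rw [map_sub, hz, zero_sub] at e4
        have := Submodule.sub_mem _ (Submodule.neg_mem _ e4) e3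
        simpa using this
      rw [← proj_eq_self (D.dS_pureWt ht2)]
      exact proj_eq_zero e1 fun γ h h' => by omega
    obtain ⟨y, hy1, hy2, hy⟩ := hM n k hk t ht1 ht2 hd
    have hzy : z - D.d y ∈ part (fun γ => k + 1 ≤ wt (pureWt p) γ) := by
      have e3 := D.d_sub_dS_pureWt (k := k) (x := y) (part_mono (fun γ hγ => hγ.ge) hy2)
      rw [hy] at e3
      have := Submodule.sub_mem _ hr' e3
      rwa [sub_sub_sub_cancel_right] at this
    obtain ⟨y', hy1', hy2', hy'⟩ := ih (k + 1) (by omega) _ (Submodule.sub_mem _ hz1 (by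
      have := D.d_deg hy1
      rwa [sub_add_cancel] at this)) hzy (by rw [map_sub, hz, D.d_d, sub_zero])
      (by push_cast at hr; omega)
    exact ⟨y' + y, Submodule.add_mem _ hy1' hy1,
      Submodule.add_mem _ (part_mono (fun γ hγ => by omega) hy2')
        (part_mono (fun γ hγ => hγ.ge) hy2), by rw [map_add, hy', sub_add_cancel]⟩

end MinDGA
end Sullivan

/-! ### Euler characteristics, signed generating functions and Halperin's inequalities. -/

namespace Sullivan
open GC

section LinearAlgebra

variable {E : Type*} [AddCommGroup E] [Module ℚ E]

theorem finrank_map_add_finrank_inf_ker (d : E →ₗ[ℚ] E) (C : Submodule ℚ E)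
    [FiniteDimensional ℚ C] : Module.finrank ℚ (C.map d) +
      Module.finrank ℚ (C ⊓ LinearMap.ker d : Submodule ℚ E) = Module.finrank ℚ C := by
  have h := LinearMap.finrank_range_add_finrank_ker (d.domRestrict C)
  rw [LinearMap.range_domRestrict, LinearMap.ker_domRestrict] at h
  rw [← h, add_right_inj]
  have e : C ⊓ LinearMap.ker d = (Submodule.comap C.subtype (LinearMap.ker d)).map C.subtype := by
    rw [Submodule.map_comap_subtype]
  rw [e]
  exact (Submodule.equivMapOfInjective _ C.subtype_injective _).finrank_eq.symm

/-- The dimension of the space of cocycles. -/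
def zdim (d : E →ₗ[ℚ] E) (C : ℕ → Submodule ℚ E) (n : ℕ) : ℤ :=
  Module.finrank ℚ (C n ⊓ LinearMap.ker d : Submodule ℚ E)

/-- The dimension of the space of coboundaries. -/
def bdim (d : E →ₗ[ℚ] E) (C : ℕ → Submodule ℚ E) : ℕ → ℤ
  | 0 => 0
  | n + 1 => Module.finrank ℚ ((C n).map d)

variable {d : E →ₗ[ℚ] E} {C : ℕ → Submodule ℚ E}

theorem finrank_eq_bdim_add_zdim (n : ℕ) [FiniteDimensional ℚ (C n)] :
    (Module.finrank ℚ (C n) : ℤ) = bdim d C (n + 1) + zdim d C n := by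
  rw [← finrank_map_add_finrank_inf_ker d]
  simp [bdim, zdim]

/-- Rank-nullity in each degree, telescoped. The last term is the uncancelled rank of the
differential leaving degree `K`. -/
theorem euler_char (hC : ∀ n, FiniteDimensional ℚ (C n)) (K : ℕ) :
    ∑ n ∈ Finset.range (K + 1), (-1 : ℤ) ^ n * Module.finrank ℚ (C n) =
      ∑ n ∈ Finset.range (K + 1), (-1 : ℤ) ^ n * (zdim d C n - bdim d C n) +
        (-1) ^ K * bdim d C (K + 1) := by
  induction K with
  | zero => simp [finrank_eq_bdim_add_zdim (d := d), bdim]; ring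
  | succ K ih =>
    rw [Finset.sum_range_succ, ih, Finset.sum_range_succ _ (K + 1),
      finrank_eq_bdim_add_zdim (d := d) (K + 1)]
    ring

theorem zdim_eq_bdim (hd : ∀ x, d (d x) = 0) (hC : ∀ n, ∀ x ∈ C n, d x ∈ C (n + 1))
    (h0 : ∀ x ∈ C 0, d x = 0 → x = 0) (h : ∀ n, ∀ x ∈ C (n + 1), d x = 0 → ∃ y ∈ C n, d y = x)
    (n : ℕ) : zdim d C n = bdim d C n := by
  cases n with
  | zero =>
    have : C 0 ⊓ LinearMap.ker d = ⊥ := by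
      rw [eq_bot_iff]
      rintro x ⟨hx, hx'⟩
      exact h0 x hx hx'
    rw [zdim, this, bdim, finrank_bot, Nat.cast_zero]
  | succ n =>
    have : C (n + 1) ⊓ LinearMap.ker d = (C n).map d := by
      ext x
      constructor
      · rintro ⟨hx, hx'⟩
        exact h n x hx hx'
      · rintro ⟨y, hy, rfl⟩
        exact ⟨hC n y hy, hd y⟩
    rw [zdim, this, bdim]

end LinearAlgebra

variable {ι : Type*} {p : ι → ℕ} [DecidableEq ι] [GenList ι] [Fintype ι]

namespace GC

theorem finrank_part {Q : (ι → ℕ) → Prop} {S : Finset (ι → ℕ)}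
    (h : ∀ γ, γ ∈ S ↔ Valid p γ ∧ Q γ) :
    Module.finrank ℚ (part Q : Submodule ℚ (GC p)) = S.card := by
  have hli : LinearIndependent ℚ (fun γ : S => (mono γ.1 : GC p)) := by
    apply LinearIndependent.of_comp coord
    have : (coord ∘ fun γ : S => (mono γ.1 : GC p)) = fun γ : S => Finsupp.single γ.1 (1 : ℚ) := by
      funext γ
      exact coord_mono ((h γ.1).1 γ.2).1
    rw [this]
    exact (Finsupp.linearIndependent_single_one ℚ (ι → ℕ)).comp _ Subtype.val_injective
  have hsp : (part Q : Submodule ℚ (GC p)) =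
      Submodule.span ℚ (Set.range fun γ : S => (mono γ.1 : GC p)) := by
    apply le_antisymm
    · refine Submodule.span_le.2 ?_
      rintro _ ⟨γ, hγ, rfl⟩
      by_cases hv : Valid p γ
      · exact Submodule.subset_span ⟨⟨γ, (h γ).2 ⟨hv, hγ⟩⟩, rfl⟩
      · rw [mono_eq_zero hv]; exact Submodule.zero_mem _
    · refine Submodule.span_le.2 ?_
      rintro _ ⟨γ, rfl⟩
      exact mono_mem_part ((h γ.1).1 γ.2).2
  rw [hsp, finrank_span_eq_card hli]
  simp

/-- The degree plus the number of odd generators, as a natural number. -/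
def pw (p : ι → ℕ) (i : ι) : ℕ := if Odd (p i) then p i + 1 else p i

theorem pureWt_eq_pw (γ : ι → ℕ) : wt (pureWt p) γ = (wt (pw p) γ : ℕ) := by
  unfold wt
  push_cast
  refine Finset.sum_congr rfl fun i _ => ?_
  unfold pureWt oddWt pw
  split_ifs <;> simp

theorem finite_wt_le {w : ι → ℕ} (hw : ∀ i, 1 ≤ w i) (n : ℕ) :
    {γ : ι → ℕ | wt w γ ≤ n}.Finite := by
  refine (Set.finite_Iic (fun _ : ι => n)).subset fun γ hγ i => ?_
  have h1 : γ i * w i ≤ wt w γ := by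
    have := Finset.single_le_sum (f := fun i => γ i • w i) (fun i _ => Nat.zero_le _)
      (Finset.mem_univ i)
    exact this
  exact (Nat.le_mul_of_pos_right _ (hw i)).trans (h1.trans hγ)

/-- The exponents of weight at most `n` which satisfy a condition. -/
def expo (p w : ι → ℕ) (hw : ∀ i, 1 ≤ w i) (n : ℕ) (Q : (ι → ℕ) → Prop) : Finset (ι → ℕ) :=
  (Set.Finite.subset (finite_wt_le hw n) (t := {γ | wt w γ ≤ n ∧ Valid p γ ∧ Q γ})
    fun _ h => h.1).toFinset

theorem mem_expo {w : ι → ℕ} {hw : ∀ i, 1 ≤ w i} {n : ℕ} {Q : (ι → ℕ) → Prop} {γ : ι → ℕ} :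
    γ ∈ expo p w hw n Q ↔ wt w γ ≤ n ∧ Valid p γ ∧ Q γ := by
  simp [expo]

/-- The signed number of exponents of given weight. -/
def signedCount (p w : ι → ℕ) (hw : ∀ i, 1 ≤ w i) (k : ℕ) : ℤ :=
  ∑ γ ∈ expo p w hw k (fun γ => wt w γ = k), (-1) ^ wt p γ

open PowerSeries in
/-- The factors of the signed generating function. -/
def genFactor (p w : ι → ℕ) (i : ι) : ℤ⟦X⟧ :=
  if Odd (p i) then 1 - PowerSeries.X ^ w i else mk fun n => if w i ∣ n then 1 else 0

open PowerSeries in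
theorem genFactor_even {w : ι → ℕ} {i : ι} (hw : 1 ≤ w i) (h : ¬ Odd (p i)) :
    genFactor p w i * (1 - PowerSeries.X ^ w i) = 1 := by
  rw [genFactor, if_neg h]
  ext n
  rw [mul_sub, mul_one, map_sub, coeff_mk, coeff_mul_X_pow', coeff_one]
  by_cases hn : w i ≤ n
  · rw [if_pos hn, coeff_mk, if_neg (show ¬ n = 0 by omega)]
    have : w i ∣ n - w i ↔ w i ∣ n := (Nat.dvd_sub_iff_left hn dvd_rfl)
    simp [this]
  · rw [if_neg hn]
    by_cases h0 : n = 0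
    · simp [h0]
    · have : ¬ w i ∣ n := fun hd => hn (Nat.le_of_dvd (by omega) hd)
      simp [this, h0]

/-- An odd generator occurs at most once, with sign -1, giving the factor 1 - t^w. An even one
occurs any number of times with sign 1, giving the geometric series 1/(1 - t^w). -/
theorem coeff_prod_genFactor {w : ι → ℕ} (hw : ∀ i, 1 ≤ w i) (k : ℕ) :
    PowerSeries.coeff k (∏ i, genFactor p w i) = signedCount p w hw k := by
  rw [PowerSeries.coeff_prod, signedCount]
  symm
  refine Finset.sum_of_injOn (fun γ => Finsupp.equivFunOnFinite.symm fun i => γ i * w i)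
    ?_ ?_ ?_ ?_
  · intro γ _ γ' _ h
    funext i
    have := DFunLike.congr_fun h i
    simp only [Finsupp.equivFunOnFinite_symm_apply_apply] at this
    exact Nat.eq_of_mul_eq_mul_right (hw i) this
  · intro γ hγ
    rw [Finset.mem_coe, mem_expo] at hγ
    rw [Finset.mem_coe, Finset.mem_finsuppAntidiag]
    refine ⟨?_, Finset.subset_univ _⟩
    simpa [wt] using hγ.2.2
  · intro l hl hl'
    rw [Finset.mem_finsuppAntidiag] at hl
    by_contra hne
    have hi : ∀ i, ∃ c : ℕ, l i = c * w i ∧ (Odd (p i) → c ≤ 1) := by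
      intro i
      have hc := fun h => hne (Finset.prod_eq_zero (Finset.mem_univ i) h)
      by_cases ho : Odd (p i)
      · rw [genFactor, if_pos ho, map_sub, PowerSeries.coeff_one, PowerSeries.coeff_X_pow] at hc
        by_cases h0 : l i = 0
        · exact ⟨0, by simp [h0], fun _ => by omega⟩
        · by_cases h1 : l i = w i
          · exact ⟨1, by simp [h1], fun _ => le_rfl⟩
          · simp [h0, h1] at hc
      · rw [genFactor, if_neg ho, PowerSeries.coeff_mk] at hc
        by_cases hd : w i ∣ l i
        · obtain ⟨c, hc⟩ := hd
          exact ⟨c, by rw [hc, mul_comm], fun h => absurd h ho⟩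
        · simp [hd] at hc
    choose γ hγ hγ' using hi
    refine hl' ⟨γ, ?_, ?_⟩
    · have : wt w γ = k := by
        rw [← hl.1, wt]
        exact Finset.sum_congr rfl fun i _ => (hγ i).symm
      rw [Finset.mem_coe, mem_expo]
      exact ⟨this.le, hγ', this⟩
    · ext i
      simp [hγ]
  · intro γ hγ
    rw [mem_expo] at hγ
    rw [wt, ← Finset.prod_pow_eq_pow_sum]
    refine Finset.prod_congr rfl fun i _ => ?_
    simp only [Finsupp.equivFunOnFinite_symm_apply_apply, smul_eq_mul, genFactor]
    split_ifs with h
    · have h1 := hγ.2.1 i h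
      have h2 := hw i
      rw [map_sub, PowerSeries.coeff_one, PowerSeries.coeff_X_pow]
      interval_cases γ i
      · have : ¬ 0 = w i := by omega
        simp [this]
      · have : ¬ w i = 0 := by omega
        simp [this, h.neg_one_pow]
    · rw [PowerSeries.coeff_mk, if_pos (Dvd.intro_left _ rfl),
        Even.neg_one_pow ((Nat.not_odd_iff_even.1 h).mul_left _)]

/-- The number of generators of even degree. -/
def evenCard (p : ι → ℕ) : ℕ := (Finset.univ.filter fun i => ¬ Odd (p i)).card

/-- The number of generators of odd degree. -/
def oddCard (p : ι → ℕ) : ℕ := (Finset.univ.filter fun i => Odd (p i)).card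

open Polynomial in
theorem signedCount_identity {w : ι → ℕ} (hw : ∀ i, 1 ≤ w i) {M : ℕ}
    (hM : ∀ k, M < k → signedCount p w hw k = 0) :
    (∑ k ∈ Finset.range (M + 1), Polynomial.C (signedCount p w hw k) * Polynomial.X ^ k : ℤ[X]) *
      ∏ i with ¬ Odd (p i), (1 - Polynomial.X ^ w i) = ∏ i with Odd (p i), (1 - Polynomial.X ^ w i) := by
  rw [← Polynomial.coe_inj]
  have hC : ((∑ k ∈ Finset.range (M + 1), Polynomial.C (signedCount p w hw k) * Polynomial.X ^ k : ℤ[X]) :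
      PowerSeries ℤ) = ∏ i, genFactor p w i := by
    ext k
    rw [Polynomial.coeff_coe, coeff_prod_genFactor hw, finsetSum_coeff]
    simp only [coeff_C_mul, coeff_X_pow, mul_ite, mul_one, mul_zero]
    rw [Finset.sum_ite_eq]
    split_ifs with h
    · rfl
    · rw [hM k (by simpa using h)]
  have hP : ∀ s : Finset ι, ((∏ i ∈ s, (1 - Polynomial.X ^ w i) : ℤ[X]) : PowerSeries ℤ) =
      ∏ i ∈ s, (1 - PowerSeries.X ^ w i) := by
    intro s
    have := map_prod (Polynomial.coeToPowerSeries.ringHom (R := ℤ)) (fun i => 1 - Polynomial.X ^ w i) s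
    refine this.trans (Finset.prod_congr rfl fun i _ => ?_)
    rw [map_sub, map_one, map_pow]
    exact congrArg (fun x => 1 - x ^ w i) Polynomial.coe_X
  rw [Polynomial.coe_mul, hC, hP, hP,
    ← Finset.prod_filter_mul_prod_filter_not Finset.univ (fun i => Odd (p i)), mul_assoc,
    ← Finset.prod_mul_distrib]
  have h1 : ∏ i with ¬ Odd (p i), genFactor p w i * (1 - PowerSeries.X ^ w i) = 1 :=
    Finset.prod_eq_one fun i hi => genFactor_even (hw i) (Finset.mem_filter.1 hi).2
  rw [h1, mul_one]
  refine Finset.prod_congr rfl fun i hi => ?_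
  rw [genFactor, if_pos (Finset.mem_filter.1 hi).2]

open Polynomial in
-- Each 1 - t^w equals 1 - t times a polynomial with positive value `w` at 1. Cancelling powers of 1
-- - t bounds the number of even generators; evaluating at 1 then gives 0 if the numbers differ and
-- a positive value if they agree.
theorem signedCount_sum {w : ι → ℕ} (hw : ∀ i, 1 ≤ w i) {M : ℕ}
    (hM : ∀ k, M < k → signedCount p w hw k = 0) :
    evenCard p ≤ oddCard p ∧ 0 ≤ ∑ k ∈ Finset.range (M + 1), signedCount p w hw k ∧
      (evenCard p = oddCard p → 1 ≤ ∑ k ∈ Finset.range (M + 1), signedCount p w hw k) := by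
  have key := signedCount_identity hw hM
  set S : ℤ[X] := ∑ k ∈ Finset.range (M + 1), Polynomial.C (signedCount p w hw k) * Polynomial.X ^ k with hS
  have hS1 : S.eval 1 = ∑ k ∈ Finset.range (M + 1), signedCount p w hw k := by
    simp [hS, eval_finsetSum]
  rw [← hS1]
  let g : ι → ℤ[X] := fun i => ∑ j ∈ Finset.range (w i), Polynomial.X ^ j
  have hg : ∀ s : Finset ι, (∏ i ∈ s, (1 - Polynomial.X ^ w i) : ℤ[X]) =
      (∏ i ∈ s, g i) * (1 - Polynomial.X) ^ s.card := by
    intro s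
    rw [← Finset.prod_const, ← Finset.prod_mul_distrib]
    exact Finset.prod_congr rfl fun i _ => (geom_sum_mul_neg Polynomial.X (w i)).symm
  have hpos : ∀ s : Finset ι, 0 < (∏ i ∈ s, g i).eval 1 := by
    intro s
    rw [eval_prod]
    refine Finset.prod_pos fun i _ => ?_
    have := hw i
    simp [g, eval_finsetSum]
    omega
  rw [hg, hg] at key
  change S * (_ * (1 - Polynomial.X) ^ evenCard p) = _ * (1 - Polynomial.X) ^ oddCard p at key
  set a := ∏ i with ¬ Odd (p i), g i
  set b := ∏ i with Odd (p i), g i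
  have ha : 0 < a.eval 1 := hpos _
  have hb : 0 < b.eval 1 := hpos _
  have hx : (1 - Polynomial.X : ℤ[X]) ≠ 0 := fun h => by
    have := congrArg (eval 0) h
    simp at this
  -- With more even generators than odd ones, cancellation would leave a factor 1 - t on the left,
  -- forcing the positive number `b.eval 1` to be 0.
  have hle : evenCard p ≤ oddCard p := by
    by_contra hlt
    obtain ⟨c, hc⟩ := Nat.exists_eq_add_of_lt (not_le.1 hlt)
    rw [hc, show oddCard p + c + 1 = (c + 1) + oddCard p by ring, pow_add, ← mul_assoc,
      ← mul_assoc] at key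
    have := mul_right_cancel₀ (pow_ne_zero _ hx) key
    have := congrArg (eval 1) this
    simp at this
    omega
  obtain ⟨c, hc⟩ := Nat.exists_eq_add_of_le' hle
  rw [hc, pow_add, ← mul_assoc, ← mul_assoc] at key
  have h2 := congrArg (eval 1) (mul_right_cancel₀ (pow_ne_zero _ hx) key)
  simp only [eval_mul, eval_pow, eval_sub, eval_one, eval_X, sub_self] at h2
  refine ⟨hle, ?_, fun he => ?_⟩
  · refine nonneg_of_mul_nonneg_left (b := a.eval 1) ?_ ha
    rw [h2]
    positivity
  · have : c = 0 := by omega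
    rw [this, pow_zero, mul_one] at h2
    refine pos_of_mul_pos_left (b := a.eval 1) ?_ ha.le
    rw [h2]; exact hb

theorem sum_neg_one_pow_card {S : Finset (ι → ℕ)} {K : ℕ} (h : ∀ γ ∈ S, wt p γ ≤ K) :
    ∑ n ∈ Finset.range (K + 1), (-1 : ℤ) ^ n * (S.filter fun γ => wt p γ = n).card =
      ∑ γ ∈ S, (-1) ^ wt p γ := by
  rw [← Finset.sum_fiberwise_of_maps_to (t := Finset.range (K + 1)) (g := fun γ => wt p γ)
    (fun γ hγ => by simpa [Nat.lt_succ_iff] using h γ hγ)]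
  refine Finset.sum_congr rfl fun n _ => ?_
  rw [Finset.sum_congr rfl (g := fun _ => (-1 : ℤ) ^ n)
    (fun γ hγ => by rw [(Finset.mem_filter.1 hγ).2])]
  simp [mul_comm]

end GC

namespace MinDGA

variable {D : MinDGA p}

/-- The homogeneous component of degree `n`. -/
def comp (p : ι → ℕ) (n : ℕ) : Submodule ℚ (GC p) := part (fun γ => deg p γ = n)

include D in
theorem finiteDimensional_comp (n : ℕ) : FiniteDimensional ℚ (comp p n) :=
  finiteDimensional_part (finite_deg_eq (fun i => by have := D.two_le i; omega) n)

include D in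
theorem one_le_pw (i : ι) : 1 ≤ pw p i := by
  have := D.two_le i
  unfold pw
  split_ifs <;> omega

include D in
theorem wt_le_pw (γ : ι → ℕ) : wt p γ ≤ wt (pw p) γ :=
  Finset.sum_le_sum fun i _ => nsmul_le_nsmul_right (by unfold pw; split_ifs <;> omega) _

/-- Exactness of `dS` in each weight above `M` makes the signed counts vanish there. Exactness of
`d` on the part of weight above `M` means that this part contributes nothing to the Euler
characteristic of the cohomology, which is thus the signed number of monomials of weight at most
`M`. -/
theorem VanishAbove.halperin {n₀ : ℕ} (H : D.VanishAbove n₀) : ∃ M : ℕ, ∀ K, M < K →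
    evenCard p ≤ oddCard p ∧
    0 ≤ ∑ n ∈ Finset.range (K + 1), (-1 : ℤ) ^ n * (zdim D.d (comp p) n - bdim D.d (comp p) n) ∧
    (evenCard p = oddCard p →
      1 ≤ ∑ n ∈ Finset.range (K + 1),
        (-1 : ℤ) ^ n * (zdim D.d (comp p) n - bdim D.d (comp p) n)) := by
  obtain ⟨M, hS, hT⟩ := H.exact_of_lt
  refine ⟨M, fun K hK => ?_⟩
  have hw := D.one_le_pw
  have hvan : ∀ k, M < k → signedCount p (pw p) hw k = 0 := by
    intro k hk
    let G : ℕ → Submodule ℚ (GC p) := fun n =>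
      part (fun γ => deg p γ = n ∧ wt (pureWt p) γ = k)
    have hG : ∀ n, FiniteDimensional ℚ (G n) := fun n => finiteDimensional_part
      ((finite_deg_eq (fun i => by have := D.two_le i; omega) n).subset fun γ h => h.1)
    have hz : ∀ n, zdim D.dS G n = bdim D.dS G n := by
      refine zdim_eq_bdim D.dS_dS (fun n x hx => ?_) (fun x hx h => ?_) (fun n x hx h => ?_)
      · exact part_mono (fun γ h => by push_cast; exact h)
          (mem_part_and (D.dS_deg (part_mono (fun γ h => h.1) hx))
            (D.dS_pureWt (part_mono (fun γ h => h.2) hx)))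
      · obtain ⟨y, hy, _, rfl⟩ := hS 0 k (by exact_mod_cast hk) x
          (part_mono (fun γ h => by simpa using h.1) hx) (part_mono (fun γ h => h.2) hx) h
        have : y = 0 := coord_injective (Finsupp.ext fun γ => by
          by_contra hγ
          have := mem_part_iff.1 hy γ (by simpa using hγ)
          rw [deg_eq] at this
          omega)
        rw [this, map_zero]
      · obtain ⟨y, hy, hy', rfl⟩ := hS (n + 1) k (by exact_mod_cast hk) x
          (part_mono (fun γ h => by simpa using h.1) hx) (part_mono (fun γ h => h.2) hx) h
        exact ⟨y, mem_part_and (by simpa using hy) hy', rfl⟩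
    have h1 := euler_char (d := D.dS) hG k
    have h2 : ∀ n, Module.finrank ℚ (G n) =
        ((expo p (pw p) hw k fun γ => wt (pw p) γ = k).filter fun γ => wt p γ = n).card := by
      intro n
      refine finrank_part fun γ => ?_
      rw [Finset.mem_filter, mem_expo, deg_eq, pureWt_eq_pw]
      constructor
      · rintro ⟨⟨_, h1, h2⟩, h3⟩; exact ⟨h1, by omega, by omega⟩
      · rintro ⟨h1, h2, h3⟩; exact ⟨⟨by omega, h1, by omega⟩, by omega⟩
    simp only [h2, hz, sub_self, mul_zero, Finset.sum_const_zero, zero_add] at h1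
    rw [sum_neg_one_pow_card] at h1
    · rw [signedCount, h1, ← hz]
      -- Degree never exceeds weight, so the weight `k` complex ends at degree `k` and the boundary
      -- term of `euler_char` disappears.
      have : G (k + 1) = ⊥ := by
        rw [eq_bot_iff]
        intro x hx
        rw [Submodule.mem_bot]
        refine coord_injective (Finsupp.ext fun γ => ?_)
        by_contra hγ
        have h3 := mem_part_iff.1 hx γ (by simpa using hγ)
        rw [deg_eq, pureWt_eq_pw] at h3
        have := D.wt_le_pw γ
        omega
      rw [zdim, this, bot_inf_eq, finrank_bot, Nat.cast_zero, mul_zero]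
    · intro γ hγ
      rw [mem_expo] at hγ
      have := D.wt_le_pw γ
      omega
  let T : ℕ → Submodule ℚ (GC p) := fun n =>
    part (fun γ => deg p γ = n ∧ (M + 1 : ℤ) ≤ wt (pureWt p) γ)
  have hTf : ∀ n, FiniteDimensional ℚ (T n) := fun n => finiteDimensional_part
    ((finite_deg_eq (fun i => by have := D.two_le i; omega) n).subset fun γ h => h.1)
  have hz : ∀ n, zdim D.d T n = bdim D.d T n := by
    refine zdim_eq_bdim D.d_d (fun n x hx => ?_) (fun x hx h => ?_) (fun n x hx h => ?_)
    · exact part_mono (fun γ h => by push_cast; exact h)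
        (mem_part_and (D.d_deg (part_mono (fun γ h => h.1) hx))
          (D.d_pureWt_le (part_mono (fun γ h => h.2) hx)))
    · obtain ⟨y, hy, _, rfl⟩ := hT 0 (M + 1) (by omega) x
        (part_mono (fun γ h => by simpa using h.1) hx) (part_mono (fun γ h => h.2) hx) h
      have : y = 0 := coord_injective (Finsupp.ext fun γ => by
        by_contra hγ
        have := mem_part_iff.1 hy γ (by simpa using hγ)
        rw [deg_eq] at this
        omega)
      rw [this, map_zero]
    · obtain ⟨y, hy, hy', rfl⟩ := hT (n + 1) (M + 1) (by omega) x
        (part_mono (fun γ h => by simpa using h.1) hx) (part_mono (fun γ h => h.2) hx) h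
      exact ⟨y, mem_part_and (by simpa using hy) hy', rfl⟩
  have hcf := fun n => D.finiteDimensional_comp n
  have e1 := euler_char (d := D.d) hcf K
  have e2 := euler_char (d := D.d) hTf K
  simp only [hz, sub_self, mul_zero, Finset.sum_const_zero, zero_add] at e2
  -- In degree `K > M` every monomial has weight above `M`. The boundary terms of the two truncated
  -- Euler characteristics therefore coincide and cancel.
  have hTK : T K = comp p K := by
    refine le_antisymm (part_mono fun γ h => h.1) (part_mono fun γ h => ⟨h, ?_⟩)
    rw [pureWt_eq_pw]
    rw [deg_eq] at h
    have := D.wt_le_pw γ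
    omega
  have hb : bdim D.d T (K + 1) = bdim D.d (comp p) (K + 1) := by
    rw [bdim, hTK, bdim]
  have hcard : ∀ n, (Module.finrank ℚ (comp p n) : ℤ) = Module.finrank ℚ (T n) +
      ((expo p (pw p) hw M fun _ => True).filter fun γ => wt p γ = n).card := by
    intro n
    have hp : ∀ i, 1 ≤ p i := fun i => by have := D.two_le i; omega
    have c1 : Module.finrank ℚ (comp p n) = (expo p p hp n fun γ => wt p γ = n).card :=
      finrank_part fun γ => by
        rw [mem_expo, deg_eq]
        exact ⟨fun ⟨_, h1, h2⟩ => ⟨h1, by omega⟩, fun ⟨h1, h2⟩ => ⟨by omega, h1, by omega⟩⟩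
    have c2 : Module.finrank ℚ (T n) =
        ((expo p p hp n fun γ => wt p γ = n).filter fun γ => ¬ wt (pw p) γ ≤ M).card :=
      finrank_part fun γ => by
        rw [Finset.mem_filter, mem_expo, deg_eq, pureWt_eq_pw]
        exact ⟨fun ⟨⟨_, h1, h2⟩, h3⟩ => ⟨h1, by omega, by omega⟩,
          fun ⟨h1, h2, h3⟩ => ⟨⟨by omega, h1, by omega⟩, by omega⟩⟩
    rw [c1, c2]
    rw [← Finset.card_filter_add_card_filter_not (s := expo p p hp n fun γ => wt p γ = n)
      (fun γ => wt (pw p) γ ≤ M), add_comm]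
    push_cast
    congr 3
    ext γ
    simp only [Finset.mem_filter, mem_expo]
    constructor
    · rintro ⟨⟨_, h1, h2⟩, h3⟩; exact ⟨⟨h3, h1, trivial⟩, h2⟩
    · rintro ⟨⟨h1, h2, _⟩, h3⟩; exact ⟨⟨h3.le, h2, h3⟩, h1⟩
  have hχ : ∑ n ∈ Finset.range (K + 1),
      (-1 : ℤ) ^ n * (zdim D.d (comp p) n - bdim D.d (comp p) n) =
      ∑ k ∈ Finset.range (M + 1), signedCount p (pw p) hw k := by
    have h3 := sum_neg_one_pow_card (p := p) (S := expo p (pw p) hw M fun _ => True) (K := K)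
      (fun γ hγ => by
        rw [mem_expo] at hγ
        have := D.wt_le_pw γ
        omega)
    have h4 : ∑ k ∈ Finset.range (M + 1), signedCount p (pw p) hw k =
        ∑ γ ∈ expo p (pw p) hw M fun _ => True, (-1) ^ wt p γ := by
      rw [← Finset.sum_fiberwise_of_maps_to (t := Finset.range (M + 1)) (g := fun γ => wt (pw p) γ)
        (fun γ hγ => by
          rw [mem_expo] at hγ
          simpa [Nat.lt_succ_iff] using hγ.1)]
      refine Finset.sum_congr rfl fun k hk => ?_
      rw [signedCount]
      refine Finset.sum_congr ?_ fun _ _ => rfl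
      ext γ
      simp only [Finset.mem_filter, mem_expo, Finset.mem_range] at hk ⊢
      constructor
      · rintro ⟨_, h1, h2⟩; exact ⟨⟨by omega, h1, trivial⟩, h2⟩
      · rintro ⟨⟨h1, h2, _⟩, h3⟩; exact ⟨h3.le, h2, h3⟩
    rw [h4, ← h3]
    simp only [hcard, mul_add, Finset.sum_add_distrib] at e1
    rw [e2, hb] at e1
    linarith
  rw [hχ]
  exact signedCount_sum hw hvan

end MinDGA
end Sullivan

/-! ### Cohomology of the decomposables and the dimension count. -/

namespace Sullivan
open GC

variable {ι : Type*} {p : ι → ℕ} [DecidableEq ι] [GenList ι] [Fintype ι]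

section Sequences

variable {v r h l : ℕ → ℤ}

/-- The `r` terms telescope, leaving only the last. The correction -1 is `h 0`, which the sum over
`l` does not see. -/
theorem alternating_sum_eq (hl : ∀ n, l (n + 2) = h (n + 2) - r (n + 2) - r (n + 1) + v (n + 1))
    (hv : v 0 = 0) (hr : r 1 = 0) (h0 : h 0 = 1) (h1 : h 1 = 0) (K : ℕ) :
    ∑ k ∈ Finset.range K, (-1 : ℤ) ^ k * l (k + 2) =
      ∑ n ∈ Finset.range (K + 2), (-1 : ℤ) ^ n * h n - 1 -
        ∑ n ∈ Finset.range (K + 1), (-1 : ℤ) ^ n * v n + (-1) ^ K * r (K + 1) := by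
  induction K with
  | zero => simp [Finset.sum_range_succ, h0, h1, hv, hr]
  | succ K ih =>
    rw [Finset.sum_range_succ, ih, Finset.sum_range_succ _ (K + 2),
      Finset.sum_range_succ (fun n => (-1) ^ n * v n) (K + 1), hl]
    ring

theorem sum_range_two_mul (l : ℕ → ℤ) (K : ℕ) :
    ∑ k ∈ Finset.range (2 * K + 2), (-1 : ℤ) ^ k * l (k + 2) = l 2 - l 3 +
      (∑ k ∈ Finset.range K, l (2 * k + 4) - ∑ k ∈ Finset.range K, l (2 * k + 5)) := by
  induction K with
  | zero => simp [Finset.sum_range_succ]; ring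
  | succ K ih =>
    rw [show 2 * (K + 1) + 2 = 2 * K + 2 + 1 + 1 by ring, Finset.sum_range_succ,
      Finset.sum_range_succ, ih, Finset.sum_range_succ, Finset.sum_range_succ]
    have : (-1 : ℤ) ^ (2 * K + 2) = 1 := Even.neg_one_pow ⟨K + 1, by ring⟩
    rw [pow_succ _ (2 * K + 2), this]
    ring_nf

end Sequences

namespace MinDGA

variable (D : MinDGA p)

/-- The decomposable elements of degree `n`. -/
def dec (p : ι → ℕ) (n : ℕ) : Submodule ℚ (GC p) := part (fun γ => deg p γ = n ∧ 2 ≤ len γ)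

/-- The number of generators of degree `n`. -/
def genCard (p : ι → ℕ) (n : ℕ) : ℕ := (Finset.univ.filter fun i => p i = n).card

theorem dec_le (n : ℕ) : dec p n ≤ comp p n := part_mono fun _ h => h.1

include D in
theorem finiteDimensional_dec (n : ℕ) : FiniteDimensional ℚ (dec p n) :=
  have := D.finiteDimensional_comp n
  Submodule.finiteDimensional_of_le (dec_le n)

include D in
theorem one_le (i : ι) : 1 ≤ p i := by have := D.two_le i; omega

theorem d_len {x : GC p} {n : ℕ} (hx : x ∈ comp p n) : D.d x ∈ part (fun γ => 2 ≤ len γ) := by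
  refine part_induction D.d _ (fun γ _ => ?_) hx
  have h0 := D.isDer.filtered (fun _ => (1 : ℤ)) (fun _ => (1 : ℤ)) 1
    (fun i => X_mem_part (by simp)) (fun i => part_mono (fun γ h => h) (D.d_X_len i))
    (x := mono γ) (a := len γ) (mono_mem_part le_rfl)
  by_cases hγ : γ = 0
  · rw [hγ, mono_zero, D.isDer.map_one]
    exact Submodule.zero_mem _
  · refine part_mono (fun γ' h => ?_) h0
    obtain ⟨j, hj⟩ := Function.ne_iff.1 hγ
    obtain ⟨γ'', rfl⟩ := exists_add_single hj
    have : 0 ≤ len γ'' := wt_nonneg (fun _ => by norm_num) _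
    simp only [len, wt_add, wt_single] at this h ⊢
    omega

theorem d_mem_dec {x : GC p} {n : ℕ} (hx : x ∈ comp p n) : D.d x ∈ dec p (n + 1) :=
  mem_part_and (part_mono (fun γ h => by push_cast; exact h) (D.d_deg hx)) (D.d_len hx)

include D in
theorem finrank_comp {n : ℕ} (hn : 1 ≤ n) : Module.finrank ℚ (comp p n) =
    Module.finrank ℚ (dec p n) + genCard p n := by
  have hp := D.one_le
  have c1 : Module.finrank ℚ (comp p n) = (expo p p hp n fun γ => wt p γ = n).card :=
    finrank_part fun γ => by
      rw [mem_expo, deg_eq]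
      exact ⟨fun ⟨_, h1, h2⟩ => ⟨h1, by omega⟩, fun ⟨h1, h2⟩ => ⟨by omega, h1, by omega⟩⟩
  have c2 : Module.finrank ℚ (dec p n) =
      ((expo p p hp n fun γ => wt p γ = n).filter fun γ => 2 ≤ len γ).card :=
    finrank_part fun γ => by
      rw [Finset.mem_filter, mem_expo, deg_eq]
      exact ⟨fun ⟨⟨_, h1, h2⟩, h3⟩ => ⟨h1, by omega, h3⟩,
        fun ⟨h1, h2, h3⟩ => ⟨⟨by omega, h1, by omega⟩, h3⟩⟩
  rw [c1, c2, ← Finset.card_filter_add_card_filter_not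
    (s := expo p p hp n fun γ => wt p γ = n) (fun γ => 2 ≤ len γ), add_right_inj, genCard]
  symm
  refine Finset.card_nbij (fun i => Pi.single i 1) (fun i hi => ?_) (fun i _ j _ h => ?_)
    (fun γ hγ => ?_)
  · have hi' := (Finset.mem_filter.1 hi).2
    rw [Finset.mem_coe, Finset.mem_filter, mem_expo]
    simp only [wt_single, len]
    refine ⟨⟨hi'.le, fun j _ => ?_, hi'⟩, by norm_num⟩
    rw [Pi.single_apply]; split_ifs <;> omega
  · by_contra hne
    have := congrFun h i
    simp [hne] at this
  · rw [Finset.mem_coe, Finset.mem_filter, mem_expo] at hγ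
    obtain ⟨⟨_, _, h1⟩, h2⟩ := hγ
    obtain ⟨j, hj⟩ := Function.ne_iff.1 (show γ ≠ 0 by
      rintro rfl
      rw [wt_zero] at h1
      omega)
    obtain ⟨γ', rfl⟩ := exists_add_single hj
    have h3 : γ' = 0 := by
      by_contra h0
      obtain ⟨k, hk⟩ := Function.ne_iff.1 h0
      obtain ⟨γ'', rfl⟩ := exists_add_single hk
      have : 0 ≤ len γ'' := wt_nonneg (fun _ => by norm_num) _
      simp only [len, wt_add, wt_single] at this h2
      omega
    subst h3
    rw [zero_add, wt_single] at h1
    exact ⟨j, by simpa using h1, by simp⟩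

/-- The dimension of the cohomology in degree `n`. -/
def hdim (n : ℕ) : ℤ := zdim D.d (comp p) n - bdim D.d (comp p) n

/-- The dimension of the cohomology of the decomposables in degree `n`. -/
def ldim (n : ℕ) : ℤ := zdim D.d (dec p) n - bdim D.d (dec p) n

/-- The dimension of the space of linear parts of the cocycles of degree `n`. -/
def rdim (n : ℕ) : ℤ := zdim D.d (comp p) n - zdim D.d (dec p) n

theorem rdim_nonneg (n : ℕ) : 0 ≤ D.rdim n := by
  have := D.finiteDimensional_comp n
  have : Module.finrank ℚ (dec p n ⊓ LinearMap.ker D.d : Submodule ℚ (GC p)) ≤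
      Module.finrank ℚ (comp p n ⊓ LinearMap.ker D.d : Submodule ℚ (GC p)) :=
    Submodule.finrank_mono (inf_le_inf_right _ (dec_le n))
  rw [rdim, zdim, zdim]
  omega

theorem bdim_dec_le (n : ℕ) : bdim D.d (dec p) (n + 1) ≤ bdim D.d (comp p) (n + 1) := by
  have := D.finiteDimensional_comp n
  have : Module.finrank ℚ ((dec p n).map D.d) ≤ Module.finrank ℚ ((comp p n).map D.d) :=
    Submodule.finrank_mono (Submodule.map_mono (dec_le n))
  rw [bdim, bdim]
  omega

/-- Rank-nullity for all elements and for the decomposables, subtracted. The generators of degree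
`n` split into linear parts of cocycles and a part that adds new coboundaries. -/
theorem rdim_add {n : ℕ} (hn : 1 ≤ n) :
    D.rdim n + (bdim D.d (comp p) (n + 1) - bdim D.d (dec p) (n + 1)) = genCard p n := by
  have := D.finiteDimensional_comp n
  have := D.finiteDimensional_dec n
  have h1 := finrank_eq_bdim_add_zdim (d := D.d) (C := comp p) n
  have h2 := finrank_eq_bdim_add_zdim (d := D.d) (C := dec p) n
  have h3 := D.finrank_comp hn
  rw [rdim]
  omega

theorem rdim_le {n : ℕ} (hn : 1 ≤ n) : D.rdim n ≤ genCard p n := by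
  have := D.rdim_add hn
  have := D.bdim_dec_le n
  omega

theorem bdim_le_zdim (n : ℕ) : bdim D.d (comp p) (n + 1) ≤ zdim D.d (dec p) (n + 1) := by
  have := D.finiteDimensional_dec (n + 1)
  have : Module.finrank ℚ ((comp p n).map D.d) ≤
      Module.finrank ℚ (dec p (n + 1) ⊓ LinearMap.ker D.d : Submodule ℚ (GC p)) := by
    refine Submodule.finrank_mono ?_
    rintro _ ⟨x, hx, rfl⟩
    exact ⟨D.d_mem_dec hx, D.d_d x⟩
  rw [bdim, zdim]
  omega

theorem rdim_le_hdim (n : ℕ) : D.rdim (n + 1) ≤ D.hdim (n + 1) := by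
  have := D.bdim_le_zdim n
  rw [rdim, hdim]
  omega

/-- This is the long exact sequence of the decomposables inside the positive degree elements, in
terms of dimensions: passing to decomposables loses `rdim (n + 2)` dimensions of cocycles and, by
`rdim_add`, `genCard - rdim` in degree `n + 1` of coboundaries. -/
theorem ldim_eq (n : ℕ) :
    D.ldim (n + 2) = D.hdim (n + 2) - D.rdim (n + 2) - D.rdim (n + 1) + genCard p (n + 1) := by
  have := D.rdim_add (n := n + 1) (by omega)
  rw [ldim, hdim]
  rw [show n + 1 + 1 = n + 2 from rfl] at this
  simp only [rdim] at this ⊢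
  omega

theorem ldim_nonneg (n : ℕ) : 0 ≤ D.ldim (n + 2) := by
  have := D.ldim_eq n
  have h := D.rdim_le_hdim (n + 1)
  rw [show n + 1 + 1 = n + 2 from rfl] at h
  have := D.rdim_le (n := n + 1) (by omega)
  omega

include D in
theorem genCard_eq_zero {n : ℕ} (hn : n ≤ 1) : genCard p n = 0 := by
  rw [genCard, Finset.card_eq_zero, Finset.filter_eq_empty_iff]
  intro i _
  have := D.two_le i
  omega

include D in
theorem finrank_dec {n : ℕ} (hn : n ≤ 3) : Module.finrank ℚ (dec p n) = 0 := by
  rw [← Finset.card_empty (α := ι → ℕ)]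
  refine finrank_part fun γ => ⟨fun h => absurd h (Finset.notMem_empty _), fun h => ?_⟩
  have := D.len_le_deg γ
  omega

theorem zdim_dec {n : ℕ} (hn : n ≤ 3) : zdim D.d (dec p) n = 0 ∧ bdim D.d (dec p) (n + 1) = 0 := by
  have := D.finiteDimensional_dec n
  have h := finrank_eq_bdim_add_zdim (d := D.d) (C := dec p) n
  rw [D.finrank_dec hn, zdim, bdim] at h
  rw [zdim, bdim]
  omega

theorem ldim_two : D.ldim 2 = 0 := by
  rw [ldim, (D.zdim_dec (n := 2) (by norm_num)).1, (D.zdim_dec (n := 1) (by norm_num)).2, sub_self]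

theorem ldim_three : D.ldim 3 = 0 := by
  rw [ldim, (D.zdim_dec (n := 3) (by norm_num)).1, (D.zdim_dec (n := 2) (by norm_num)).2, sub_self]

theorem bdim_comp_one : bdim D.d (comp p) 1 = 0 := by
  have h1 := D.bdim_le_zdim 0
  rw [(D.zdim_dec (n := 0 + 1) (by norm_num)).1] at h1
  refine le_antisymm h1 ?_
  rw [bdim]
  exact Int.natCast_nonneg _

theorem rdim_one : D.rdim 1 = 0 := by
  have h1 := D.rdim_le le_rfl
  have h2 := D.rdim_nonneg 1
  rw [D.genCard_eq_zero le_rfl] at h1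
  push_cast at h1
  omega

theorem hdim_one : D.hdim 1 = 0 := by
  have h1 := D.rdim_one
  rw [rdim, (D.zdim_dec (n := 1) (by norm_num)).1] at h1
  rw [hdim, D.bdim_comp_one]
  omega

theorem hdim_zero : D.hdim 0 = 1 := by
  have := D.finiteDimensional_comp 0
  have h := finrank_eq_bdim_add_zdim (d := D.d) (C := comp p) 0
  have h1 : Module.finrank ℚ (comp p 0) = 1 := by
    rw [← Finset.card_singleton (0 : ι → ℕ)]
    refine finrank_part fun γ => ?_
    rw [Finset.mem_singleton]
    constructor
    · rintro rfl
      exact ⟨fun i _ => Nat.zero_le _, by simp⟩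
    · rintro ⟨_, h⟩
      by_contra h0
      obtain ⟨k, hk⟩ := Function.ne_iff.1 h0
      obtain ⟨γ', rfl⟩ := exists_add_single hk
      rw [deg_eq, wt_add, wt_single] at h
      have := D.two_le k
      omega
  rw [D.bdim_comp_one, h1] at h
  have h2 : bdim D.d (comp p) 0 = 0 := rfl
  rw [hdim, h2]
  push_cast at h
  omega

theorem sum_genCard {K : ℕ} (hK : ∀ i, p i ≤ K) :
    ∑ n ∈ Finset.range (K + 1), (-1 : ℤ) ^ n * genCard p n = evenCard p - oddCard p := by
  have h1 : ∑ n ∈ Finset.range (K + 1), (-1 : ℤ) ^ n * genCard p n = ∑ i, (-1 : ℤ) ^ p i := by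
    rw [← Finset.sum_fiberwise_of_maps_to (t := Finset.range (K + 1)) (g := p)
      (fun i _ => by simpa [Nat.lt_succ_iff] using hK i)]
    refine Finset.sum_congr rfl fun n _ => ?_
    rw [Finset.sum_congr rfl (g := fun _ => (-1 : ℤ) ^ n)
      (fun i hi => by rw [(Finset.mem_filter.1 hi).2])]
    simp [mul_comm, genCard]
  rw [h1, ← Finset.sum_filter_add_sum_filter_not Finset.univ (fun i => Odd (p i)),
    Finset.sum_congr rfl (g := fun _ => (-1 : ℤ))
      (fun i hi => (Finset.mem_filter.1 hi).2.neg_one_pow),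
    Finset.sum_congr (s₁ := Finset.univ.filter fun i => ¬ Odd (p i)) rfl (g := fun _ => (1 : ℤ))
      (fun i hi => (Nat.not_odd_iff_even.1 (Finset.mem_filter.1 hi).2).neg_one_pow)]
  simp [evenCard, oddCard]
  ring

variable {D} {n₀ : ℕ}

theorem VanishAbove.hdim_eq_zero (H : D.VanishAbove n₀) {n : ℕ} (hn : n₀ < n) : D.hdim n = 0 := by
  obtain ⟨n, rfl⟩ := Nat.exists_eq_add_of_lt (Nat.zero_lt_of_lt hn)
  rw [zero_add] at hn ⊢
  have : comp p (n + 1) ⊓ LinearMap.ker D.d = (comp p n).map D.d := by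
    ext x
    constructor
    · rintro ⟨hx, hx'⟩
      obtain ⟨y, hy, rfl⟩ := H (n + 1 : ℕ) (by exact_mod_cast hn) x hx hx'
      exact ⟨y, part_mono (fun γ h => by push_cast at h; omega) hy, rfl⟩
    · rintro ⟨y, hy, rfl⟩
      exact ⟨dec_le _ (D.d_mem_dec hy), D.d_d y⟩
  rw [hdim, zdim, bdim, this, sub_self]

include D in
theorem exists_genCard_eq_zero : ∃ N : ℕ, (∀ i, p i ≤ N) ∧ ∀ n, N < n → genCard p n = 0 := by
  refine ⟨Finset.univ.sup p, fun i => Finset.le_sup (Finset.mem_univ i), fun n hn => ?_⟩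
  rw [genCard, Finset.card_eq_zero, Finset.filter_eq_empty_iff]
  intro i _ h
  have := Finset.le_sup (f := p) (Finset.mem_univ i)
  omega

theorem VanishAbove.exists_ldim_eq_zero (H : D.VanishAbove n₀) :
    ∃ N : ℕ, ∀ n, N < n → D.ldim n = 0 := by
  obtain ⟨N, _, hN⟩ := D.exists_genCard_eq_zero
  refine ⟨N + n₀ + 1, fun n hn => ?_⟩
  obtain ⟨n, rfl⟩ := Nat.exists_eq_add_of_le' (show 2 ≤ n by omega)
  have h1 := D.ldim_eq n
  have h2 := D.ldim_nonneg n
  have h3 := D.rdim_nonneg (n + 1)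
  have h4 := D.rdim_nonneg (n + 2)
  rw [H.hdim_eq_zero (by omega), hN _ (by omega)] at h1
  push_cast at h1
  omega

/-- For large `K` the boundary rank is zero, and the difference of the two sums is χ(H) - 1 - χ(V).
Either χ(V) = 0 and χ(H) ≥ 1, or χ(V) ≤ -1 and χ(H) ≥ 0. -/
theorem VanishAbove.sum_ldim_le (H : D.VanishAbove n₀) : ∃ M : ℕ, ∀ K, M < K →
    ∑ k ∈ Finset.range K, D.ldim (2 * k + 5) ≤ ∑ k ∈ Finset.range K, D.ldim (2 * k + 4) := by
  obtain ⟨N, hN, hN'⟩ := D.exists_genCard_eq_zero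
  obtain ⟨M, hM⟩ := H.halperin
  refine ⟨M + N, fun K hK => ?_⟩
  have h1 := sum_range_two_mul D.ldim K
  rw [alternating_sum_eq (v := fun n => (genCard p n : ℤ)) D.ldim_eq
    (by rw [D.genCard_eq_zero (by omega)]; rfl) D.rdim_one D.hdim_zero D.hdim_one, D.ldim_two,
    D.ldim_three, sum_genCard (fun i => (hN i).trans (by omega))] at h1
  have hr : D.rdim (2 * K + 2 + 1) = 0 := by
    have h2 := D.rdim_le (n := 2 * K + 2 + 1) (by omega)
    have h3 := D.rdim_nonneg (2 * K + 2 + 1)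
    rw [hN' _ (by omega)] at h2
    push_cast at h2
    omega
  rw [hr, mul_zero] at h1
  obtain ⟨g1, g2, g3⟩ := hM (2 * K + 2 + 1) (by omega)
  change 0 ≤ ∑ n ∈ Finset.range (2 * K + 2 + 2), (-1 : ℤ) ^ n * D.hdim n at g2
  change _ → 1 ≤ ∑ n ∈ Finset.range (2 * K + 2 + 2), (-1 : ℤ) ^ n * D.hdim n at g3
  rcases g1.eq_or_lt with h | h
  · have := g3 h
    omega
  · omega

/-- The odd terms are nonnegative with sum at most 0, so they vanish too. Each `ldim` is the sum of
`hdim - rdim` in its degree and `genCard - rdim` one degree below, both nonnegative. Two consecutive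
degrees then identify `hdim`, `rdim` and `genCard` in the same degree. -/
theorem VanishAbove.hdim_eq_genCard (H : D.VanishAbove n₀) (h : ∀ k, D.ldim (2 * k + 4) = 0)
    {n : ℕ} (hn : 2 ≤ n) : D.hdim n = genCard p n := by
  have hl : ∀ n, D.ldim (n + 2) = 0 := by
    obtain ⟨M, hM⟩ := H.sum_ldim_le
    intro n
    rcases Nat.even_or_odd' n with ⟨k, rfl | rfl⟩
    · rcases k with _ | k
      · exact D.ldim_two
      · exact h k
    · rcases k with _ | k
      · exact D.ldim_three
      · have h1 := hM (M + k + 1) (by omega)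
        simp only [h, Finset.sum_const_zero] at h1
        have h2 := Finset.single_le_sum (s := Finset.range (M + k + 1))
          (f := fun k => D.ldim (2 * k + 5)) (fun k _ => D.ldim_nonneg (2 * k + 3))
          (Finset.mem_range.2 (show k < M + k + 1 by omega))
        exact le_antisymm (h2.trans h1) (D.ldim_nonneg (2 * k + 3))
  obtain ⟨n, rfl⟩ := Nat.exists_eq_add_of_le' hn
  have h1 := D.ldim_eq n
  have h2 := D.ldim_eq (n + 1)
  have h3 := D.rdim_le_hdim (n + 1)
  have h4 := D.rdim_le_hdim (n + 1 + 1)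
  have h5 := D.rdim_le (n := n + 1) (by omega)
  have h6 := D.rdim_le (n := n + 1 + 1) (by omega)
  rw [hl] at h1 h2
  change 0 = D.hdim (n + 1 + 1 + 1) - D.rdim (n + 1 + 1 + 1) - D.rdim (n + 1 + 1) + _ at h2
  change D.hdim (n + 1 + 1) = genCard p (n + 1 + 1)
  change 0 = D.hdim (n + 1 + 1) - D.rdim (n + 1 + 1) - _ + _ at h1
  omega

end MinDGA
end Sullivan

/-! ### Identification of `ΛV` with the free algebra on a homogeneous basis. -/

namespace Sullivan
open GC

section Free

variable {V : ℕ → Type*} [∀ i, AddCommGroup (V i)] [∀ i, Module ℚ (V i)]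

theorem gen_mul_gen (i j : ℕ) (v : V i) (w : V j) :
    (gen i v * gen j w : FreeGCA V) = (-1 : ℚ) ^ (i * j) • (gen j w * gen i v) := by
  have := RingQuot.mkAlgHom_rel ℚ (CommRel.comm i j v w)
  rw [map_smul, map_mul, map_mul] at this
  exact this

/-- The universal property of `ΛV`. -/
def FreeGCA.lift {C : Type*} [Ring C] [Algebra ℚ C] (f : ∀ n, V n →ₗ[ℚ] C)
    (h : ∀ i j v w, f i v * f j w = (-1 : ℚ) ^ (i * j) • (f j w * f i v)) : FreeGCA V →ₐ[ℚ] C :=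
  RingQuot.liftAlgHom ℚ ⟨TensorAlgebra.lift ℚ (DirectSum.toModule ℚ ℕ C f), by
    rintro _ _ ⟨i, j, v, w⟩
    simpa using h i j v w⟩

@[simp]
theorem FreeGCA.lift_gen {C : Type*} [Ring C] [Algebra ℚ C] (f : ∀ n, V n →ₗ[ℚ] C)
    (h : ∀ i j v w, f i v * f j w = (-1 : ℚ) ^ (i * j) • (f j w * f i v)) (n : ℕ) (v : V n) :
    FreeGCA.lift f h (gen n v) = f n v := by
  unfold FreeGCA.lift gen FreeGCA.mk
  simp only [LinearMap.comp_apply]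
  erw [RingQuot.liftAlgHom_mkAlgHom_apply]
  simp

theorem FreeGCA.algHom_ext {C : Type*} [Semiring C] [Algebra ℚ C] {φ ψ : FreeGCA V →ₐ[ℚ] C}
    (h : ∀ n v, φ (gen n v) = ψ (gen n v)) : φ = ψ := by
  refine RingQuot.ringQuot_ext' (s := CommRel V) ℚ φ ψ (TensorAlgebra.hom_ext ?_)
  refine DirectSum.linearMap_ext _ fun n => LinearMap.ext fun v => ?_
  exact h n v

theorem monomial_append (l l' : List (Σ i, V i)) :
    (monomial (l ++ l') : FreeGCA V) = monomial l * monomial l' := by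
  simp [monomial]

theorem monomial_cons (a : Σ i, V i) (l : List (Σ i, V i)) :
    (monomial (a :: l) : FreeGCA V) = gen a.1 a.2 * monomial l := by
  simp [monomial]

variable (V) in
/-- The span of the monomials of given degree and word length. -/
def wordPart (n : ℕ × ℕ) : Submodule ℚ (FreeGCA V) :=
  Submodule.span ℚ {x | ∃ l : List (Σ i, V i),
    ((l.map fun p => p.1).sum, l.length) = n ∧ monomial l = x}

theorem one_mem_wordPart : (1 : FreeGCA V) ∈ wordPart V 0 :=
  Submodule.subset_span ⟨[], rfl, rfl⟩

theorem gen_mem_wordPart (n : ℕ) (v : V n) : gen n v ∈ wordPart V (n, 1) :=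
  Submodule.subset_span ⟨[⟨n, v⟩], by simp, by simp [monomial]⟩

theorem mul_mem_wordPart (a b : ℕ × ℕ) :
    ∀ x ∈ wordPart V a, ∀ y ∈ wordPart V b, x * y ∈ wordPart V (a + b) := by
  intro x hx y hy
  have := Submodule.mul_mem_mul hx hy
  rw [wordPart, wordPart, Submodule.span_mul_span] at this
  refine Submodule.span_le.2 ?_ this
  rintro _ ⟨_, ⟨l, rfl, rfl⟩, _, ⟨l', rfl, rfl⟩, rfl⟩
  exact Submodule.subset_span ⟨l ++ l', by simp, monomial_append l l'⟩

theorem wordPart_le_degreePart (n k : ℕ) : wordPart V (n, k) ≤ degreePart V n :=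
  Submodule.span_mono fun _ ⟨l, h, h'⟩ => ⟨l, congrArg Prod.fst h, h'⟩

end Free

variable {ι : Type*} {p : ι → ℕ} [DecidableEq ι] [GenList ι] [Fintype ι]
variable {V : ℕ → Type*} [∀ i, AddCommGroup (V i)] [∀ i, Module ℚ (V i)]
variable (b : ∀ n, Module.Basis {i // p i = n} ℚ (V n))

/-- The linear inclusion of `V n` in the free algebra on a basis. -/
def basisGen (n : ℕ) : V n →ₗ[ℚ] GC p := (b n).constr ℚ fun i => X i.1

theorem basisGen_basis (n : ℕ) (i : {i // p i = n}) : basisGen b n (b n i) = X i.1 :=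
  (b n).constr_basis ..

theorem basisGen_mem (n : ℕ) (v : V n) :
    basisGen b n v ∈ part (fun γ => deg p γ = n ∧ len γ = 1 ∧ ∀ i, γ i ≠ 0 → p i = n) := by
  have hv := (b n).mem_span v
  induction hv using Submodule.span_induction with
  | zero => rw [map_zero]; exact Submodule.zero_mem _
  | add x y _ _ hx hy => rw [map_add]; exact add_mem hx hy
  | smul r x _ hx => rw [map_smul]; exact Submodule.smul_mem _ _ hx
  | mem x hx =>
    obtain ⟨i, rfl⟩ := hx
    rw [basisGen_basis]
    refine X_mem_part ⟨by simp [i.2], by simp, fun j hj => ?_⟩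
    by_cases h : j = i.1
    · rw [h, i.2]
    · simp [h] at hj

theorem basisGen_par (n : ℕ) (v : V n) : basisGen b n v ∈ (par n : Submodule ℚ (GC p)) :=
  part_deg_le_par rfl (part_mono (fun _ h => h.1) (basisGen_mem b n v))

/-- The map from `ΛV` to the free algebra on a basis. -/
def toGC : FreeGCA V →ₐ[ℚ] GC p :=
  FreeGCA.lift (basisGen b) fun _ _ v w => par_comm (basisGen_par b _ v) (basisGen_par b _ w)

@[simp]
theorem toGC_gen (n : ℕ) (v : V n) : toGC b (gen n v) = basisGen b n v := FreeGCA.lift_gen ..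

/-- The map from the free algebra on a basis to `ΛV`. -/
def ofGC : GC p →ₐ[ℚ] FreeGCA V :=
  lift (fun i => gen (p i) (b (p i) ⟨i, rfl⟩)) fun _ _ => gen_mul_gen ..

@[simp]
theorem ofGC_X (i : ι) : ofGC b (X i) = gen (p i) (b (p i) ⟨i, rfl⟩) := lift_X ..

/-- `ΛV` is the free algebra on a basis. -/
def equivGC : FreeGCA V ≃ₐ[ℚ] GC p :=
  AlgEquiv.ofAlgHom (toGC b) (ofGC b)
    (GC.algHom_ext fun i => by
      simp [basisGen_basis])
    (FreeGCA.algHom_ext fun n v => by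
      have : (ofGC b).toLinearMap ∘ₗ basisGen b n = gen n := by
        refine (b n).ext ?_
        rintro ⟨i, rfl⟩
        simp [basisGen_basis]
      simpa using LinearMap.congr_fun this v)

theorem toGC_monomial (l : List (Σ i, V i)) : toGC b (monomial l) ∈
    part (fun γ => deg p γ = (l.map fun p => p.1).sum ∧ len γ = l.length) := by
  induction l with
  | nil => simpa [monomial] using one_mem_part (by simp)
  | cons a l ih =>
    rw [monomial_cons, map_mul, toGC_gen]
    refine mul_mem_part ?_ (basisGen_mem b a.1 a.2) ih
    rintro γ γ' ⟨h1, h2, _⟩ ⟨h3, h4⟩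
    simp only [deg, len, wt_add] at h1 h2 h3 h4 ⊢
    rw [h1, h2, h3, h4]
    push_cast [List.map_cons, List.sum_cons, List.length_cons]
    exact ⟨rfl, add_comm ..⟩

theorem ofGC_mono (γ : ι → ℕ) : ofGC b (mono γ) ∈ wordPart V (wt p γ, wt (fun _ => 1) γ) := by
  have := hom_mono_mem (ofGC b) (fun i => (p i, 1)) (wordPart V) one_mem_wordPart
    mul_mem_wordPart (fun i => by rw [ofGC_X]; exact gen_mem_wordPart _ _) γ
  convert this using 2
  simp only [wt, Prod.ext_iff, Prod.fst_sum, Prod.snd_sum, Prod.smul_fst, Prod.smul_snd, and_self]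

theorem toGC_degreePart {n : ℕ} {x : FreeGCA V} (hx : x ∈ degreePart V n) :
    toGC b x ∈ MinDGA.comp p n := by
  have : degreePart V n ≤ (MinDGA.comp p n).comap (toGC b).toLinearMap :=
    Submodule.span_le.2 (by
      rintro _ ⟨l, rfl, rfl⟩
      exact part_mono (fun _ h => h.1) (toGC_monomial b l))
  exact this hx

theorem ofGC_comp {n : ℕ} {x : GC p} (hx : x ∈ MinDGA.comp p n) : ofGC b x ∈ degreePart V n := by
  refine part_induction (ofGC b).toLinearMap _ (fun γ hγ => ?_) hx
  rw [deg_eq, Nat.cast_inj] at hγ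
  subst hγ
  exact wordPart_le_degreePart _ _ (ofGC_mono b γ)

theorem toGC_wordLengthGE {k : ℕ} {x : FreeGCA V} (hx : x ∈ wordLengthGE V k) :
    toGC b x ∈ part (fun γ => (k : ℤ) ≤ len γ) := by
  have : wordLengthGE V k ≤ (part (fun γ => (k : ℤ) ≤ len γ)).comap (toGC b).toLinearMap :=
    Submodule.span_le.2 (by
      rintro _ ⟨l, hl, rfl⟩
      exact part_mono (fun _ h => by omega) (toGC_monomial b l))
  exact this hx

theorem toGC_subalgebraGenBy {k : ℕ} {x : FreeGCA V}
    (hx : x ∈ subalgebraGenBy (truncation V k)) :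
    toGC b x ∈ part (fun γ => ∀ i, γ i ≠ 0 → p i ≤ k) := by
  induction hx using Algebra.adjoin_induction with
  | mem x hx =>
    obtain ⟨i, v, hv, rfl⟩ := hx
    rw [toGC_gen]
    by_cases hi : i ≤ k
    · exact part_mono (fun γ h j hj => (h.2.2 j hj).trans_le hi) (basisGen_mem b i v)
    · rw [truncation, if_neg hi, Submodule.mem_bot] at hv
      rw [hv, map_zero]
      exact Submodule.zero_mem _
  | algebraMap r =>
    rw [AlgHom.commutes, Algebra.algebraMap_eq_smul_one]
    exact Submodule.smul_mem _ _ (one_mem_part (by simp))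
  | add x y _ _ hx hy => rw [map_add]; exact add_mem hx hy
  | mul x y _ _ hx hy =>
    rw [map_mul]
    refine mul_mem_part (fun γ γ' h h' i hi => ?_) hx hy
    by_cases h0 : γ i = 0
    · exact h' i fun h1 => hi (by simp [h0, h1])
    · exact h i h0

theorem ofGC_subalgebraGenBy {k : ℕ} {x : GC p}
    (hx : x ∈ part (fun γ => ∀ i, γ i ≠ 0 → p i ≤ k)) :
    ofGC b x ∈ subalgebraGenBy (truncation V k) := by
  refine part_induction (ofGC b).toLinearMap
    (Subalgebra.toSubmodule (subalgebraGenBy (truncation V k))) (fun γ hγ => ?_) hx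
  -- The weight counts letters of degree above `k`. The family is the subalgebra in weight 0 and
  -- everything in positive weight, so multiplicativity needs checking only when both weights are 0.
  have := hom_mono_mem (ofGC b) (fun i => if p i ≤ k then 0 else 1)
    (fun a : ℕ => if a = 0 then Subalgebra.toSubmodule (subalgebraGenBy (truncation V k)) else ⊤)
    (by simp [one_mem]) (fun a c x hx y hy => ?_) (fun i => ?_) γ
  · rw [if_pos] at this
    · exact this
    · refine Finset.sum_eq_zero fun i _ => ?_
      by_cases h : γ i = 0
      · rw [h, zero_smul]
      · simp [hγ i h]
  · by_cases ha : a = 0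
    · by_cases hc : c = 0
      · subst ha hc
        simp only [if_true] at hx hy ⊢
        exact Subalgebra.mul_mem _ hx hy
      · simp [hc]
    · simp [ha]
  · by_cases h : p i ≤ k
    · rw [if_pos h, if_pos rfl, ofGC_X]
      exact Algebra.subset_adjoin ⟨p i, _, by rw [truncation, if_pos h]; trivial, rfl⟩
    · simp [h]

theorem map_degreePart (n : ℕ) :
    (Subalgebra.toSubmodule (⊤ : Subalgebra ℚ (FreeGCA V)) ⊓ degreePart V n).map
      (equivGC b).toLinearMap = MinDGA.comp p n := by
  ext x
  constructor
  · rintro ⟨y, ⟨_, hy⟩, rfl⟩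
    exact toGC_degreePart b hy
  · intro hx
    exact ⟨ofGC b x, ⟨trivial, ofGC_comp b hx⟩, (equivGC b).apply_symm_apply x⟩

/-- A single letter of degree `n > k` is excluded by the support condition. In a product of two or
more letters the others take up degree at least 2, leaving at most `n - 2 ≤ k` for each. The range
of `n` covers both `k + 1` and `k + 2`: the coboundaries and the cocycles of `L^(k+2)`. -/
theorem supp_le_iff (hp : ∀ i, 2 ≤ p i) {n k : ℕ} (h1 : n ≤ k + 2) (h2 : k < n) {γ : ι → ℕ}
    (hγ : deg p γ = n) : (∀ i, γ i ≠ 0 → p i ≤ k) ↔ 2 ≤ len γ := by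
  have hlen : ∀ γ, 2 * len γ ≤ deg p γ := fun γ => by
    have : 2 * len γ = wt (fun _ => (2 : ℤ)) γ := by simp [wt, Finset.mul_sum, mul_comm]
    rw [this]
    exact wt_le_wt (fun i => by exact_mod_cast hp i) γ
  constructor
  · intro h
    obtain ⟨j, hj, _⟩ := exists_ne_zero_of_wt (w := fun i => (p i : ℤ)) (γ := γ) (by
      change deg p γ ≠ 0; omega)
    have hjk := h j hj
    obtain ⟨γ', rfl⟩ := exists_add_single hj
    have h0 : γ' ≠ 0 := by
      rintro rfl
      simp only [deg, zero_add, wt_single] at hγ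
      omega
    obtain ⟨l, hl⟩ := Function.ne_iff.1 h0
    obtain ⟨γ'', rfl⟩ := exists_add_single hl
    have : 0 ≤ len γ'' := wt_nonneg (fun _ => by norm_num) _
    simp only [len, wt_add, wt_single] at this ⊢
    omega
  · intro h j hj
    obtain ⟨γ', rfl⟩ := exists_add_single hj
    have := hlen γ'
    simp only [deg, len, wt_add, wt_single] at h hγ this
    omega

theorem map_subalgebraGenBy (hp : ∀ i, 2 ≤ p i) {n k : ℕ} (h1 : n ≤ k + 2) (h2 : k < n) :
    (Subalgebra.toSubmodule (subalgebraGenBy (truncation V k)) ⊓ degreePart V n).map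
      (equivGC b).toLinearMap = MinDGA.dec p n := by
  ext x
  constructor
  · rintro ⟨y, ⟨hy, hy'⟩, rfl⟩
    exact part_mono (fun γ h => ⟨h.1, (supp_le_iff hp h1 h2 h.1).1 h.2⟩)
      (mem_part_and (toGC_degreePart b hy') (toGC_subalgebraGenBy b hy))
  · intro hx
    refine ⟨ofGC b x, ⟨ofGC_subalgebraGenBy b (part_mono (fun γ h => ?_) hx),
      ofGC_comp b (MinDGA.dec_le n hx)⟩, (equivGC b).apply_symm_apply x⟩
    exact (supp_le_iff hp h1 h2 h.1).2 h.2

namespace Differential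

variable (D : Differential V)

/-- The differential, seen on the free algebra on a basis. -/
def transport : GC p →ₗ[ℚ] GC p :=
  (equivGC b).toLinearMap ∘ₗ D.d ∘ₗ (equivGC b).symm.toLinearMap

theorem transport_equivGC (x : FreeGCA V) :
    D.transport b (equivGC b x) = equivGC b (D.d x) := by
  simp [transport]

/-- The Leibniz rule of a `Differential` is stated for homogeneous left factors. Testing on
monomials, where `sgn` is the scalar (-1)^degree, extends it to all elements. -/
theorem isDer_transport : IsDer (AlgHom.id ℚ _) (D.transport b) := by
  intro x y
  have : D.transport b ∘ₗ LinearMap.mulRight ℚ y =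
      LinearMap.mulRight ℚ y ∘ₗ D.transport b +
        LinearMap.mulRight ℚ (D.transport b y) ∘ₗ sgn.toLinearMap := by
    refine linearMap_ext fun γ => ?_
    have h := D.leibniz (wt p γ) (ofGC b (mono γ)) (ofGC_comp b (mono_mem_part (deg_eq ..)))
      (ofGC b y)
    simp only [LinearMap.comp_apply, LinearMap.add_apply, LinearMap.mulRight_apply,
      AlgHom.toLinearMap_apply, sgn_mono]
    have e : ∀ z, D.transport b z = equivGC b (D.d (ofGC b z)) := fun z => rfl
    have e' : ∀ z, equivGC b (ofGC b z) = z := (equivGC b).apply_symm_apply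
    rw [e, map_mul, h, map_add, map_mul, map_smul, map_mul, e', e', ← e, ← e, smul_mul_assoc]
  simpa using LinearMap.congr_fun this x

/-- A minimal differential, seen on the free algebra on a basis. -/
def toMinDGA (hp : ∀ i, 2 ≤ p i) (h : D.IsMinimal) : MinDGA p where
  d := D.transport b
  isDer := D.isDer_transport b
  d_X_deg i := by
    have := toGC_degreePart b (D.map_degree (p i) _
      (ofGC_comp b (X_mem_part (i := i) (by simp))))
    exact part_mono (fun γ h => by push_cast at h; exact h) this
  d_d x := by
    obtain ⟨x, rfl⟩ := (equivGC b).surjective x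
    rw [transport_equivGC, transport_equivGC, D.d_d, map_zero]
  two_le := hp
  d_X_len _ := toGC_wordLengthGE b (h _)

section Cohomology

variable {D} {S : Subalgebra ℚ (FreeGCA V)} {C : ℕ → Submodule ℚ (GC p)}

theorem map_cocycles {n : ℕ} (hn : (Subalgebra.toSubmodule S ⊓ degreePart V n).map
    (equivGC b).toLinearMap = C n) : (D.cocycles S n).map (equivGC b).toLinearMap =
      C n ⊓ LinearMap.ker (D.transport b) := by
  rw [← hn]
  ext x
  constructor
  · rintro ⟨y, ⟨hy, hy'⟩, rfl⟩
    refine ⟨⟨y, hy, rfl⟩, ?_⟩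
    change D.transport b (equivGC b y) = 0
    rw [transport_equivGC, show D.d y = 0 from hy', map_zero]
  · rintro ⟨⟨y, hy, rfl⟩, hy'⟩
    refine ⟨y, ⟨hy, ?_⟩, rfl⟩
    change D.transport b (equivGC b y) = 0 at hy'
    rw [transport_equivGC] at hy'
    exact (map_eq_zero_iff _ (equivGC b).injective).1 hy'

theorem map_coboundaries {n : ℕ} (hn : (Subalgebra.toSubmodule S ⊓ degreePart V n).map
    (equivGC b).toLinearMap = C n) : (D.coboundaries S (n + 1)).map (equivGC b).toLinearMap =
      (C n).map (D.transport b) := by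
  rw [← hn, coboundaries, ← Submodule.map_comp, ← Submodule.map_comp]
  congr 1
  ext x
  simp [transport]

theorem finrank_map_equivGC (A : Submodule ℚ (FreeGCA V)) :
    Module.finrank ℚ (A.map (equivGC b).toLinearMap) = Module.finrank ℚ A :=
  (Submodule.equivMapOfInjective (equivGC b).toLinearMap (equivGC b).injective A).finrank_eq.symm

theorem finite_cohomology {n : ℕ} [FiniteDimensional ℚ (C n)]
    (hn : (Subalgebra.toSubmodule S ⊓ degreePart V n).map (equivGC b).toLinearMap = C n) :
    Module.Finite ℚ (D.cocycles S n) := by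
  have : FiniteDimensional ℚ (C n ⊓ LinearMap.ker (D.transport b) : Submodule ℚ (GC p)) :=
    Submodule.finiteDimensional_of_le inf_le_left
  rw [← map_cocycles b hn] at this
  exact Module.Finite.equiv
    (Submodule.equivMapOfInjective (equivGC b).toLinearMap (equivGC b).injective (D.cocycles S n)).symm

theorem finrank_quotient {E : Type*} [AddCommGroup E] [Module ℚ E] {A B : Submodule ℚ E}
    [Module.Finite ℚ A] (h : B ≤ A) :
    Module.finrank ℚ (A ⧸ B.submoduleOf A) + Module.finrank ℚ B = Module.finrank ℚ A := by
  rw [← Submodule.finrank_quotient_add_finrank (B.submoduleOf A),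
    (Submodule.submoduleOfEquivOfLe h).finrank_eq]

theorem finrank_cohomology_zero [FiniteDimensional ℚ (C 0)]
    (hn : (Subalgebra.toSubmodule S ⊓ degreePart V 0).map (equivGC b).toLinearMap = C 0) :
    (Module.finrank ℚ (D.cohomology S 0) : ℤ) =
      zdim (D.transport b) C 0 - bdim (D.transport b) C 0 := by
  have := finite_cohomology (D := D) b hn
  have h := finrank_quotient (A := D.cocycles S 0) (B := D.coboundaries S 0) bot_le
  have h0 : Module.finrank ℚ (D.coboundaries S 0) = 0 := finrank_bot ..
  rw [h0, ← finrank_map_equivGC b (D.cocycles S 0), map_cocycles b hn, add_zero] at h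
  rw [h, zdim, bdim, sub_zero]

theorem finrank_cohomology_succ {n : ℕ} [FiniteDimensional ℚ (C (n + 1))]
    (hn : (Subalgebra.toSubmodule S ⊓ degreePart V n).map (equivGC b).toLinearMap = C n)
    (hn' : (Subalgebra.toSubmodule S ⊓ degreePart V (n + 1)).map (equivGC b).toLinearMap =
      C (n + 1)) (hC : ∀ x ∈ C n, D.transport b x ∈ C (n + 1)) :
    (Module.finrank ℚ (D.cohomology S (n + 1)) : ℤ) =
      zdim (D.transport b) C (n + 1) - bdim (D.transport b) C (n + 1) := by
  have := finite_cohomology (D := D) b hn'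
  have hle : D.coboundaries S (n + 1) ≤ D.cocycles S (n + 1) := by
    rw [← Submodule.map_le_map_iff_of_injective (f := (equivGC b).toLinearMap)
      (equivGC b).injective, map_cocycles b hn', map_coboundaries b hn]
    rintro _ ⟨x, hx, rfl⟩
    refine ⟨hC x hx, ?_⟩
    obtain ⟨x, rfl⟩ := (equivGC b).surjective x
    change D.transport b (D.transport b _) = 0
    rw [transport_equivGC, transport_equivGC, D.d_d, map_zero]
  have h : Module.finrank ℚ (D.cohomology S (n + 1)) + _ = _ := finrank_quotient hle
  rw [← finrank_map_equivGC b (D.cocycles S (n + 1)), map_cocycles b hn',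
    ← finrank_map_equivGC b (D.coboundaries S (n + 1)), map_coboundaries b hn] at h
  rw [zdim, bdim]
  omega

end Cohomology

end Differential
end Sullivan

/-! ### Finite direct sums and the conclusion. -/

namespace Sullivan
open GC

section DirectSum

variable {M : ℕ → Type*} [∀ n, AddCommGroup (M n)] [∀ n, Module ℚ (M n)]

/-- A direct sum with vanishing tail is a finite product. -/
def directSumEquivPi {K : ℕ} (h : ∀ n, K ≤ n → Subsingleton (M n)) :
    (⨁ n, M n) ≃ₗ[ℚ] ∀ i : Fin K, M i :=
  LinearEquiv.ofBijective (LinearMap.pi fun i : Fin K => DirectSum.component ℚ ℕ M i) (by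
    constructor
    · intro x y hxy
      refine DirectSum.ext_component ℚ fun n => ?_
      by_cases hn : n < K
      · exact congrFun hxy ⟨n, hn⟩
      · have := h n (not_lt.1 hn)
        exact Subsingleton.elim _ _
    · intro g
      refine ⟨∑ i : Fin K, DirectSum.lof ℚ ℕ M i (g i), ?_⟩
      funext j
      rw [LinearMap.pi_apply, map_sum, Finset.sum_eq_single j]
      · exact DirectSum.component.lof_self ..
      · intro i _ hij
        rw [DirectSum.component.of, dif_neg fun h => hij (Fin.ext h)]
      · intro h
        exact absurd (Finset.mem_univ j) h)

theorem finite_directSum [∀ n, Module.Finite ℚ (M n)] {K : ℕ}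
    (h : ∀ n, K ≤ n → Subsingleton (M n)) : Module.Finite ℚ (⨁ n, M n) :=
  Module.Finite.equiv (directSumEquivPi h).symm

theorem finrank_directSum_eq [∀ n, Module.Finite ℚ (M n)] {K : ℕ}
    (h : ∀ n, K ≤ n → Subsingleton (M n)) :
    Module.finrank ℚ (⨁ n, M n) = ∑ n ∈ Finset.range K, Module.finrank ℚ (M n) := by
  rw [(directSumEquivPi h).finrank_eq, Module.finrank_pi_fintype,
    Fin.sum_univ_eq_sum_range (fun n => Module.finrank ℚ (M n))]

theorem component_surjective (n : ℕ) : Function.Surjective (DirectSum.component ℚ ℕ M n) :=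
  fun x => ⟨DirectSum.lof ℚ ℕ M n x, DirectSum.component.lof_self ..⟩

theorem finite_of_finite_directSum (h : Module.Finite ℚ (⨁ n, M n)) (n : ℕ) :
    Module.Finite ℚ (M n) :=
  Module.Finite.of_surjective _ (component_surjective n)

theorem exists_subsingleton_of_finite_directSum (h : Module.Finite ℚ (⨁ n, M n)) :
    ∃ K : ℕ, ∀ n, K < n → Subsingleton (M n) := by
  classical
  obtain ⟨s, hs⟩ := h.fg_top
  refine ⟨s.sup fun x => (DFinsupp.support x).sup id, fun n hn => ?_⟩
  -- Finitely many generators have finitely supported components, so beyond the largest index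
  -- occurring in them each component map vanishes on generators and hence everywhere.
  have h0 : DirectSum.component ℚ ℕ M n = 0 := by
    refine LinearMap.ext_on hs fun x hx => ?_
    by_contra hne
    have h1 : n ∈ DFinsupp.support x := DFinsupp.mem_support_iff.2 hne
    have h2 : n ≤ (DFinsupp.support x).sup id := Finset.le_sup (f := id) h1
    have h3 := Finset.le_sup (f := fun x : ⨁ n, M n => (DFinsupp.support x).sup id) hx
    exact absurd (h2.trans h3) (not_le.2 hn)
  refine subsingleton_of_forall_eq 0 fun x => ?_
  obtain ⟨y, rfl⟩ := component_surjective n x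
  rw [h0, LinearMap.zero_apply]

theorem subsingleton_of_directSum (h : Subsingleton (⨁ n, M n)) (n : ℕ) : Subsingleton (M n) :=
  (component_surjective n).subsingleton

end DirectSum

theorem exists_basis {V : ℕ → Type*} [∀ i, AddCommGroup (V i)] [∀ i, Module ℚ (V i)]
    (h : Module.Finite ℚ (⨁ i, V i)) : ∃ (ι : Type) (p : ι → ℕ) (_ : Fintype ι),
      Nonempty (∀ n, Module.Basis {i // p i = n} ℚ (V n)) := by
  have hV := finite_of_finite_directSum h
  obtain ⟨K, hK⟩ := exists_subsingleton_of_finite_directSum h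
  refine ⟨Σ n, Fin (Module.finrank ℚ (V n)), Sigma.fst, ?_, ⟨fun n =>
    (Module.finBasis ℚ (V n)).reindex (Equiv.sigmaSubtype (β := fun n => Fin (Module.finrank ℚ (V n))) n).symm⟩⟩
  refine Fintype.ofInjective (β := Σ n : Fin (K + 1), Fin (Module.finrank ℚ (V n)))
    (fun x => ⟨⟨x.1, ?_⟩, x.2⟩) ?_
  · by_contra hx
    have := hK x.1 (by omega)
    have h0 : Module.finrank ℚ (V x.1) = 0 := Module.finrank_zero_of_subsingleton
    exact absurd x.2.2 (by omega)
  · rintro ⟨n, i⟩ ⟨m, j⟩ hij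
    simp only [Sigma.mk.injEq, Fin.mk.injEq] at hij
    obtain ⟨rfl, h⟩ := hij
    simpa using h

namespace Differential

variable {V : ℕ → Type*} [∀ i, AddCommGroup (V i)] [∀ i, Module ℚ (V i)]
variable {ι : Type*} {p : ι → ℕ} [DecidableEq ι] [GenList ι] [Fintype ι]
variable (b : ∀ n, Module.Basis {i // p i = n} ℚ (V n)) {D : Differential V}

include b in
theorem finrank_gen (n : ℕ) : Module.finrank ℚ (V n) = MinDGA.genCard p n := by
  rw [Module.finrank_eq_card_basis (b n), Fintype.card_subtype]
  rfl

include b in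
theorem finite_H (h2 : ∀ i, 2 ≤ p i) (hm : D.IsMinimal) (n : ℕ) : Module.Finite ℚ (D.H n) := by
  have := (D.toMinDGA b h2 hm).finiteDimensional_comp n
  have := finite_cohomology (D := D) (C := MinDGA.comp p) b (map_degreePart b n)
  exact Module.Finite.quotient ..

theorem finrank_H (h2 : ∀ i, 2 ≤ p i) (hm : D.IsMinimal) (n : ℕ) :
    (Module.finrank ℚ (D.H n) : ℤ) = (D.toMinDGA b h2 hm).hdim n := by
  have := (D.toMinDGA b h2 hm).finiteDimensional_comp n
  rcases n with _ | n
  · exact finrank_cohomology_zero b (C := MinDGA.comp p) (map_degreePart b 0)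
  · exact finrank_cohomology_succ b (C := MinDGA.comp p) (map_degreePart b n)
      (map_degreePart b (n + 1))
      fun x hx => MinDGA.dec_le _ ((D.toMinDGA b h2 hm).d_mem_dec hx)

include b in
theorem finite_L (h2 : ∀ i, 2 ≤ p i) (hm : D.IsMinimal) (n : ℕ) :
    Module.Finite ℚ (D.L (n + 2)) := by
  have := (D.toMinDGA b h2 hm).finiteDimensional_dec (n + 2)
  have := finite_cohomology (D := D) (C := MinDGA.dec p) b
    (map_subalgebraGenBy b h2 (n := n + 2) (k := n + 2 - 2) (by omega) (by omega))
  exact Module.Finite.quotient ..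

theorem finrank_L (h2 : ∀ i, 2 ≤ p i) (hm : D.IsMinimal) (n : ℕ) :
    (Module.finrank ℚ (D.L (n + 2)) : ℤ) = (D.toMinDGA b h2 hm).ldim (n + 2) := by
  have := (D.toMinDGA b h2 hm).finiteDimensional_dec (n + 1 + 1)
  exact finrank_cohomology_succ b (C := MinDGA.dec p) (n := n + 1)
    (map_subalgebraGenBy b h2 (n := n + 1) (k := n + 2 - 2) (by omega) (by omega))
    (map_subalgebraGenBy b h2 (n := n + 2) (k := n + 2 - 2) (by omega) (by omega))
    fun x hx => (D.toMinDGA b h2 hm).d_mem_dec (MinDGA.dec_le _ hx)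

theorem vanishAbove (h2 : ∀ i, 2 ≤ p i) (hm : D.IsMinimal) {K : ℕ}
    (hK : ∀ n, K < n → Subsingleton (D.H n)) : (D.toMinDGA b h2 hm).VanishAbove K := by
  intro n hn z hz hdz
  obtain ⟨n, rfl⟩ : ∃ m : ℕ, n = (m + 1 : ℕ) := ⟨(n - 1).toNat, by omega⟩
  have h0 := hK (n + 1) (by exact_mod_cast hn)
  have hle : D.cocycles ⊤ (n + 1) ≤ D.coboundaries ⊤ (n + 1) :=
    Submodule.submoduleOf_eq_top.1 (Submodule.Quotient.subsingleton_iff.1 h0)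
  have h3 := Submodule.map_mono (f := (equivGC b).toLinearMap) hle
  rw [map_cocycles b (C := MinDGA.comp p) (map_degreePart b (n + 1)),
    map_coboundaries b (C := MinDGA.comp p) (map_degreePart b n)] at h3
  obtain ⟨y, hy, rfl⟩ := h3 ⟨hz, hdz⟩
  exact ⟨y, part_mono (fun γ h => by push_cast; omega) hy, rfl⟩

theorem IsElliptic.finrank_Lodd_le (hD : D.IsElliptic) :
    (Module.Finite ℚ D.Leven ∧ Module.Finite ℚ D.Lodd ∧
      Module.finrank ℚ D.Lodd ≤ Module.finrank ℚ D.Leven) ∧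
    (Subsingleton D.Leven →
      (∀ i, 2 ≤ i → Nonempty (D.H i ≃ₗ[ℚ] V i)) ∧
      Module.finrank ℚ (⨁ i, D.H i) = Module.finrank ℚ (⨁ i, V i) + 1) := by
  classical
  obtain ⟨ι, p, _, ⟨b⟩⟩ := exists_basis hD.finite_generators
  let _ : GenList ι := ⟨Finset.univ.toList, Finset.nodup_toList _, fun i => by simp⟩
  have h2 : ∀ i, 2 ≤ p i := by
    intro i
    by_contra hi
    have h0 : Subsingleton (V (p i)) := by
      rcases Nat.lt_or_ge (p i) 1 with h | h
      · rw [show p i = 0 by omega]; exact hD.sullivan.1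
      · rw [show p i = 1 by omega]; exact hD.simplyConnected
    exact (b (p i)).ne_zero ⟨i, rfl⟩ (Subsingleton.elim _ _)
  have hm := hD.minimal
  obtain ⟨K, hK⟩ := exists_subsingleton_of_finite_directSum (M := D.H) hD.finite_cohomology
  have hv := vanishAbove b h2 hm hK
  have hLf := finite_L b h2 hm
  have hHf := finite_H b h2 hm
  have hVf := finite_of_finite_directSum hD.finite_generators
  obtain ⟨N, hN⟩ := hv.exists_ldim_eq_zero
  obtain ⟨M, hM⟩ := hv.sum_ldim_le
  have hL0 : ∀ n, N ≤ n → Subsingleton (D.L (n + 2)) := fun n hn => by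
    have := hLf n
    refine (Module.finrank_zero_iff (R := ℚ)).1 ?_
    have := finrank_L b h2 hm n
    rw [hN _ (by omega)] at this
    exact_mod_cast this
  have he : ∀ k, Module.Finite ℚ (D.L (2 * k + 4)) := fun k => hLf (2 * k + 2)
  have ho : ∀ k, Module.Finite ℚ (D.L (2 * k + 5)) := fun k => hLf (2 * k + 3)
  have he0 : ∀ k, N + M + 1 ≤ k → Subsingleton (D.L (2 * k + 4)) :=
    fun k hk => hL0 (2 * k + 2) (by omega)
  have ho0 : ∀ k, N + M + 1 ≤ k → Subsingleton (D.L (2 * k + 5)) :=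
    fun k hk => hL0 (2 * k + 3) (by omega)
  refine ⟨⟨finite_directSum he0, finite_directSum ho0, ?_⟩, fun hs => ?_⟩
  · rw [finrank_directSum_eq he0, finrank_directSum_eq ho0]
    zify
    have h := hM (N + M + 1) (by omega)
    convert h using 2 with k _ k _
    · exact finrank_L b h2 hm (2 * k + 3)
    · exact finrank_L b h2 hm (2 * k + 2)
  · have hl : ∀ k, (D.toMinDGA b h2 hm).ldim (2 * k + 4) = 0 := fun k => by
      have h0 : Subsingleton (D.L (2 * k + 4)) := subsingleton_of_directSum (M := fun k => D.L (2 * k + 4)) hs k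
      have := finrank_L b h2 hm (2 * k + 2)
      rw [show 2 * k + 2 + 2 = 2 * k + 4 from rfl] at this
      rw [← this, Module.finrank_zero_of_subsingleton]
      rfl
    have hHV : ∀ i, 2 ≤ i → Module.finrank ℚ (D.H i) = Module.finrank ℚ (V i) := fun i hi => by
      have := finrank_H b h2 hm i
      rw [hv.hdim_eq_genCard hl hi, ← finrank_gen b i] at this
      exact_mod_cast this
    refine ⟨fun i hi => FiniteDimensional.nonempty_linearEquiv_of_finrank_eq (hHV i hi), ?_⟩
    obtain ⟨K', hK'⟩ := exists_subsingleton_of_finite_directSum hD.finite_generators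
    have e1 := finrank_directSum_eq (M := D.H) (K := K + K' + 2) fun n hn => hK n (by omega)
    have e2 := finrank_directSum_eq (M := V) (K := K + K' + 2) fun n hn => hK' n (by omega)
    have hH0 : Module.finrank ℚ (D.H 0) = 1 := by
      have := finrank_H b h2 hm 0
      rw [MinDGA.hdim_zero] at this
      exact_mod_cast this
    have hH1 : Module.finrank ℚ (D.H 1) = 0 := by
      have := finrank_H b h2 hm 1
      rw [MinDGA.hdim_one] at this
      exact_mod_cast this
    have hV0 : Module.finrank ℚ (V 0) = 0 :=
      have := hD.sullivan.1
      Module.finrank_zero_of_subsingleton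
    have hV1 : Module.finrank ℚ (V 1) = 0 :=
      have := hD.simplyConnected
      Module.finrank_zero_of_subsingleton
    have hsum : ∀ f : ℕ → ℕ, ∑ n ∈ Finset.range (K + K' + 2), f n =
        ∑ n ∈ Finset.range (K + K'), f (n + 2) + f 1 + f 0 := fun f => by
      rw [Finset.sum_range_succ', Finset.sum_range_succ']
    -- From degree 2 on the two sums agree term by term. In degrees 0 and 1 only `H^0`, of dimension
    -- 1, contributes.
    rw [e1, e2, hsum fun n => Module.finrank ℚ (D.H n), hsum fun n => Module.finrank ℚ (V n),
      Finset.sum_congr rfl fun n _ => hHV (n + 2) (by omega), hH0, hH1, hV0, hV1]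

end Differential
end Sullivan

end

theorem corollary2p7 {V : ℕ → Type*} [∀ i, AddCommGroup (V i)] [∀ i, Module ℚ (V i)]
    (D : Sullivan.Differential V) (hD : D.IsElliptic) :
    (Module.Finite ℚ D.Leven ∧ Module.Finite ℚ D.Lodd ∧
      Module.finrank ℚ D.Lodd ≤ Module.finrank ℚ D.Leven) ∧
    (Subsingleton D.Leven →
      (∀ i, 2 ≤ i → Nonempty (D.H i ≃ₗ[ℚ] V i)) ∧
      Module.finrank ℚ (⨁ i, D.H i) = Module.finrank ℚ (⨁ i, V i) + 1) :=
  hD.finrank_Lodd_le
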